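/- Let $\alpha,\mu>0$ and consider in $\mathbb{R}^3$ the second-grade fluid equations $$\partial_t(u-\alpha\Delta u)-\mu\Delta u+\operatorname{curl}(u-\alpha\Delta u)\times u+\nabla p=0,\qquad \operatorname{div}u=0,\qquad u(0)=u_0 .$$ *Notation.* $\|v\|_{H^1_\alpha}^2=\|v\|_{L^2}^2+\alpha\|\nabla v\|_{L^2}^2$; $V=\{v\in H^1(\mathbb{R}^3)^3:\operatorname{div}v=0\}$; $V_2=\{v\in V:\operatorname{curl}(v-\alpha\Delta v)\in L^2(\mathbb{R}^3)^3\}$ with $\|v\|_{V_2}^2=\|v\|_{H^1_\alpha}^2+\|\operatorname{curl}(v-\alpha\Delta v)\|_{L^2}^2$. Put $b(a,v,c)=\sum_{i,j}\int a_j\,\partial_jv_i\,c_i\,dx$. A (global) weak solution is a function $u$ such that, for every $T>0$, $u\in L^\infty(0,T;V_2)$ and $u'\in L^\infty(0,T;V)$, with $u(0)=u_0$ (for the representative of $u$ that is continuous in time), and such that for a.e. $t>0$ and every divergence-free $\phi\in C_c^\infty(\mathbb{R}^3)^3$ $$(u',\phi)+\alpha(\nabla u',\nabla\phi)+\mu(\nabla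 u,\nabla\phi)+b(u,u,\phi)-\alpha\,b(u,\Delta u,\phi)+\alpha\,b(\phi,\Delta u,u)=0 .$$ For $v\in L^2(\mathbb{R}^3)^3$ with Fourier transform $\widehat v(\xi)=\int e^{-i\xi\cdot x}v(x)\,dx$ and $r\in\mathbb{R}$ let $$P_r(v)_-=\liminf_{\rho\to0^+}\rho^{-2r-3}\int_{|\xi|\le\rho}|\widehat v|^2d\xi,\qquad P_r(v)_+=\limsup_{\rho\to0^+}\rho^{-2r-3}\int_{|\xi|\le\rho}|\widehat v|^2d\xi,$$ and let $r^*_+(v)=\sup\{r\in\mathbb{R}:P_r(v)_+<\infty\}$ be the upper decay character. **Corollary.** There is $\epsilon>0$, depending only on $\alpha$ and $\mu$, with the following property. Let $u_0\in H^4(\mathbb{R}^3)^3$ with $\operatorname{div}u_0=0$ and $\|u_0\|_{V_2}<\epsilon$. Suppose that $r^*:=r^*_+(u_0)\in(-3/2,1)$ and that $P_{r^*}(u_0)_->0$ (both hold with this $r^*$ in particular when $P_{r^*}(u_0)_->0$ and $P_{r^*}(u_0)_+<\infty$ for some $r^*\in(-3/2,1)$, i.e. when $u_0$ has decay character $r^*$).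 Then every global weak solution $u$ with initial value $u_0$ satisfies $$\|u(t)\|_{H^1_\alpha}^2\ \ge\ C\,(t+1)^{-\min\{\frac32+r^*,\frac52\}}\qquad\text{for all }t\ge0,$$ where, for any fixed $\rho_0>0$, the constant $C>0$ depends only on $\alpha$, $\mu$, $r^*$, $\|u_0\|_{H^1_\alpha}$, $\rho_0$ and the low-frequency profile $\rho\mapsto\int_{|\xi|\le\rho}|\widehat{u_0}|^2d\xi$, $0<\rho\le\rho_0$. -/

import Mathlib

open MeasureTheory Filter Topology
open scoped ENNReal ContDiff SchwartzMap LineDeriv Laplacian FourierTransform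

noncomputable section

namespace SecondGrade

/-- Physical space `ℝ³` with its Euclidean norm. -/
abbrev E3 : Type := EuclideanSpace ℝ (Fin 3)

/-- The real Lebesgue space `L²(ℝ³)`. -/
abbrev L2 : Type := Lp ℝ 2 (volume : Measure E3)

/-- Vector fields in `L²(ℝ³)³`, given by their three components. -/
abbrev VF : Type := Fin 3 → L2

/-- The `j`-th vector of the standard basis of `ℝ³`. -/
def stdVec (j : Fin 3) : E3 := EuclideanSpace.single j 1

/-- A real `L²` function regarded as a complex-valued one. -/
def toComplex (f : L2) : Lp ℂ 2 (volume : Measure E3) := Complex.ofRealCLM.compLp f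

/-- The tempered distribution defined by a real `L²` function. -/
def toDist (f : L2) : 𝓢'(E3, ℂ) := Lp.toTemperedDistribution (toComplex f)

theorem toDist_injective : Function.Injective toDist := by
  intro f g h
  have h1 : toComplex f = toComplex g :=
    LinearMap.ker_eq_bot.mp (Lp.ker_toTemperedDistributionCLM_eq_bot (F := ℂ)
      (μ := (volume : Measure E3)) (p := 2)) h
  apply Lp.ext
  have hf := Complex.ofRealCLM.coeFn_compLp f
  have hg := Complex.ofRealCLM.coeFn_compLp g
  have h2 : (Complex.ofRealCLM.compLp f : E3 → ℂ) = Complex.ofRealCLM.compLp g := by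
    have h3 : Complex.ofRealCLM.compLp f = Complex.ofRealCLM.compLp g := h1
    rw [h3]
  filter_upwards [hf, hg] with x hx hy
  rw [h2] at hx
  have h4 := hx.symm.trans hy
  simpa using h4

open Classical in
/-- The real `L²` function that represents the distribution `T` (and `0` if there is none). -/
def l2Repr (T : 𝓢'(E3, ℂ)) : L2 := if h : ∃ g : L2, T = toDist g then h.choose else 0

theorem l2Repr_toDist (g : L2) : l2Repr (toDist g) = g := by
  have h : ∃ g' : L2, toDist g = toDist g' := ⟨g, rfl⟩
  unfold l2Repr
  rw [dif_pos h]
  exact (toDist_injective h.choose_spec).symm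

/-- The weak partial derivative `∂ⱼ f`, as an `L²` function. -/
def weakPartial (j : Fin 3) (f : L2) : L2 := l2Repr (∂_{stdVec j} (toDist f))

/-- The weak Laplacian `Δ v` of a vector field, componentwise, as an `L²` function. -/
def weakLaplacian (v : VF) : VF := fun i => l2Repr (Δ (toDist (v i)))

/-- `v ∈ Hˢ(ℝ³)³`. -/
def MemHs (s : ℝ) (v : VF) : Prop := ∀ i, TemperedDistribution.MemSobolev s 2 (toDist (v i))

/-- `div v = 0` in the sense of distributions. -/
def IsDivFree (v : VF) : Prop := ∑ i, ∂_{stdVec i} (toDist (v i)) = 0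

/-- The curl of a vector-valued distribution, `(curl w)ᵢ = ∂ᵢ₊₁ wᵢ₊₂ - ∂ᵢ₊₂ wᵢ₊₁` with the
indices taken modulo `3`. -/
def curlDist (w : Fin 3 → 𝓢'(E3, ℂ)) : Fin 3 → 𝓢'(E3, ℂ) :=
  fun i => ∂_{stdVec (i + 1)} (w (i + 2)) - ∂_{stdVec (i + 2)} (w (i + 1))

/-- The distribution `curl (v - α Δ v)`. -/
def curlFiltered (α : ℝ) (v : VF) : Fin 3 → 𝓢'(E3, ℂ) :=
  curlDist (fun i => toDist (v i) - (α : ℂ) • Δ (toDist (v i)))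

/-- The space `V(ℝ³)` of divergence-free fields in `H¹(ℝ³)³`. -/
def MemV (v : VF) : Prop := MemHs 1 v ∧ IsDivFree v

/-- The space `V₂(ℝ³)` of those `v ∈ V(ℝ³)` with `curl (v - α Δ v) ∈ L²(ℝ³)³`. -/
def MemV2 (α : ℝ) (v : VF) : Prop :=
  MemV v ∧ ∀ i, ∃ g : L2, curlFiltered α v i = toDist g

/-- `‖v‖²_{H¹_α} = ‖v‖²_{L²} + α ‖∇v‖²_{L²}`. -/
def h1AlphaNormSq (α : ℝ) (v : VF) : ℝ :=
  ∑ i, ‖v i‖ ^ 2 + α * ∑ i, ∑ j, ‖weakPartial j (v i)‖ ^ 2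

/-- The norm `‖v‖_{H¹_α}`. -/
def h1AlphaNorm (α : ℝ) (v : VF) : ℝ := Real.sqrt (h1AlphaNormSq α v)

/-- `‖v‖_{V₂} = (‖v‖²_{L²} + α ‖∇v‖²_{L²} + ‖curl (v - α Δ v)‖²_{L²})^{1/2}`. -/
def v2Norm (α : ℝ) (v : VF) : ℝ :=
  Real.sqrt (h1AlphaNormSq α v + ∑ i, ‖l2Repr (curlFiltered α v i)‖ ^ 2)

/-- Divergence-free test fields in `C_c^∞(ℝ³)³`. -/
structure IsTestField (φ : Fin 3 → E3 → ℝ) : Prop where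
  smooth : ∀ i, ContDiff ℝ ∞ (φ i)
  compact_support : ∀ i, HasCompactSupport (φ i)
  div_free : ∀ x, ∑ i, fderiv ℝ (φ i) x (stdVec i) = 0

/-- `(v, φ) = ∑ᵢ ∫ vᵢ φᵢ`. -/
def pair (v : VF) (φ : Fin 3 → E3 → ℝ) : ℝ := ∑ i, ∫ x, v i x * φ i x

/-- `(∇v, ∇φ) = ∑ᵢⱼ ∫ ∂ⱼvᵢ ∂ⱼφᵢ`. -/
def gradPair (v : VF) (φ : Fin 3 → E3 → ℝ) : ℝ :=
  ∑ i, ∑ j, ∫ x, weakPartial j (v i) x * fderiv ℝ (φ i) x (stdVec j)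

/-- The trilinear form `b(a, v, c) = ∑ᵢⱼ ∫ aⱼ ∂ⱼvᵢ cᵢ`. -/
def trilinear (a : Fin 3 → E3 → ℝ) (v : VF) (c : Fin 3 → E3 → ℝ) : ℝ :=
  ∑ i, ∑ j, ∫ x, a j x * weakPartial j (v i) x * c i x

/-- `u` is a (global) weak solution of the second-grade fluid equations
`∂ₜ(u - αΔu) - μΔu + curl(u - αΔu) × u + ∇p = 0`, `div u = 0`, `u(0) = u₀` in `ℝ³`:
for every `T > 0` one has `u ∈ L^∞(0,T;V₂)` and `u' ∈ L^∞(0,T;V)`, and the weak formulation holds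
for a.e. time and all divergence-free test fields. The condition `time_deriv` says that the field `u'` is the
(weak) time derivative of `u`, that `u` is the representative continuous in time, and that
`u(0) = u₀`. -/
structure IsWeakSolutionWith (α μ : ℝ) (u₀ : VF) (u u' : ℝ → VF) : Prop where
  meas : ∀ T > 0, AEStronglyMeasurable u (volume.restrict (Set.Ioo 0 T))
  bound : ∀ T > 0, ∃ M : ℝ, ∀ᵐ t ∂(volume.restrict (Set.Ioo 0 T)),
    MemV2 α (u t) ∧ v2Norm α (u t) ≤ M
  meas_deriv : ∀ T > 0, AEStronglyMeasurable u' (volume.restrict (Set.Ioo 0 T))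
  bound_deriv : ∀ T > 0, ∃ M : ℝ, ∀ᵐ t ∂(volume.restrict (Set.Ioo 0 T)),
    MemV (u' t) ∧ h1AlphaNorm α (u' t) ≤ M
  time_deriv : ∀ t ≥ 0, u t = u₀ + ∫ s in (0 : ℝ)..t, u' s
  equation : ∀ᵐ t ∂(volume.restrict (Set.Ioi (0 : ℝ))), ∀ φ : Fin 3 → E3 → ℝ, IsTestField φ →
    pair (u' t) φ + α * gradPair (u' t) φ + μ * gradPair (u t) φ
      + trilinear (fun i => u t i) (u t) φ
      - α * trilinear (fun i => u t i) (weakLaplacian (u t)) φ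
      + α * trilinear φ (weakLaplacian (u t)) (fun i => u t i) = 0

/-- `u` is a global weak solution with initial value `u₀`; see `IsWeakSolutionWith`. -/
def IsWeakSolution (α μ : ℝ) (u₀ : VF) (u : ℝ → VF) : Prop :=
  ∃ u' : ℝ → VF, IsWeakSolutionWith α μ u₀ u u'

/-- The `i`-th component of `v̂(ξ) = ∫ e^{-i ξ·x} v(x) dx`. Mathlib's transform has the kernel
`e^{-2πi ξ·x}`, hence the rescaling of the frequency. -/
def vhat (v : VF) (i : Fin 3) (ξ : E3) : ℂ := (𝓕 (toComplex (v i))) ((2 * Real.pi)⁻¹ • ξ)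

/-- `∫_{|ξ| ≤ ρ} |v̂(ξ)|² dξ`. -/
def lowFreqEnergy (v : VF) (ρ : ℝ) : ℝ≥0∞ :=
  ∫⁻ ξ in Metric.closedBall (0 : E3) ρ, ∑ i, ‖vhat v i ξ‖ₑ ^ 2

/-- The upper decay indicator `P_r(v)₊ = limsup_{ρ → 0+} ρ^{-2r-3} ∫_{|ξ| ≤ ρ} |v̂|²`. -/
def upperDecayIndicator (r : ℝ) (v : VF) : ℝ≥0∞ :=
  limsup (fun ρ : ℝ => ENNReal.ofReal (ρ ^ (-2 * r - 3)) * lowFreqEnergy v ρ) (𝓝[>] 0)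

/-- The lower decay indicator `P_r(v)₋ = liminf_{ρ → 0+} ρ^{-2r-3} ∫_{|ξ| ≤ ρ} |v̂|²`. -/
def lowerDecayIndicator (r : ℝ) (v : VF) : ℝ≥0∞ :=
  liminf (fun ρ : ℝ => ENNReal.ofReal (ρ ^ (-2 * r - 3)) * lowFreqEnergy v ρ) (𝓝[>] 0)

/-- The upper decay character `r*₊(v) = sup {r ∈ ℝ : P_r(v)₊ < ∞}`, an extended real number. -/
def upperDecayCharacter (v : VF) : EReal :=
  sSup ((fun r : ℝ => (r : EReal)) '' {r : ℝ | upperDecayIndicator r v < ⊤})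

end SecondGrade

end

/-! Let `E(t)` be the squared `H¹_α` norm of `u(t)` and `Y(ρ,t) ≤ E(t)` the part of it carried by
the frequencies `|ξ| ≤ ρ` (`lowEnergy`). The lower bound comes from following `Y(ρ,·)` up to time
`t` with `ρ` a small multiple of `(1+t)^(-1/2)`: on that scale viscosity removes only a fraction of
`√Y(ρ,0)`, so the question is how much the nonlinearity can remove.

Two facts control the nonlinearity. The pressure disappears frequency by frequency, because the curl
of the momentum residual vanishes and the residual is thus parallel to `ξ`, while `û ⟂ ξ`
(`WeakEquation.fourier`). Up to a gradient, the nonlinear term is the divergence of a tensor built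
from products of `u` and `∇u` and their first derivatives (`MemV2.exists_nlFT_eq`), so its product
with `û` is at most `C|ξ|(1+|ξ|) E |û|`. Cauchy–Schwarz on the ball gives a flux of at most `C
ρ^(5/2) E √Y` (`exists_low_flux_bound`); dividing by `2√Y` and integrating in time, `√Y(ρ,t) ≥ (1 -
Cρ²t) √Y(ρ,0) - Cρ^(5/2) ∫₀ᵗ E`, up to a product of the two small terms. Positivity of the lower
decay indicator gives `√Y(ρ,0) ≥ κ ρ^(3/2+r)`. With `ρ = h (1+t)^(-1/2)` and `h` small this
dominates as soon as `∫₀ᵗ E ≤ J (1+t)^((1-r)/2)`, and then `E ≥ Y ≥ A (1+t)^(-(3/2+r))`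
(`exists_le_energy`).

The bound on `∫₀ᵗ E` follows from monotonicity of `E` when `r ≤ -1`. When `r > -1`, the upper decay
character gives `√Y(ρ,0) ≤ M ρ^((1+r)/2)`, and two rounds of Fourier splitting (`exists_energy_le`)
give `E ≤ A (1+t)^(-(1+r)/2)`.

A weak solution is differentiable in time only as an `L²`-valued curve and lies in `V₂` for almost
every time only. Energy identities are therefore written for the truncations `|ξ| ≤ n`, which are
continuous quadratic forms on `L²`, and the truncation error tends to zero because the nonlinear
term does no work (`exists_energy_error`). `EnergyEstimates` collects what the decay argument needs;
from there on it is a statement about real functions. -/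

noncomputable section

namespace SecondGrade

/-! ### Real test functions determine tempered distributions -/

/-- A real Schwartz function regarded as a complex-valued one. -/
def cplx : 𝓢(E3, ℝ) →L[ℝ] 𝓢(E3, ℂ) := SchwartzMap.postcompCLM Complex.ofRealCLM

@[simp]
theorem cplx_apply (ψ : 𝓢(E3, ℝ)) (x : E3) : cplx ψ x = (ψ x : ℂ) := rfl

/-- The smooth cutoff equal to `1` on the ball of radius `n + 1`. -/
def cutoff (n : ℕ) (x : E3) : ℝ :=
  (⟨1, 2, one_pos, one_lt_two⟩ : ContDiffBump (0 : E3)) (((n : ℝ) + 1)⁻¹ • x)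

theorem cutoff_contDiff (n : ℕ) : ContDiff ℝ ∞ (cutoff n) :=
  (ContDiffBump.contDiff _).comp (contDiff_const_smul _)

theorem cutoff_hasCompactSupport (n : ℕ) : HasCompactSupport (cutoff n) := by
  have h := (ContDiffBump.hasCompactSupport
    (⟨1, 2, one_pos, one_lt_two⟩ : ContDiffBump (0 : E3)))
  exact h.comp_smul (c := ((n : ℝ) + 1)⁻¹) (by positivity)

theorem cutoff_hasTemperateGrowth (n : ℕ) : (cutoff n).HasTemperateGrowth :=
  (cutoff_hasCompactSupport n).hasTemperateGrowth (cutoff_contDiff n)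

theorem cutoff_eq_one {n : ℕ} {x : E3} (hx : ‖x‖ ≤ n + 1) : cutoff n x = 1 := by
  apply ContDiffBump.one_of_mem_closedBall
  rw [mem_closedBall_zero_iff, norm_smul, Real.norm_of_nonneg (by positivity)]
  show _ ≤ (1 : ℝ)
  rw [inv_mul_le_iff₀ (by positivity)]
  simpa using hx

/-- Rescaling by `(n + 1)⁻¹` multiplies the `i`-th derivative by `(n + 1)⁻ⁱ ≤ 1`, so one bound
serves every `n`. -/
theorem exists_bound_iteratedFDeriv_cutoff (i : ℕ) :
    ∃ C : ℝ, 0 ≤ C ∧ ∀ n x, ‖iteratedFDeriv ℝ i (cutoff n) x‖ ≤ C := by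
  set χ : ContDiffBump (0 : E3) := ⟨1, 2, one_pos, one_lt_two⟩
  have hc : HasCompactSupport (iteratedFDeriv ℝ i χ) := χ.hasCompactSupport.iteratedFDeriv i
  obtain ⟨C, hC⟩ := (χ.contDiff (n := ⊤)).continuous_iteratedFDeriv
    (m := i) (mod_cast le_top) |>.bounded_above_of_compact_support hc
  refine ⟨C, (norm_nonneg _).trans (hC 0), fun n x => ?_⟩
  have h : iteratedFDeriv ℝ i (cutoff n) = fun x =>
      (((n : ℝ) + 1)⁻¹) ^ i • iteratedFDeriv ℝ i χ (((n : ℝ) + 1)⁻¹ • x) :=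
    iteratedFDeriv_comp_const_smul _ χ.contDiff
  rw [h]
  simp only [norm_smul, norm_pow]
  have h1 : ‖((n : ℝ) + 1)⁻¹‖ ≤ 1 := by
    rw [Real.norm_of_nonneg (by positivity)]
    exact inv_le_one_of_one_le₀ (by linarith [(Nat.cast_nonneg n : (0 : ℝ) ≤ n)])
  calc _ ≤ 1 * C := by
        gcongr
        · exact pow_le_one₀ (norm_nonneg _) h1
        · exact hC _
    _ = C := one_mul C

theorem tendsto_cutoff_smul (ψ : 𝓢(E3, ℝ)) :
    Tendsto (fun n => SchwartzMap.smulLeftCLM ℝ (cutoff n) ψ) atTop (𝓝 ψ) := by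
  rw [(schwartz_withSeminorms ℝ E3 ℝ).tendsto_nhds]
  rintro ⟨k, m⟩ ε hε
  choose C hC0 hC using exists_bound_iteratedFDeriv_cutoff
  set B : ℝ := ∑ i ∈ Finset.range (m + 1), (m.choose i) * (C i + 1) *
    SchwartzMap.seminorm ℝ (k + 1) (m - i) ψ
  have hB : 0 ≤ B := Finset.sum_nonneg fun i _ => by have := hC0 i; positivity
  obtain ⟨n₀, hn₀⟩ := exists_nat_gt (B / ε)
  filter_upwards [eventually_ge_atTop n₀] with n hn
  have hn1 : (0 : ℝ) < n + 1 := by positivity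
  refine lt_of_le_of_lt (SchwartzMap.seminorm_le_bound ℝ k m _
    (M := B / (n + 1)) (by positivity) fun x => ?_) ?_
  · set η : E3 → ℝ := fun x => cutoff n x - 1
    have hη : ContDiff ℝ ∞ η := (cutoff_contDiff n).sub contDiff_const
    have hcoe : ((SchwartzMap.smulLeftCLM ℝ (cutoff n) ψ - ψ : 𝓢(E3, ℝ)) : E3 → ℝ)
        = fun y => η y • ψ y := by
      ext y
      rw [sub_apply,
        SchwartzMap.smulLeftCLM_apply_apply (cutoff_hasTemperateGrowth n)]
      simp only [η, smul_eq_mul]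
      ring
    rw [hcoe]
    rcases lt_or_ge ‖x‖ (n + 1) with hx | hx
    · have hev : (fun y => η y • ψ y) =ᶠ[𝓝 x] fun _ => 0 := by
        have : ∀ᶠ y in 𝓝 x, ‖y‖ < n + 1 :=
          continuous_norm.continuousAt.eventually_lt continuousAt_const hx
        filter_upwards [this] with y hy
        simp [η, cutoff_eq_one hy.le]
      have h0 : iteratedFDeriv ℝ m (fun y => η y • ψ y) x = 0 := by
        rw [(hev.iteratedFDeriv ℝ m).eq_of_nhds]
        simp
      rw [h0]
      simp only [norm_zero, mul_zero]
      positivity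
    · have hηi : ∀ i, ‖iteratedFDeriv ℝ i η x‖ ≤ C i + 1 := by
        intro i
        have h1 : iteratedFDeriv ℝ i η x
            = iteratedFDeriv ℝ i (cutoff n) x - iteratedFDeriv ℝ i (fun _ : E3 => (1 : ℝ)) x :=
          iteratedFDeriv_sub_apply
            (((cutoff_contDiff n).of_le (mod_cast le_top)).contDiffAt)
            contDiff_const.contDiffAt
        rw [h1]
        refine (norm_sub_le _ _).trans (add_le_add (hC i n x) ?_)
        rcases i with _ | i
        · simp
        · rw [iteratedFDeriv_const_of_ne (Nat.succ_ne_zero i)]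
          simp
      have hle := norm_iteratedFDeriv_smul_le hη (ψ.smooth ⊤) x (n := m) (mod_cast le_top)
      -- The difference vanishes inside the ball of radius `n + 1`; outside it, one more power of
      -- `‖x‖` in the seminorm buys the factor `(n + 1)⁻¹`.
      have hxk : ‖x‖ ^ k ≤ ‖x‖ ^ (k + 1) / (n + 1) := by
        rw [le_div_iff₀ hn1, pow_succ]
        gcongr
      calc ‖x‖ ^ k * ‖iteratedFDeriv ℝ m (fun y => η y • ψ y) x‖
          ≤ ‖x‖ ^ (k + 1) / (n + 1) * ∑ i ∈ Finset.range (m + 1), (m.choose i) *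
            ‖iteratedFDeriv ℝ i η x‖ * ‖iteratedFDeriv ℝ (m - i) ψ x‖ := by gcongr
        _ = (∑ i ∈ Finset.range (m + 1), (m.choose i) *
            ‖iteratedFDeriv ℝ i η x‖ * (‖x‖ ^ (k + 1) * ‖iteratedFDeriv ℝ (m - i) ψ x‖))
            / (n + 1) := by
            rw [div_mul_eq_mul_div, Finset.mul_sum]
            congr 1
            exact Finset.sum_congr rfl fun i _ => by ring
        _ ≤ B / (n + 1) := by
            refine div_le_div_of_nonneg_right (Finset.sum_le_sum fun i _ => ?_) hn1.le
            have h1 := hηi i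
            have h2 := SchwartzMap.le_seminorm ℝ (k + 1) (m - i) ψ x
            have h3 := hC0 i
            gcongr
  · rw [div_lt_iff₀ hn1]
    rw [div_lt_iff₀ hε] at hn₀
    have : (n₀ : ℝ) ≤ n := mod_cast hn
    nlinarith

theorem eq_zero_of_forall_cplx {T : 𝓢'(E3, ℂ)} (h : ∀ ψ : 𝓢(E3, ℝ), T (cplx ψ) = 0) : T = 0 := by
  ext ψ
  have hψ : ψ = cplx (ψ.postcompCLM Complex.reCLM)
      + Complex.I • cplx (ψ.postcompCLM Complex.imCLM) := by
    ext x
    simp [mul_comm Complex.I]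
  rw [hψ, map_add, map_smul, h, h]
  simp

/-- A tempered distribution that vanishes on real test functions with compact support is zero. -/
theorem eq_zero_of_forall_hasCompactSupport {T : 𝓢'(E3, ℂ)}
    (h : ∀ ψ : 𝓢(E3, ℝ), HasCompactSupport ψ → T (cplx ψ) = 0) : T = 0 := by
  refine eq_zero_of_forall_cplx fun ψ => ?_
  have h1 : Tendsto (fun n => T (cplx (SchwartzMap.smulLeftCLM ℝ (cutoff n) ψ))) atTop
      (𝓝 (T (cplx ψ))) :=
    ((T.continuous.comp cplx.continuous).tendsto ψ).comp (tendsto_cutoff_smul ψ)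
  have h2 : ∀ n, T (cplx (SchwartzMap.smulLeftCLM ℝ (cutoff n) ψ)) = 0 := fun n => by
    apply h
    rw [SchwartzMap.smulLeftCLM_apply (cutoff_hasTemperateGrowth n)]
    exact (cutoff_hasCompactSupport n).smul_right
  simp only [h2] at h1
  exact tendsto_nhds_unique h1 tendsto_const_nhds

theorem lineDerivOp_cplx (m : E3) (ψ : 𝓢(E3, ℝ)) : ∂_{m} (cplx ψ) = cplx (∂_{m} ψ) := by
  ext x
  rw [cplx_apply, SchwartzMap.lineDerivOp_apply_eq_fderiv,
    SchwartzMap.lineDerivOp_apply_eq_fderiv]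
  have h := (Complex.ofRealCLM.hasFDerivAt.comp x (ψ.hasFDerivAt x)).fderiv
  have h2 : (cplx ψ : E3 → ℂ) = Complex.ofRealCLM ∘ ψ := rfl
  rw [h2, h]
  rfl

theorem coeFn_toComplex (f : L2) : ∀ᵐ x, (toComplex f : E3 → ℂ) x = (f x : ℂ) :=
  Complex.ofRealCLM.coeFn_compLp f

theorem toDist_apply (f : L2) (h : 𝓢(E3, ℂ)) : toDist f h = ∫ x, h x * (f x : ℂ) := by
  rw [toDist, Lp.toTemperedDistribution_apply]
  refine integral_congr_ae ?_
  filter_upwards [coeFn_toComplex f] with x hx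
  rw [hx, smul_eq_mul]

theorem toDist_cplx (f : L2) (ψ : 𝓢(E3, ℝ)) : toDist f (cplx ψ) = ((∫ x, f x * ψ x : ℝ) : ℂ) := by
  rw [toDist_apply, ← integral_complex_ofReal]
  refine integral_congr_ae (ae_of_all _ fun x => ?_)
  simp [mul_comm]

/-! ### Fourier transforms of `L²` functions and weak derivatives -/

/-- The Fourier transform of a real `L²` function. -/
def FT (f : L2) : Lp ℂ 2 (volume : Measure E3) := 𝓕 (toComplex f)

/-- The Fourier transform as a continuous real-linear map. -/
def FTL : L2 →L[ℝ] Lp ℂ 2 (volume : Measure E3) :=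
  ((Lp.fourierTransformₗᵢ E3 ℂ).toLinearIsometry.toContinuousLinearMap.restrictScalars ℝ).comp
    (Complex.ofRealCLM.compLpL 2 volume)

theorem FTL_apply (f : L2) : FTL f = FT f := rfl

theorem norm_toComplex (f : L2) : ‖toComplex f‖ = ‖f‖ := by
  rw [Lp.norm_def, Lp.norm_def]
  congr 1
  refine eLpNorm_congr_norm_ae ?_
  filter_upwards [coeFn_toComplex f] with x hx
  rw [hx, Complex.norm_real]

theorem norm_FT (f : L2) : ‖FT f‖ = ‖f‖ := (Lp.norm_fourier_eq _).trans (norm_toComplex f)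

theorem FT_injective : Function.Injective FT := by
  intro f g h
  rw [← sub_eq_zero, ← norm_eq_zero, ← norm_FT, ← FTL_apply, map_sub, FTL_apply, FTL_apply, h,
    sub_self, norm_zero]

theorem memLp_FT (f : L2) : MemLp (FT f) 2 volume := Lp.memLp _

theorem norm_sq_eq_integral (F : Lp ℂ 2 (volume : Measure E3)) : ‖F‖ ^ 2 = ∫ ξ, ‖F ξ‖ ^ 2 := by
  have h := @L2.inner_def E3 ℂ ℂ _ _ _ _ _ F F
  rw [inner_self_eq_norm_sq_to_K] at h
  have h2 : (∫ ξ, inner ℂ (F ξ) (F ξ)) = ((∫ ξ, ‖F ξ‖ ^ 2 : ℝ) : ℂ) := by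
    rw [← integral_complex_ofReal]
    refine integral_congr_ae (ae_of_all _ fun x => ?_)
    simp [inner_self_eq_norm_sq_to_K]
  rw [h2] at h
  have h3 := congrArg Complex.re h
  rw [Complex.ofReal_re] at h3
  rw [← h3, ← Complex.ofReal_re (‖F‖ ^ 2), Complex.ofReal_pow]
  rfl

theorem norm_sq_eq_integral_FT (f : L2) : ‖f‖ ^ 2 = ∫ ξ, ‖FT f ξ‖ ^ 2 := by
  rw [← norm_FT, norm_sq_eq_integral]

theorem integrable_norm_sq_FT (f : L2) : Integrable (fun ξ => ‖FT f ξ‖ ^ 2) :=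
  (memLp_two_iff_integrable_sq_norm (memLp_FT f).1).1 (memLp_FT f)

/-- The symbol `2πi ξⱼ` of the partial derivative `∂ⱼ`. -/
def dsym (j : Fin 3) (ξ : E3) : ℂ := 2 * Real.pi * Complex.I * (ξ j : ℂ)

theorem continuous_dsym (j : Fin 3) : Continuous (dsym j) := by
  unfold dsym
  fun_prop

theorem inner_stdVec (j : Fin 3) (ξ : E3) : inner ℝ ξ (stdVec j) = ξ j := by
  simp [stdVec, EuclideanSpace.inner_single_right]

/-- `W` represents the Fourier transform of the tempered distribution `T`. -/
structure IsFourier (T : 𝓢'(E3, ℂ)) (W : E3 → ℂ) : Prop where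
  locInt : LocallyIntegrable W volume
  eq : ∀ h : 𝓢(E3, ℂ), HasCompactSupport h → 𝓕 T h = ∫ ξ, h ξ * W ξ

theorem integrable_schwartz_mul {W : E3 → ℂ} (hW : LocallyIntegrable W volume) (h : 𝓢(E3, ℂ))
    (hc : HasCompactSupport h) : Integrable (fun ξ => h ξ * W ξ) := by
  simpa using hW.integrable_smul_left_of_hasCompactSupport h.continuous hc

namespace IsFourier

variable {T T' : 𝓢'(E3, ℂ)} {W W' : E3 → ℂ}

/-- Compactly supported tests already separate locally integrable functions. This weak notion is
stable under multiplication by polynomial symbols, which would leave `L²`, and so allows identities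
of distributions to be read almost everywhere in `ξ`. -/
theorem unique (h : IsFourier T W) (h' : IsFourier T W') : W =ᵐ[volume] W' := by
  refine ae_eq_of_integral_contDiff_smul_eq h.locInt h'.locInt fun g hg hc => ?_
  have hc' : HasCompactSupport (fun x => (g x : ℂ)) := hc.comp_left (g := Complex.ofReal) rfl
  have hg' : ContDiff ℝ ∞ (fun x => (g x : ℂ)) := Complex.ofRealCLM.contDiff.comp hg
  have h1 := h.eq (hc'.toSchwartzMap hg') hc'
  rw [h'.eq (hc'.toSchwartzMap hg') hc'] at h1
  simpa using h1.symm

theorem congr (h : IsFourier T W) (e : W =ᵐ[volume] W') : IsFourier T W' where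
  locInt := h.locInt.congr e
  eq g hg := by
    rw [h.eq g hg]
    refine integral_congr_ae ?_
    filter_upwards [e] with x hx
    rw [hx]

theorem add (h : IsFourier T W) (h' : IsFourier T' W') :
    IsFourier (T + T') (fun ξ => W ξ + W' ξ) where
  locInt := h.locInt.add h'.locInt
  eq g hg := by
    have e : 𝓕 (T + T') g = 𝓕 T g + 𝓕 T' g := by simp
    rw [e, h.eq g hg, h'.eq g hg,
      ← integral_add (integrable_schwartz_mul h.locInt g hg)
        (integrable_schwartz_mul h'.locInt g hg)]
    simp only [mul_add]

theorem smul (c : ℂ) (h : IsFourier T W) : IsFourier (c • T) (fun ξ => c * W ξ) where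
  locInt := h.locInt.smul c
  eq g hg := by
    have e : 𝓕 (c • T) g = c * 𝓕 T g := by simp
    rw [e, h.eq g hg, ← integral_const_mul]
    congr 1
    ext ξ
    ring

theorem sub (h : IsFourier T W) (h' : IsFourier T' W') :
    IsFourier (T - T') (fun ξ => W ξ - W' ξ) := by
  have e : T - T' = T + (-1 : ℂ) • T' := by
    ext ψ
    change T ψ - T' ψ = T ψ + (-1) * T' ψ
    ring
  rw [e]
  simpa [sub_eq_add_neg] using h.add (h'.smul (-1))

theorem zero : IsFourier 0 (fun _ => 0) where
  locInt := locallyIntegrable_const 0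
  eq g hg := by simp

theorem sum {ι : Type*} (s : Finset ι) {S : ι → 𝓢'(E3, ℂ)} {V : ι → E3 → ℂ}
    (h : ∀ i, IsFourier (S i) (V i)) : IsFourier (∑ i ∈ s, S i) (fun ξ => ∑ i ∈ s, V i ξ) := by
  classical
  induction s using Finset.induction_on with
  | empty => simpa using IsFourier.zero
  | insert a s ha ih => simpa [Finset.sum_insert ha] using (h a).add ih

theorem lineDeriv (j : Fin 3) (h : IsFourier T W) :
    IsFourier (∂_{stdVec j} T) (fun ξ => dsym j ξ * W ξ) where
  locInt := by
    have := h.locInt.continuous_mul (continuous_dsym j)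
    simpa using this
  eq g hg := by
    have ht : (fun x : E3 => ((inner ℝ x (stdVec j) : ℝ) : ℂ)).HasTemperateGrowth := by fun_prop
    have hc : HasCompactSupport (SchwartzMap.smulLeftCLM ℂ
        (fun x : E3 => ((inner ℝ x (stdVec j) : ℝ) : ℂ)) g) := by
      refine hg.mono fun x hx => ?_
      rw [Function.mem_support, SchwartzMap.smulLeftCLM_apply_apply ht] at hx
      exact right_ne_zero_of_smul hx
    rw [TemperedDistribution.fourier_lineDerivOp_eq]
    change (2 * Real.pi * Complex.I) * 𝓕 T (SchwartzMap.smulLeftCLM ℂ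
        (fun x : E3 => ((inner ℝ x (stdVec j) : ℝ) : ℂ)) g) = _
    rw [h.eq _ hc, ← integral_const_mul]
    congr 1
    ext ξ
    rw [SchwartzMap.smulLeftCLM_apply_apply ht, inner_stdVec, dsym, smul_eq_mul]
    ring

end IsFourier

theorem fourier_toDist_apply (f : L2) (h : 𝓢(E3, ℂ)) : 𝓕 (toDist f) h = ∫ ξ, h ξ * FT f ξ := by
  rw [toDist, Lp.fourier_toTemperedDistribution_eq, Lp.toTemperedDistribution_apply]
  rfl

theorem isFourier_toDist (f : L2) : IsFourier (toDist f) (FT f) where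
  locInt := (memLp_FT f).locallyIntegrable (by norm_num)
  eq h _ := fourier_toDist_apply f h

/-- `g` is the weak partial derivative `∂ⱼ f`. -/
def HasWP (j : Fin 3) (f g : L2) : Prop := ∂_{stdVec j} (toDist f) = toDist g

theorem HasWP.weakPartial_eq {j : Fin 3} {f g : L2} (h : HasWP j f g) : weakPartial j f = g := by
  rw [weakPartial, h, l2Repr_toDist]

theorem HasWP.FT_eq {j : Fin 3} {f g : L2} (h : HasWP j f g) :
    FT g =ᵐ[volume] fun ξ => dsym j ξ * FT f ξ := by
  have h1 := (isFourier_toDist f).lineDeriv j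
  rw [h] at h1
  exact (isFourier_toDist g).unique h1

theorem fourier_lineDeriv_toDist (j : Fin 3) (f : L2) (h : 𝓢(E3, ℂ)) :
    𝓕 (∂_{stdVec j} (toDist f)) h = ∫ ξ, h ξ * (dsym j ξ * FT f ξ) := by
  have ht : (fun x : E3 => ((inner ℝ x (stdVec j) : ℝ) : ℂ)).HasTemperateGrowth := by fun_prop
  rw [TemperedDistribution.fourier_lineDerivOp_eq]
  change (2 * Real.pi * Complex.I) * 𝓕 (toDist f) (SchwartzMap.smulLeftCLM ℂ
      (fun x : E3 => ((inner ℝ x (stdVec j) : ℝ) : ℂ)) h) = _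
  rw [fourier_toDist_apply, ← integral_const_mul]
  congr 1
  ext ξ
  rw [SchwartzMap.smulLeftCLM_apply_apply ht, inner_stdVec, dsym, smul_eq_mul]
  ring

theorem fourier_injective : Function.Injective (fun T : 𝓢'(E3, ℂ) => 𝓕 T) := by
  intro S T h
  have := congrArg (fun T : 𝓢'(E3, ℂ) => 𝓕⁻ T) h
  simpa using this

theorem toDist_lineDeriv_cplx (j : Fin 3) (f : L2) (ψ : 𝓢(E3, ℝ)) :
    ∂_{stdVec j} (toDist f) (cplx ψ) = ((-∫ x, f x * (∂_{stdVec j} ψ) x : ℝ) : ℂ) := by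
  rw [TemperedDistribution.lineDerivOp_apply_apply, map_neg, lineDerivOp_cplx, toDist_cplx]
  push_cast
  rfl

theorem hasWP_iff_integral {j : Fin 3} {f g : L2} :
    HasWP j f g ↔ ∀ ψ : 𝓢(E3, ℝ), ∫ x, g x * ψ x = -∫ x, f x * (∂_{stdVec j} ψ) x := by
  constructor
  · intro h ψ
    have h1 := toDist_lineDeriv_cplx j f ψ
    rw [h, toDist_cplx] at h1
    exact_mod_cast h1
  · intro h
    refine sub_eq_zero.1 (eq_zero_of_forall_cplx fun ψ => ?_)
    have e : (∂_{stdVec j} (toDist f) - toDist g) (cplx ψ)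
      = ∂_{stdVec j} (toDist f) (cplx ψ) - toDist g (cplx ψ) := rfl
    rw [e, toDist_lineDeriv_cplx, toDist_cplx, h ψ, sub_self]

/-- The weak partial derivative exists as soon as its Fourier transform is in `L²`. -/
theorem exists_hasWP {j : Fin 3} {f : L2}
    (h : MemLp (fun ξ => dsym j ξ * FT f ξ) 2 volume) : ∃ g, HasWP j f g := by
  set G : Lp ℂ 2 (volume : Measure E3) := 𝓕⁻ (h.toLp _)
  have hG : ∂_{stdVec j} (toDist f) = Lp.toTemperedDistribution G := by
    refine fourier_injective ?_
    ext ψ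
    simp only
    rw [fourier_lineDeriv_toDist, Lp.fourier_toTemperedDistribution_eq,
      Lp.toTemperedDistribution_apply]
    refine integral_congr_ae ?_
    have e : (𝓕 G : Lp ℂ 2 (volume : Measure E3)) = h.toLp _ :=
      FourierTransform.fourier_fourierInv_eq _
    rw [e]
    filter_upwards [h.coeFn_toLp] with ξ hξ
    rw [hξ, smul_eq_mul]
  -- The inverse transform `G` is a priori complex-valued. The derivative of a real distribution
  -- takes real values on real test functions, so the real part of `G` represents it too.
  refine ⟨Complex.reCLM.compLp G, hasWP_iff_integral.2 fun ψ => ?_⟩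
  have h1 := toDist_lineDeriv_cplx j f ψ
  rw [hG, Lp.toTemperedDistribution_apply] at h1
  have h2 := congrArg Complex.re h1
  rw [Complex.ofReal_re] at h2
  rw [← h2]
  have hint : Integrable (fun x => cplx ψ x • G x) := by
    have := (MemLp.integrable_mul ((cplx ψ).memLp 2 volume) (Lp.memLp G))
    exact this
  have h3 : (∫ x, cplx ψ x • G x).re = ∫ x, (cplx ψ x • G x).re :=
    (Complex.reCLM.integral_comp_comm hint).symm
  rw [h3]
  refine integral_congr_ae ?_
  filter_upwards [Complex.reCLM.coeFn_compLp G] with x hx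
  rw [hx]
  simp [mul_comm]

theorem HasWP.hasWP_weakPartial {j : Fin 3} {f g : L2} (h : HasWP j f g) :
    HasWP j f (weakPartial j f) := by
  rw [h.weakPartial_eq]
  exact h

theorem isDivFree_FT {v : VF} (h : IsDivFree v) :
    ∀ᵐ ξ, ∑ i, dsym i ξ * FT (v i) ξ = 0 := by
  have h1 := IsFourier.sum Finset.univ fun i => (isFourier_toDist (v i)).lineDeriv i
  have h0 : (∑ i, ∂_{stdVec i} (toDist (v i))) = 0 := h
  rw [h0] at h1
  exact h1.unique IsFourier.zero

/-- Sobolev regularity yields a complex `L²` representative of the derivative; passing through its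
Fourier transform replaces it by a real one. -/
theorem exists_hasWP_of_memHs {v : VF} (h : MemHs 1 v) (i j : Fin 3) : ∃ g, HasWP j (v i) g := by
  have h1 := (h i).lineDerivOp (m := stdVec j)
  rw [sub_self, TemperedDistribution.memSobolev_zero_iff] at h1
  obtain ⟨G, hG⟩ := h1
  refine exists_hasWP ((Lp.memLp (𝓕 G : Lp ℂ 2 (volume : Measure E3))).ae_eq ?_)
  have h2 : IsFourier (∂_{stdVec j} (toDist (v i))) (𝓕 G : Lp ℂ 2 (volume : Measure E3)) := by
    rw [hG]
    exact ⟨(Lp.memLp _).locallyIntegrable (by norm_num), fun ψ _ => by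
      rw [Lp.fourier_toTemperedDistribution_eq, Lp.toTemperedDistribution_apply]; rfl⟩
  exact h2.unique ((isFourier_toDist (v i)).lineDeriv j)

/-! ### Fourier transforms of products of `L²` functions -/

theorem integrable_mul (f g : L2) : Integrable (fun x => f x * g x) :=
  MemLp.integrable_mul (Lp.memLp f) (Lp.memLp g)

theorem integrable_ofReal_mul (f g : L2) : Integrable (fun x => ((f x * g x : ℝ) : ℂ)) :=
  (integrable_mul f g).ofReal

theorem integral_norm_mul_le (f g : L2) : ∫ x, ‖f x * g x‖ ≤ ‖f‖ * ‖g‖ := by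
  have hf : MemLp (fun x => ‖f x‖) 2 volume := (Lp.memLp f).norm
  have hg : MemLp (fun x => ‖g x‖) 2 volume := (Lp.memLp g).norm
  have h1 : ∫ x, ‖f x * g x‖ = inner ℝ (hf.toLp _) (hg.toLp _) := by
    rw [L2.inner_def]
    refine integral_congr_ae ?_
    filter_upwards [hf.coeFn_toLp, hg.coeFn_toLp] with x hx hy
    rw [hx, hy]
    simp [mul_comm]
  rw [h1]
  refine (real_inner_le_norm _ _).trans (le_of_eq ?_)
  have h2 : ‖hf.toLp _‖ = ‖f‖ := by
    rw [Lp.norm_toLp, Lp.norm_def, eLpNorm_norm]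
  have h3 : ‖hg.toLp _‖ = ‖g‖ := by
    rw [Lp.norm_toLp, Lp.norm_def, eLpNorm_norm]
  rw [h2, h3]

theorem integral_fourier_mul_flip {f g : E3 → ℂ} (hf : Integrable f) (hg : Integrable g) :
    ∫ ξ, 𝓕 f ξ * g ξ = ∫ x, f x * 𝓕 g x := by
  simpa using! VectorFourier.integral_fourierIntegral_smul_eq_flip (L := innerₗ E3)
    Real.continuous_fourierChar continuous_inner hf hg

theorem integral_fourierInv_mul_flip {f g : E3 → ℂ} (hf : Integrable f) (hg : Integrable g) :
    ∫ ξ, 𝓕⁻ f ξ * g ξ = ∫ x, f x * 𝓕⁻ g x := by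
  have h := integral_fourier_mul_flip hf hg.comp_neg
  rw [← Real.fourierInv_eq_fourier_comp_neg] at h
  rw [← h, ← integral_neg_eq_self]
  simp [Real.fourierInv_eq_fourier_neg]

theorem fourier_conj (f : E3 → ℂ) (x : E3) :
    𝓕 (fun ξ => starRingEnd ℂ (f ξ)) x = starRingEnd ℂ (𝓕⁻ f x) := by
  rw [Real.fourier_eq', Real.fourierInv_eq', ← integral_conj]
  congr 1
  ext ξ
  simp only [smul_eq_mul, map_mul, ← Complex.exp_conj, Complex.conj_ofReal, Complex.conj_I]
  congr 2
  push_cast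
  ring

theorem continuous_fourier {f : E3 → ℂ} (hf : Integrable f) : Continuous (𝓕 f) :=
  VectorFourier.fourierIntegral_continuous Real.continuous_fourierChar continuous_inner hf

theorem norm_fourier_le (f : E3 → ℂ) (ξ : E3) : ‖𝓕 f ξ‖ ≤ ∫ x, ‖f x‖ :=
  VectorFourier.norm_fourierIntegral_le_integral_norm _ _ _ _ _

/-- The Fourier transform of the product of two real `L²` functions. -/
def prodFT (f g : L2) : E3 → ℂ := 𝓕 (fun x => ((f x * g x : ℝ) : ℂ))

theorem norm_prodFT_le (f g : L2) (ξ : E3) : ‖prodFT f g ξ‖ ≤ ‖f‖ * ‖g‖ := by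
  refine (norm_fourier_le _ _).trans (le_trans (le_of_eq ?_) (integral_norm_mul_le f g))
  simp

theorem continuous_prodFT (f g : L2) : Continuous (prodFT f g) :=
  continuous_fourier (integrable_ofReal_mul f g)

theorem prodFT_comm (f g : L2) : prodFT f g = prodFT g f := by
  unfold prodFT
  simp only [mul_comm]

theorem prodFT_add_right (f g h : L2) (ξ : E3) :
    prodFT f (g + h) ξ = prodFT f g ξ + prodFT f h ξ := by
  unfold prodFT
  simp only [Real.fourier_eq]
  rw [← integral_add]
  · refine integral_congr_ae ?_
    filter_upwards [Lp.coeFn_add g h] with x hx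
    rw [hx, Pi.add_apply, mul_add, Complex.ofReal_add, smul_add]
  · exact (Real.fourierIntegral_convergent_iff ξ).2 (integrable_ofReal_mul f g)
  · exact (Real.fourierIntegral_convergent_iff ξ).2 (integrable_ofReal_mul f h)

theorem prodFT_zero_right (f : L2) (ξ : E3) : prodFT f 0 ξ = 0 := by
  have h := prodFT_add_right f 0 0 ξ
  rw [add_zero] at h
  simpa using h

theorem prodFT_sum_right (f : L2) {ι : Type*} (s : Finset ι) (g : ι → L2) (ξ : E3) :
    prodFT f (∑ i ∈ s, g i) ξ = ∑ i ∈ s, prodFT f (g i) ξ := by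
  classical
  induction s using Finset.induction_on with
  | empty => simpa using prodFT_zero_right f ξ
  | insert a s ha ih => rw [Finset.sum_insert ha, Finset.sum_insert ha, prodFT_add_right, ih]

/-- The tempered distribution defined by the product of two real `L²` functions. -/
def prodDist (f g : L2) : 𝓢'(E3, ℂ) :=
  Lp.toTemperedDistribution ((memLp_one_iff_integrable.2 (integrable_ofReal_mul f g)).toLp _)

theorem prodDist_apply (f g : L2) (h : 𝓢(E3, ℂ)) :
    prodDist f g h = ∫ x, h x * ((f x * g x : ℝ) : ℂ) := by
  rw [prodDist, Lp.toTemperedDistribution_apply]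
  refine integral_congr_ae ?_
  filter_upwards [(memLp_one_iff_integrable.2 (integrable_ofReal_mul f g)).coeFn_toLp] with x hx
  rw [hx, smul_eq_mul]

theorem prodDist_cplx (f g : L2) (ψ : 𝓢(E3, ℝ)) :
    prodDist f g (cplx ψ) = ((∫ x, f x * g x * ψ x : ℝ) : ℂ) := by
  rw [prodDist_apply, ← integral_complex_ofReal]
  refine integral_congr_ae (ae_of_all _ fun x => ?_)
  simp [mul_comm]

theorem isFourier_prodDist (f g : L2) : IsFourier (prodDist f g) (prodFT f g) where
  locInt := (continuous_prodFT f g).locallyIntegrable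
  eq h _ := by
    rw [TemperedDistribution.fourier_apply, prodDist_apply, SchwartzMap.fourier_coe]
    rw [integral_fourier_mul_flip h.integrable (integrable_ofReal_mul f g)]
    rfl

theorem toDist_smul_integrable (f : L2) (ψ : 𝓢(E3, ℝ)) : MemLp (fun x => f x * ψ x) 2 volume := by
  have h : MemLp (fun x => ψ x * f x) 2 volume := (Lp.memLp f).mul (ψ.memLp ⊤ volume)
  simpa only [mul_comm] using h

/-- The product of an `L²` function and a Schwartz function. -/
def mulSchwartz (f : L2) (ψ : 𝓢(E3, ℝ)) : L2 := (toDist_smul_integrable f ψ).toLp _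

theorem coeFn_mulSchwartz (f : L2) (ψ : 𝓢(E3, ℝ)) :
    ∀ᵐ x, (mulSchwartz f ψ : E3 → ℝ) x = f x * ψ x :=
  (toDist_smul_integrable f ψ).coeFn_toLp

theorem integrable_mul_schwartz (f : L2) (ψ : 𝓢(E3, ℝ)) : Integrable (fun x => f x * ψ x) :=
  MemLp.integrable_mul (Lp.memLp f) (ψ.memLp 2 volume)

theorem lineDeriv_smulLeft (m : E3) (ψ χ : 𝓢(E3, ℝ)) (x : E3) :
    (∂_{m} (SchwartzMap.smulLeftCLM ℝ ψ χ)) x = ψ x * (∂_{m} χ) x + (∂_{m} ψ) x * χ x := by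
  simp only [SchwartzMap.lineDerivOp_apply_eq_fderiv]
  rw [SchwartzMap.smulLeftCLM_apply ψ.hasTemperateGrowth]
  have h := ((ψ.hasFDerivAt x).mul (χ.hasFDerivAt x)).fderiv
  rw [show (fun y => ψ y • χ y) = (⇑ψ * ⇑χ) from rfl, h]
  simp
  ring

theorem HasWP.mulSchwartz {j : Fin 3} {f f' : L2} (h : HasWP j f f') (ψ : 𝓢(E3, ℝ)) :
    HasWP j (mulSchwartz f ψ) (mulSchwartz f' ψ + mulSchwartz f (∂_{stdVec j} ψ)) := by
  rw [hasWP_iff_integral] at h ⊢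
  intro χ
  have h1 := h (SchwartzMap.smulLeftCLM ℝ ψ χ)
  have hL : ∫ x, (SecondGrade.mulSchwartz f' ψ + SecondGrade.mulSchwartz f (∂_{stdVec j} ψ) : L2) x
      * χ x = (∫ x, f' x * (SchwartzMap.smulLeftCLM ℝ ψ χ) x)
        + ∫ x, SecondGrade.mulSchwartz f (∂_{stdVec j} ψ) x * χ x := by
    rw [← integral_add (integrable_mul_schwartz _ _) (integrable_mul_schwartz _ _)]
    refine integral_congr_ae ?_
    filter_upwards [Lp.coeFn_add (SecondGrade.mulSchwartz f' ψ)
      (SecondGrade.mulSchwartz f (∂_{stdVec j} ψ)), coeFn_mulSchwartz f' ψ] with x hx hy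
    rw [hx, Pi.add_apply, hy, SchwartzMap.smulLeftCLM_apply_apply ψ.hasTemperateGrowth, smul_eq_mul]
    ring
  rw [hL, h1]
  have hR : ∫ x, f x * (∂_{stdVec j} (SchwartzMap.smulLeftCLM ℝ ψ χ)) x
      = (∫ x, SecondGrade.mulSchwartz f ψ x * (∂_{stdVec j} χ) x)
        + ∫ x, SecondGrade.mulSchwartz f (∂_{stdVec j} ψ) x * χ x := by
    rw [← integral_add (integrable_mul_schwartz _ _) (integrable_mul_schwartz _ _)]
    refine integral_congr_ae ?_
    filter_upwards [coeFn_mulSchwartz f ψ, coeFn_mulSchwartz f (∂_{stdVec j} ψ)] with x hx hy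
    rw [hx, hy, lineDeriv_smulLeft]
    ring
  rw [hR]
  ring

theorem inner_FT (f g : L2) : inner ℂ (FT f) (FT g) = ((∫ x, f x * g x : ℝ) : ℂ) := by
  rw [FT, FT, Lp.inner_fourier_eq, L2.inner_def, ← integral_complex_ofReal]
  refine integral_congr_ae ?_
  filter_upwards [coeFn_toComplex f, coeFn_toComplex g] with x hx hy
  rw [hx, hy]
  simp [mul_comm]

theorem conj_dsym (j : Fin 3) (ξ : E3) : starRingEnd ℂ (dsym j ξ) = -dsym j ξ := by
  rw [dsym, show (2 : ℂ) = ((2 : ℝ) : ℂ) by norm_num]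
  simp only [map_mul, Complex.conj_ofReal, Complex.conj_I]
  ring

/-- By Plancherel: the symbol of `∂ⱼ` is purely imaginary, so moving it across the conjugation costs
a sign. -/
theorem HasWP.integral_by_parts {j : Fin 3} {f f' g g' : L2} (hf : HasWP j f f')
    (hg : HasWP j g g') : ∫ x, f x * g' x = -∫ x, f' x * g x := by
  have h : inner ℂ (FT f) (FT g') = -inner ℂ (FT f') (FT g) := by
    rw [L2.inner_def, L2.inner_def, ← integral_neg]
    refine integral_congr_ae ?_
    filter_upwards [hf.FT_eq, hg.FT_eq] with ξ h1 h2
    rw [h1, h2]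
    simp only [RCLike.inner_apply, map_mul, conj_dsym]
    ring
  rw [inner_FT, inner_FT] at h
  exact_mod_cast h

/-- The product rule for weak derivatives. -/
theorem lineDeriv_prodDist {j : Fin 3} {f f' g g' : L2} (hf : HasWP j f f') (hg : HasWP j g g') :
    ∂_{stdVec j} (prodDist f g) = prodDist f' g + prodDist f g' := by
  refine sub_eq_zero.1 (eq_zero_of_forall_cplx fun ψ => ?_)
  have e : (∂_{stdVec j} (prodDist f g) - (prodDist f' g + prodDist f g')) (cplx ψ)
    = prodDist f g (-∂_{stdVec j} (cplx ψ))
      - (prodDist f' g (cplx ψ) + prodDist f g' (cplx ψ)) := rfl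
  rw [e, map_neg, lineDerivOp_cplx, prodDist_cplx, prodDist_cplx, prodDist_cplx]
  -- The product `f g` is only in `L¹`. Absorbing the test function into `g` keeps both factors in
  -- `L²`, where integration by parts is available.
  have h := hf.integral_by_parts (hg.mulSchwartz ψ)
  have h1 : ∫ x, f x * (mulSchwartz g' ψ + mulSchwartz g (∂_{stdVec j} ψ) : L2) x
      = (∫ x, f x * g' x * ψ x) + ∫ x, f x * g x * (∂_{stdVec j} ψ) x := by
    have i1 : Integrable (fun x => f x * g' x * ψ x) := by
      refine (integrable_mul f (mulSchwartz g' ψ)).congr ?_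
      filter_upwards [coeFn_mulSchwartz g' ψ] with x hx
      rw [hx, mul_assoc]
    have i2 : Integrable (fun x => f x * g x * (∂_{stdVec j} ψ) x) := by
      refine (integrable_mul f (mulSchwartz g (∂_{stdVec j} ψ))).congr ?_
      filter_upwards [coeFn_mulSchwartz g (∂_{stdVec j} ψ)] with x hx
      rw [hx, mul_assoc]
    rw [← integral_add i1 i2]
    refine integral_congr_ae ?_
    filter_upwards [Lp.coeFn_add (mulSchwartz g' ψ) (mulSchwartz g (∂_{stdVec j} ψ)),
      coeFn_mulSchwartz g' ψ, coeFn_mulSchwartz g (∂_{stdVec j} ψ)] with x hx hy hz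
    rw [hx, Pi.add_apply, hy, hz]
    ring
  have h2 : ∫ x, f' x * mulSchwartz g ψ x = ∫ x, f' x * g x * ψ x := by
    refine integral_congr_ae ?_
    filter_upwards [coeFn_mulSchwartz g ψ] with x hx
    rw [hx, mul_assoc]
  rw [h1, h2] at h
  rw [← Complex.ofReal_neg, ← Complex.ofReal_add, ← Complex.ofReal_sub, Complex.ofReal_eq_zero]
  linarith

theorem prodFT_deriv {j : Fin 3} {f f' g g' : L2} (hf : HasWP j f f') (hg : HasWP j g g') :
    ∀ᵐ ξ, prodFT f' g ξ + prodFT f g' ξ = dsym j ξ * prodFT f g ξ := by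
  have h1 := (isFourier_prodDist f g).lineDeriv j
  rw [lineDeriv_prodDist hf hg] at h1
  exact ((isFourier_prodDist f' g).add (isFourier_prodDist f g')).unique h1

/-- `FT` comes from Plancherel's extension, whereas `𝓕⁻` here is the inversion integral. They are
compared by testing against compactly supported functions; the gain is Parseval's formula for the
triple products below. -/
theorem fourierInv_FT_ae {f : L2} (hI : Integrable (FT f)) :
    ∀ᵐ x, 𝓕⁻ (FT f : E3 → ℂ) x = (f x : ℂ) := by
  have hcont : Continuous (𝓕⁻ (FT f : E3 → ℂ)) := by
    rw [Real.fourierInv_eq_fourier_comp_neg]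
    exact continuous_fourier hI.comp_neg
  have hloc : LocallyIntegrable (fun x => (f x : ℂ)) volume :=
    (((Lp.memLp f).ofReal : MemLp (fun x => (f x : ℂ)) 2 volume)).locallyIntegrable (by norm_num)
  refine ae_eq_of_integral_contDiff_smul_eq hcont.locallyIntegrable hloc fun g hg hc => ?_
  have hc' : HasCompactSupport (fun x => (g x : ℂ)) := hc.comp_left (g := Complex.ofReal) rfl
  have hg' : ContDiff ℝ ∞ (fun x => (g x : ℂ)) := Complex.ofRealCLM.contDiff.comp hg
  set ψ : 𝓢(E3, ℂ) := hc'.toSchwartzMap hg'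
  have hψ : ∀ x, ψ x = (g x : ℂ) := fun x => rfl
  have h1 : ∫ x, ψ x * 𝓕⁻ (FT f : E3 → ℂ) x = ∫ x, ψ x * (f x : ℂ) := by
    rw [← integral_fourierInv_mul_flip ψ.integrable hI, ← toDist_apply]
    have h2 := fourier_toDist_apply f (𝓕⁻ ψ)
    rw [TemperedDistribution.fourier_apply, FourierTransform.fourier_fourierInv_eq] at h2
    rw [h2, SchwartzMap.fourierInv_coe]
  simpa [hψ] using h1

/-- If `f̂` is integrable, then `∫ (g h)^ conj f̂ = ∫ g h f`. -/
theorem integral_prodFT_mul_conj (g h : L2) {f : L2} (hI : Integrable (FT f)) :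
    ∫ ξ, prodFT g h ξ * starRingEnd ℂ (FT f ξ) = ((∫ x, g x * h x * f x : ℝ) : ℂ) := by
  have hI' : Integrable (fun ξ => starRingEnd ℂ (FT f ξ)) :=
    Complex.conjCLE.toContinuousLinearMap.integrable_comp hI
  rw [prodFT, integral_fourier_mul_flip (integrable_ofReal_mul g h) hI', ← integral_complex_ofReal]
  refine integral_congr_ae ?_
  filter_upwards [fourierInv_FT_ae hI] with x hx
  rw [fourier_conj, hx, Complex.conj_ofReal]
  push_cast
  ring

theorem integrable_prodFT_mul_conj (g h : L2) {f : L2} (hI : Integrable (FT f)) :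
    Integrable (fun ξ => prodFT g h ξ * starRingEnd ℂ (FT f ξ)) := by
  have hI' : Integrable (fun ξ => starRingEnd ℂ (FT f ξ)) :=
    Complex.conjCLE.toContinuousLinearMap.integrable_comp hI
  exact hI'.bdd_mul (continuous_prodFT g h).aestronglyMeasurable (ae_of_all _ (norm_prodFT_le g h))

/-! ### Regularity of fields in `V₂` -/

/-- The weight `1 + 4π²α|ξ|²`, the symbol of `1 - αΔ`. -/
def wt (α : ℝ) (ξ : E3) : ℝ := 1 + α * (2 * Real.pi * ‖ξ‖) ^ 2

/-- `∑ᵢ |v̂ᵢ(ξ)|²`. -/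
def sqFT (v : VF) (ξ : E3) : ℝ := ∑ i, ‖FT (v i) ξ‖ ^ 2

theorem sqFT_nonneg (v : VF) (ξ : E3) : 0 ≤ sqFT v ξ := Finset.sum_nonneg fun _ _ => by positivity

theorem integrable_sqFT (v : VF) : Integrable (sqFT v) :=
  integrable_finsetSum _ fun i _ => integrable_norm_sq_FT (v i)

theorem norm_FT_le_sqrt (v : VF) (i : Fin 3) (ξ : E3) : ‖FT (v i) ξ‖ ≤ √(sqFT v ξ) := by
  apply Real.le_sqrt_of_sq_le
  exact Finset.single_le_sum (f := fun i => ‖FT (v i) ξ‖ ^ 2) (fun _ _ => by positivity)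
    (Finset.mem_univ i)

theorem one_le_wt {α : ℝ} (hα : 0 < α) (ξ : E3) : 1 ≤ wt α ξ := by
  unfold wt
  have : 0 ≤ α * (2 * Real.pi * ‖ξ‖) ^ 2 := by positivity
  linarith

theorem continuous_wt (α : ℝ) : Continuous (wt α) := by
  unfold wt
  fun_prop

theorem norm_sq_eq_sum (ξ : E3) : ‖ξ‖ ^ 2 = ∑ i, ξ i ^ 2 := by
  rw [EuclideanSpace.norm_sq_eq]
  simp

theorem norm_dsym (j : Fin 3) (ξ : E3) : ‖dsym j ξ‖ = 2 * Real.pi * |ξ j| := by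
  simp [dsym, abs_of_pos Real.pi_pos]

theorem norm_dsym_le (j : Fin 3) (ξ : E3) : ‖dsym j ξ‖ ≤ 2 * Real.pi * ‖ξ‖ := by
  rw [norm_dsym]
  have h := PiLp.norm_apply_le ξ j
  rw [Real.norm_eq_abs] at h
  have := Real.pi_pos
  gcongr

theorem sum_dsym_sq (ξ : E3) : ∑ k, dsym k ξ * dsym k ξ = -(((2 * Real.pi * ‖ξ‖) ^ 2 : ℝ) : ℂ) := by
  have h := norm_sq_eq_sum ξ
  rw [mul_pow, h]
  simp only [dsym, Fin.sum_univ_three]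
  push_cast
  linear_combination (4 * (Real.pi : ℂ) ^ 2 * ((ξ 0 : ℂ) ^ 2 + (ξ 1 : ℂ) ^ 2 + (ξ 2 : ℂ) ^ 2)) *
    Complex.I_sq

theorem sum_norm_dsym_sq (ξ : E3) : ∑ k, ‖dsym k ξ‖ ^ 2 = (2 * Real.pi * ‖ξ‖) ^ 2 := by
  simp only [norm_dsym, mul_pow, sq_abs, norm_sq_eq_sum ξ, Finset.mul_sum]

/-- Lagrange's identity for the vector product with `2πiξ`, the indices being taken modulo `3`. -/
theorem sum_norm_cross_sq (ξ : E3) (V : Fin 3 → ℂ) (h : ∑ i, dsym i ξ * V i = 0) :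
    ∑ i : Fin 3, ‖dsym (i + 1) ξ * V (i + 2) - dsym (i + 2) ξ * V (i + 1)‖ ^ 2
      = (2 * Real.pi * ‖ξ‖) ^ 2 * ∑ i, ‖V i‖ ^ 2 := by
  have hc : (2 * Real.pi * Complex.I : ℂ) ≠ 0 := Complex.two_pi_I_ne_zero
  have h0 : ∑ i, (ξ i : ℂ) * V i = 0 := by
    have e : ∑ i, dsym i ξ * V i = (2 * Real.pi * Complex.I) * ∑ i, (ξ i : ℂ) * V i := by
      simp only [dsym, Finset.mul_sum, mul_assoc]
    rw [e] at h
    exact (mul_eq_zero.1 h).resolve_left hc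
  have hr := congrArg Complex.re h0
  have hi := congrArg Complex.im h0
  have e : ∀ i : Fin 3, ‖dsym (i + 1) ξ * V (i + 2) - dsym (i + 2) ξ * V (i + 1)‖ ^ 2
      = (2 * Real.pi) ^ 2 * ‖(ξ (i + 1) : ℂ) * V (i + 2) - (ξ (i + 2) : ℂ) * V (i + 1)‖ ^ 2 := by
    intro i
    have : dsym (i + 1) ξ * V (i + 2) - dsym (i + 2) ξ * V (i + 1) = (2 * Real.pi * Complex.I) *
        ((ξ (i + 1) : ℂ) * V (i + 2) - (ξ (i + 2) : ℂ) * V (i + 1)) := by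
      simp only [dsym]; ring
    rw [this, norm_mul, mul_pow]
    congr 1
    simp [abs_of_pos Real.pi_pos]
  rw [Finset.sum_congr rfl fun i _ => e i, ← Finset.mul_sum, mul_pow (2 * Real.pi) ‖ξ‖ 2,
    mul_assoc, norm_sq_eq_sum]
  congr 1
  simp only [Complex.sq_norm, Complex.normSq_apply, Fin.sum_univ_three, Complex.sub_re,
    Complex.sub_im, Complex.mul_re, Complex.mul_im, Complex.ofReal_re, Complex.ofReal_im,
    Complex.add_re, Complex.add_im, Complex.zero_re, Complex.zero_im] at hr hi ⊢
  norm_num [Fin.ext_iff] at *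
  have e1 : (1 : Fin 3) + 2 = 0 := rfl
  have e2 : (2 : Fin 3) + 2 = 1 := rfl
  have e3 : (1 : Fin 3) + 1 = 2 := rfl
  have e4 : (2 : Fin 3) + 1 = 0 := rfl
  simp only [e1, e2, e3, e4]
  linear_combination (-(ξ 0 * (V 0).re + ξ 1 * (V 1).re + ξ 2 * (V 2).re)) * hr
    - (ξ 0 * (V 0).im + ξ 1 * (V 1).im + ξ 2 * (V 2).im) * hi

theorem toDist_add (f g : L2) : toDist (f + g) = toDist f + toDist g := by
  have h : toComplex (f + g) = toComplex f + toComplex g :=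
    (Complex.ofRealCLM.compLpL 2 (volume : Measure E3)).map_add f g
  rw [toDist, h]
  exact (Lp.toTemperedDistributionCLM ℂ (volume : Measure E3) 2).map_add _ _

theorem toDist_zero : toDist 0 = 0 := by
  have h := toDist_add 0 0
  rw [add_zero] at h
  exact left_eq_add.1 h

theorem toDist_sum {ι : Type*} (s : Finset ι) (f : ι → L2) :
    toDist (∑ i ∈ s, f i) = ∑ i ∈ s, toDist (f i) := by
  classical
  induction s using Finset.induction_on with
  | empty => simpa using toDist_zero
  | insert a s ha ih => rw [Finset.sum_insert ha, Finset.sum_insert ha, toDist_add, ih]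

theorem laplacian_eq_sum_stdVec (T : 𝓢'(E3, ℂ)) : Δ T = ∑ k, ∂_{stdVec k} (∂_{stdVec k} T) := by
  rw [TemperedDistribution.laplacian_eq_sum (EuclideanSpace.basisFun (Fin 3) ℝ)]
  simp [stdVec, EuclideanSpace.basisFun_apply]

theorem IsFourier.laplacian {T : 𝓢'(E3, ℂ)} {W : E3 → ℂ} (h : IsFourier T W) :
    IsFourier (Δ T) (fun ξ => -(((2 * Real.pi * ‖ξ‖) ^ 2 : ℝ) : ℂ) * W ξ) := by
  rw [laplacian_eq_sum_stdVec]
  refine (IsFourier.sum Finset.univ fun k => (h.lineDeriv k).lineDeriv k).congr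
    (ae_of_all _ fun ξ => ?_)
  beta_reduce
  rw [← sum_dsym_sq, Finset.sum_mul]
  simp only [mul_assoc]

theorem isFourier_filtered (α : ℝ) (f : L2) :
    IsFourier (toDist f - (α : ℂ) • Δ (toDist f)) (fun ξ => (wt α ξ : ℂ) * FT f ξ) := by
  refine ((isFourier_toDist f).sub ((isFourier_toDist f).laplacian.smul α)).congr
    (ae_of_all _ fun ξ => ?_)
  simp only [wt]
  push_cast
  ring

/-- The `i`-th component of `curl (v - αΔv)`. -/
def vort (α : ℝ) (v : VF) (i : Fin 3) : L2 := l2Repr (curlFiltered α v i)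

theorem MemV2.toDist_vort {α : ℝ} {v : VF} (h : MemV2 α v) (i : Fin 3) :
    curlFiltered α v i = toDist (vort α v i) := by
  obtain ⟨g, hg⟩ := h.2 i
  rw [vort, hg, l2Repr_toDist]

/-- For a divergence-free field the curl loses nothing: `ξ ⟂ v̂`, so Lagrange's identity gives `|ξ ×
v̂| = |ξ||v̂|`. The vorticity norm therefore controls three derivatives of `v`. -/
theorem MemV2.sqFT_vort {α : ℝ} {v : VF} (h : MemV2 α v) :
    ∀ᵐ ξ, sqFT (vort α v) ξ = (2 * Real.pi * ‖ξ‖ * wt α ξ) ^ 2 * sqFT v ξ := by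
  have h1 : ∀ i, ∀ᵐ ξ, FT (vort α v i) ξ = (wt α ξ : ℂ) *
      (dsym (i + 1) ξ * FT (v (i + 2)) ξ - dsym (i + 2) ξ * FT (v (i + 1)) ξ) := by
    intro i
    have hF := ((isFourier_filtered α (v (i + 2))).lineDeriv (i + 1)).sub
      ((isFourier_filtered α (v (i + 1))).lineDeriv (i + 2))
    have e : curlFiltered α v i = ∂_{stdVec (i + 1)} (toDist (v (i + 2))
        - (α : ℂ) • Δ (toDist (v (i + 2)))) - ∂_{stdVec (i + 2)} (toDist (v (i + 1))
        - (α : ℂ) • Δ (toDist (v (i + 1)))) := rfl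
    rw [← e, h.toDist_vort] at hF
    filter_upwards [(isFourier_toDist _).unique hF] with ξ hξ
    rw [hξ]
    ring
  filter_upwards [ae_all_iff.2 h1, isDivFree_FT h.1.2] with ξ hξ hd
  have h2 := sum_norm_cross_sq ξ (fun i => FT (v i) ξ) hd
  simp only [sqFT, hξ, norm_mul, mul_pow, ← Finset.mul_sum]
  rw [h2]
  simp only [Complex.norm_real, Real.norm_eq_abs, sq_abs]
  ring

theorem memLp_sqrt_sqFT (v : VF) : MemLp (fun ξ => √(sqFT v ξ)) 2 volume := by
  have hm : AEStronglyMeasurable (fun ξ => √(sqFT v ξ)) volume :=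
    Real.continuous_sqrt.comp_aestronglyMeasurable (integrable_sqFT v).1
  rw [memLp_two_iff_integrable_sq hm]
  refine (integrable_sqFT v).congr (ae_of_all _ fun ξ => ?_)
  simp only [Real.sq_sqrt (sqFT_nonneg v ξ)]

theorem integral_sqFT (v : VF) : ∫ ξ, sqFT v ξ = ∑ i, ‖v i‖ ^ 2 := by
  unfold sqFT
  rw [integral_finsetSum _ fun i _ => integrable_norm_sq_FT (v i)]
  simp only [norm_sq_eq_integral_FT]

theorem sqrt_sqFT_vort {α : ℝ} (hα : 0 < α) {v : VF} (h : MemV2 α v) :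
    ∀ᵐ ξ, √(sqFT (vort α v) ξ) = 2 * Real.pi * ‖ξ‖ * wt α ξ * √(sqFT v ξ) := by
  filter_upwards [h.sqFT_vort] with ξ hξ
  have := one_le_wt hα ξ
  have := Real.pi_pos
  rw [hξ, Real.sqrt_mul (by positivity), Real.sqrt_sq (by positivity)]

/-- With `pow_two_le_symbol`, this converts the `L²` bound on `curl (v - αΔv)` into `L²` bounds on
the second and third derivatives. -/
theorem pow_three_le_symbol {α : ℝ} (hα : 0 < α) (ξ : E3) :
    (2 * Real.pi * ‖ξ‖) ^ 3 ≤ α⁻¹ * (2 * Real.pi * ‖ξ‖ * wt α ξ) := by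
  have hs : 0 ≤ 2 * Real.pi * ‖ξ‖ := by positivity
  rw [← sub_nonneg]
  have e : α⁻¹ * (2 * Real.pi * ‖ξ‖ * wt α ξ) - (2 * Real.pi * ‖ξ‖) ^ 3
      = α⁻¹ * (2 * Real.pi * ‖ξ‖) := by
    unfold wt
    field_simp
    ring
  rw [e]
  positivity

theorem pow_two_le_symbol {α : ℝ} (hα : 0 < α) (ξ : E3) :
    (2 * Real.pi * ‖ξ‖) ^ 2 ≤ (1 + α⁻¹) * (2 * Real.pi * ‖ξ‖ * wt α ξ) := by
  have hs : 0 ≤ 2 * Real.pi * ‖ξ‖ := by positivity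
  have h3 := pow_three_le_symbol hα ξ
  have hw := one_le_wt hα ξ
  set s := 2 * Real.pi * ‖ξ‖
  have : s ^ 2 ≤ s + s ^ 3 := by nlinarith [mul_nonneg hs (sq_nonneg (s - 1)), sq_nonneg s]
  nlinarith

namespace MemV2

variable {α : ℝ} {v : VF}

theorem hasWP (h : MemV2 α v) (i j : Fin 3) : HasWP j (v i) (weakPartial j (v i)) := by
  obtain ⟨g, hg⟩ := exists_hasWP_of_memHs h.1.1 i j
  exact hg.hasWP_weakPartial

theorem hasWP₂ (hα : 0 < α) (h : MemV2 α v) (i j k : Fin 3) :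
    HasWP k (weakPartial j (v i)) (weakPartial k (weakPartial j (v i))) := by
  have hm : MemLp (fun ξ => dsym k ξ * FT (weakPartial j (v i)) ξ) 2 volume := by
    refine (memLp_sqrt_sqFT (vort α v)).of_le_mul (c := 1 + α⁻¹)
      ((continuous_dsym k).aestronglyMeasurable.mul (memLp_FT _).1) ?_
    filter_upwards [(h.hasWP i j).FT_eq, sqrt_sqFT_vort hα h] with ξ h1 h2
    rw [h1, h2, Real.norm_of_nonneg (by have := one_le_wt hα ξ; positivity), norm_mul, norm_mul]
    calc ‖dsym k ξ‖ * (‖dsym j ξ‖ * ‖FT (v i) ξ‖)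
        ≤ (2 * Real.pi * ‖ξ‖) * ((2 * Real.pi * ‖ξ‖) * √(sqFT v ξ)) := by
          gcongr
          · exact norm_dsym_le k ξ
          · exact norm_dsym_le j ξ
          · exact norm_FT_le_sqrt v i ξ
      _ = (2 * Real.pi * ‖ξ‖) ^ 2 * √(sqFT v ξ) := by ring
      _ ≤ (1 + α⁻¹) * (2 * Real.pi * ‖ξ‖ * wt α ξ) * √(sqFT v ξ) := by
          gcongr
          exact pow_two_le_symbol hα ξ
      _ = _ := by ring
  obtain ⟨g, hg⟩ := exists_hasWP hm
  exact hg.hasWP_weakPartial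

theorem weakLaplacian_eq (hα : 0 < α) (h : MemV2 α v) (i : Fin 3) :
    weakLaplacian v i = ∑ k, weakPartial k (weakPartial k (v i)) := by
  have e : Δ (toDist (v i)) = toDist (∑ k, weakPartial k (weakPartial k (v i))) := by
    rw [laplacian_eq_sum_stdVec, toDist_sum]
    refine Finset.sum_congr rfl fun k _ => ?_
    rw [h.hasWP i k, h.hasWP₂ hα i k k]
  rw [weakLaplacian, e, l2Repr_toDist]

theorem toDist_weakLaplacian (hα : 0 < α) (h : MemV2 α v) (i : Fin 3) :
    Δ (toDist (v i)) = toDist (weakLaplacian v i) := by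
  rw [laplacian_eq_sum_stdVec, h.weakLaplacian_eq hα, toDist_sum]
  refine Finset.sum_congr rfl fun k _ => ?_
  rw [h.hasWP i k, h.hasWP₂ hα i k k]

theorem FT_weakLaplacian (hα : 0 < α) (h : MemV2 α v) (i : Fin 3) :
    ∀ᵐ ξ, FT (weakLaplacian v i) ξ = -(((2 * Real.pi * ‖ξ‖) ^ 2 : ℝ) : ℂ) * FT (v i) ξ := by
  have h1 := (isFourier_toDist (v i)).laplacian
  rw [h.toDist_weakLaplacian hα] at h1
  exact (isFourier_toDist _).unique h1

theorem norm_dsym_mul_FT_weakLaplacian_le (hα : 0 < α) (h : MemV2 α v) (i j : Fin 3) :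
    ∀ᵐ ξ, ‖dsym j ξ * FT (weakLaplacian v i) ξ‖ ≤ α⁻¹ * √(sqFT (vort α v) ξ) := by
  filter_upwards [h.FT_weakLaplacian hα i, sqrt_sqFT_vort hα h] with ξ h1 h2
  rw [h1, h2, norm_mul, norm_mul, norm_neg, Complex.norm_real, Real.norm_of_nonneg (by positivity)]
  calc ‖dsym j ξ‖ * ((2 * Real.pi * ‖ξ‖) ^ 2 * ‖FT (v i) ξ‖)
      ≤ (2 * Real.pi * ‖ξ‖) * ((2 * Real.pi * ‖ξ‖) ^ 2 * √(sqFT v ξ)) := by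
        gcongr
        · exact norm_dsym_le j ξ
        · exact norm_FT_le_sqrt v i ξ
    _ = (2 * Real.pi * ‖ξ‖) ^ 3 * √(sqFT v ξ) := by ring
    _ ≤ α⁻¹ * (2 * Real.pi * ‖ξ‖ * wt α ξ) * √(sqFT v ξ) := by
        gcongr
        exact pow_three_le_symbol hα ξ
    _ = _ := by ring

theorem hasWP_weakLaplacian (hα : 0 < α) (h : MemV2 α v) (i j : Fin 3) :
    HasWP j (weakLaplacian v i) (weakPartial j (weakLaplacian v i)) := by
  have hm : MemLp (fun ξ => dsym j ξ * FT (weakLaplacian v i) ξ) 2 volume := by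
    refine (memLp_sqrt_sqFT (vort α v)).of_le_mul (c := α⁻¹)
      ((continuous_dsym j).aestronglyMeasurable.mul (memLp_FT _).1) ?_
    filter_upwards [h.norm_dsym_mul_FT_weakLaplacian_le hα i j] with ξ h1
    rwa [Real.norm_of_nonneg (Real.sqrt_nonneg _)]
  obtain ⟨g, hg⟩ := exists_hasWP hm
  exact hg.hasWP_weakPartial

theorem weakPartial_comm (hα : 0 < α) (h : MemV2 α v) (i j k : Fin 3) :
    weakPartial k (weakPartial j (v i)) = weakPartial j (weakPartial k (v i)) := by
  apply FT_injective
  apply Lp.ext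
  filter_upwards [(h.hasWP₂ hα i j k).FT_eq, (h.hasWP₂ hα i k j).FT_eq, (h.hasWP i j).FT_eq,
    (h.hasWP i k).FT_eq] with ξ h1 h2 h3 h4
  rw [h1, h2, h3, h4]
  ring

theorem sum_weakPartial_eq_zero (h : MemV2 α v) : ∑ j, weakPartial j (v j) = 0 := by
  apply toDist_injective
  have h0 : ∑ j, ∂_{stdVec j} (toDist (v j)) = 0 := h.1.2
  rw [toDist_sum, toDist_zero, ← h0]
  exact Finset.sum_congr rfl fun j _ => (h.hasWP j j).symm

end MemV2

/-! ### The norms in terms of the Fourier transform -/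

theorem HasWP.norm_sq_eq {j : Fin 3} {f g : L2} (h : HasWP j f g) :
    ‖g‖ ^ 2 = ∫ ξ, ‖dsym j ξ‖ ^ 2 * ‖FT f ξ‖ ^ 2 := by
  rw [norm_sq_eq_integral_FT]
  refine integral_congr_ae ?_
  filter_upwards [h.FT_eq] with ξ hξ
  rw [hξ, norm_mul, mul_pow]

theorem HasWP.integrable_norm_sq {j : Fin 3} {f g : L2} (h : HasWP j f g) :
    Integrable (fun ξ => ‖dsym j ξ‖ ^ 2 * ‖FT f ξ‖ ^ 2) := by
  refine (integrable_norm_sq_FT g).congr ?_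
  filter_upwards [h.FT_eq] with ξ hξ
  rw [hξ, norm_mul, mul_pow]

theorem wt_mul_sqFT (α : ℝ) (v : VF) (ξ : E3) : wt α ξ * sqFT v ξ
    = ∑ i, ‖FT (v i) ξ‖ ^ 2 + α * ∑ i, ∑ j, ‖dsym j ξ‖ ^ 2 * ‖FT (v i) ξ‖ ^ 2 := by
  have e : ∑ i, ∑ j, ‖dsym j ξ‖ ^ 2 * ‖FT (v i) ξ‖ ^ 2
      = (2 * Real.pi * ‖ξ‖) ^ 2 * sqFT v ξ := by
    rw [sqFT, Finset.mul_sum]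
    refine Finset.sum_congr rfl fun i _ => ?_
    rw [← Finset.sum_mul, sum_norm_dsym_sq]
  rw [e, wt, sqFT]
  ring

theorem integrable_wt_mul_sqFT {α : ℝ} {v : VF}
    (h : ∀ i j, HasWP j (v i) (weakPartial j (v i))) :
    Integrable (fun ξ => wt α ξ * sqFT v ξ) := by
  simp only [wt_mul_sqFT]
  refine (integrable_sqFT v).add (Integrable.const_mul ?_ α)
  exact integrable_finsetSum _ fun i _ => integrable_finsetSum _ fun j _ => (h i j).integrable_norm_sq

theorem h1AlphaNormSq_eq {α : ℝ} {v : VF} (h : ∀ i j, HasWP j (v i) (weakPartial j (v i))) :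
    h1AlphaNormSq α v = ∫ ξ, wt α ξ * sqFT v ξ := by
  simp only [wt_mul_sqFT]
  have hI : ∀ i ∈ Finset.univ, Integrable
      (fun ξ => ∑ j, ‖dsym j ξ‖ ^ 2 * ‖FT (v i) ξ‖ ^ 2) :=
    fun i _ => integrable_finsetSum _ fun j _ => (h i j).integrable_norm_sq
  have hadd := integral_add (integrable_sqFT v) ((integrable_finsetSum _ hI).const_mul α)
  refine Eq.trans ?_ hadd.symm
  rw [integral_sqFT, integral_const_mul, integral_finsetSum _ hI, h1AlphaNormSq]
  congr 2
  refine Finset.sum_congr rfl fun i _ => ?_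
  rw [integral_finsetSum _ fun j _ => (h i j).integrable_norm_sq]
  exact Finset.sum_congr rfl fun j _ => (h i j).norm_sq_eq

theorem h1AlphaNormSq_nonneg {α : ℝ} (hα : 0 < α) (v : VF) : 0 ≤ h1AlphaNormSq α v := by
  unfold h1AlphaNormSq
  positivity

theorem norm_sq_le_h1AlphaNormSq {α : ℝ} (hα : 0 < α) (v : VF) (i : Fin 3) :
    ‖v i‖ ^ 2 ≤ h1AlphaNormSq α v := by
  have h1 : ‖v i‖ ^ 2 ≤ ∑ i, ‖v i‖ ^ 2 :=
    Finset.single_le_sum (f := fun i => ‖v i‖ ^ 2) (fun _ _ => sq_nonneg _) (Finset.mem_univ i)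
  have h2 : 0 ≤ α * ∑ i, ∑ j, ‖weakPartial j (v i)‖ ^ 2 :=
    mul_nonneg hα.le (Finset.sum_nonneg fun _ _ => Finset.sum_nonneg fun _ _ => sq_nonneg _)
  exact h1.trans (le_add_of_nonneg_right h2)

theorem norm_weakPartial_sq_le {α : ℝ} (hα : 0 < α) (v : VF) (i j : Fin 3) :
    α * ‖weakPartial j (v i)‖ ^ 2 ≤ h1AlphaNormSq α v := by
  have h1 : ‖weakPartial j (v i)‖ ^ 2 ≤ ∑ j, ‖weakPartial j (v i)‖ ^ 2 :=
    Finset.single_le_sum (f := fun j => ‖weakPartial j (v i)‖ ^ 2) (fun _ _ => sq_nonneg _)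
      (Finset.mem_univ j)
  have h2 : ∑ j, ‖weakPartial j (v i)‖ ^ 2 ≤ ∑ i, ∑ j, ‖weakPartial j (v i)‖ ^ 2 :=
    Finset.single_le_sum (f := fun i => ∑ j, ‖weakPartial j (v i)‖ ^ 2)
      (fun _ _ => Finset.sum_nonneg fun _ _ => sq_nonneg _) (Finset.mem_univ i)
  have h3 : 0 ≤ ∑ i, ‖v i‖ ^ 2 := Finset.sum_nonneg fun _ _ => sq_nonneg _
  exact (mul_le_mul_of_nonneg_left (h1.trans h2) hα.le).trans (le_add_of_nonneg_left h3)

theorem h1AlphaNormSq_add_vort {α : ℝ} (hα : 0 < α) (v : VF) :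
    h1AlphaNormSq α v + ∑ i, ‖vort α v i‖ ^ 2 = v2Norm α v ^ 2 := by
  rw [v2Norm, Real.sq_sqrt]
  · rfl
  · have := h1AlphaNormSq_nonneg hα v
    positivity

theorem h1AlphaNormSq_le_v2Norm_sq {α : ℝ} (hα : 0 < α) (v : VF) :
    h1AlphaNormSq α v ≤ v2Norm α v ^ 2 := by
  rw [← h1AlphaNormSq_add_vort hα]
  have : 0 ≤ ∑ i, ‖vort α v i‖ ^ 2 := by positivity
  linarith

theorem sum_norm_vort_sq_le {α : ℝ} (hα : 0 < α) (v : VF) :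
    ∑ i, ‖vort α v i‖ ^ 2 ≤ v2Norm α v ^ 2 := by
  rw [← h1AlphaNormSq_add_vort hα]
  have := h1AlphaNormSq_nonneg hα v
  linarith

theorem v2Norm_nonneg (α : ℝ) (v : VF) : 0 ≤ v2Norm α v := Real.sqrt_nonneg _

theorem norm_le_v2Norm {α : ℝ} (hα : 0 < α) (v : VF) (i : Fin 3) : ‖v i‖ ≤ v2Norm α v :=
  le_of_sq_le_sq ((norm_sq_le_h1AlphaNormSq hα v i).trans (h1AlphaNormSq_le_v2Norm_sq hα v))
    (v2Norm_nonneg α v)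

theorem norm_weakPartial_le {α : ℝ} (hα : 0 < α) (v : VF) (i j : Fin 3) :
    ‖weakPartial j (v i)‖ ≤ (1 + α⁻¹) * v2Norm α v := by
  have h := (norm_weakPartial_sq_le hα v i j).trans (h1AlphaNormSq_le_v2Norm_sq hα v)
  have hv := v2Norm_nonneg α v
  have hi : 0 < α⁻¹ := inv_pos.2 hα
  refine le_of_sq_le_sq ?_ (by positivity)
  have h2 : ‖weakPartial j (v i)‖ ^ 2 ≤ α⁻¹ * v2Norm α v ^ 2 := by
    rw [← div_eq_inv_mul, le_div_iff₀ hα]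
    linarith
  refine h2.trans ?_
  rw [mul_pow]
  gcongr
  nlinarith

theorem MemV2.norm_weakPartial_weakLaplacian_le {α : ℝ} (hα : 0 < α) {v : VF} (h : MemV2 α v)
    (i j : Fin 3) : ‖weakPartial j (weakLaplacian v i)‖ ≤ α⁻¹ * v2Norm α v := by
  have hv := v2Norm_nonneg α v
  refine le_of_sq_le_sq ?_ (by positivity)
  rw [norm_sq_eq_integral_FT, mul_pow]
  calc ∫ ξ, ‖FT (weakPartial j (weakLaplacian v i)) ξ‖ ^ 2
      ≤ ∫ ξ, α⁻¹ ^ 2 * sqFT (vort α v) ξ := by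
        refine integral_mono_ae (integrable_norm_sq_FT _) ((integrable_sqFT _).const_mul _) ?_
        filter_upwards [(h.hasWP_weakLaplacian hα i j).FT_eq,
          h.norm_dsym_mul_FT_weakLaplacian_le hα i j] with ξ h1 h2
        rw [h1]
        calc _ ≤ (α⁻¹ * √(sqFT (vort α v) ξ)) ^ 2 := by gcongr
          _ = _ := by rw [mul_pow, Real.sq_sqrt (sqFT_nonneg _ _)]
    _ = α⁻¹ ^ 2 * ∑ i, ‖vort α v i‖ ^ 2 := by rw [integral_const_mul, integral_sqFT]
    _ ≤ _ := by
        gcongr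
        exact sum_norm_vort_sq_le hα v

/-- A bound on `∫ |v̂|` (hence on `sup |v|`) by the norm of `V₂`. -/
theorem exists_integral_norm_FT_le {α : ℝ} (hα : 0 < α) : ∃ C : ℝ, 0 ≤ C ∧ ∀ v, MemV2 α v →
    ∀ i, Integrable (FT (v i)) ∧ ∫ ξ, ‖FT (v i) ξ‖ ≤ C * v2Norm α v := by
  -- The embedding `H² ⊂ L^∞` in dimension three: `(1 + |ξ|²)⁻¹` is square integrable because its
  -- square decays like `|ξ|⁻⁴` and `4 > 3`. Cauchy–Schwarz against `(1 + |ξ|²)|v̂|` then bounds `∫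
  -- |v̂|`.
  have hJ : MemLp (fun ξ : E3 => (1 + (2 * Real.pi * ‖ξ‖) ^ 2)⁻¹) 2 volume := by
    have hm : Continuous (fun ξ : E3 => (1 + (2 * Real.pi * ‖ξ‖) ^ 2)⁻¹) :=
      Continuous.inv₀ (by fun_prop) fun ξ => by positivity
    rw [memLp_two_iff_integrable_sq hm.aestronglyMeasurable]
    have h4 : Integrable (fun x : E3 => (1 + ‖x‖ ^ 2) ^ (-(4 : ℝ) / 2)) :=
      integrable_rpow_neg_one_add_norm_sq (by simp; norm_num)
    refine h4.mono' (hm.pow 2).aestronglyMeasurable (ae_of_all _ fun ξ => ?_)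
    have e : (1 + ‖ξ‖ ^ 2) ^ (-(4 : ℝ) / 2) = ((1 + ‖ξ‖ ^ 2)⁻¹) ^ 2 := by
      rw [show -(4 : ℝ) / 2 = -(2 : ℕ) by norm_num, Real.rpow_neg (by positivity),
        Real.rpow_natCast, inv_pow]
    rw [e, Real.norm_of_nonneg (by positivity)]
    have hpi : 1 ≤ 2 * Real.pi := by linarith [Real.pi_gt_three]
    have : ‖ξ‖ ≤ 2 * Real.pi * ‖ξ‖ := le_mul_of_one_le_left (norm_nonneg _) hpi
    gcongr
  set J : L2 := hJ.toLp _
  refine ⟨‖J‖ * (1 + (1 + α⁻¹) * √3), by positivity, fun v h i => ?_⟩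
  have hv := v2Norm_nonneg α v
  set g : L2 := ((memLp_FT (v i)).norm).toLp _ + (1 + α⁻¹) • (memLp_sqrt_sqFT (vort α v)).toLp _
  have hle : ∀ᵐ ξ, ‖FT (v i) ξ‖ ≤ J ξ * g ξ := by
    filter_upwards [hJ.coeFn_toLp, Lp.coeFn_add (((memLp_FT (v i)).norm).toLp _)
      ((1 + α⁻¹) • (memLp_sqrt_sqFT (vort α v)).toLp _), ((memLp_FT (v i)).norm).coeFn_toLp,
      Lp.coeFn_smul (1 + α⁻¹) ((memLp_sqrt_sqFT (vort α v)).toLp _),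
      (memLp_sqrt_sqFT (vort α v)).coeFn_toLp, sqrt_sqFT_vort hα h] with ξ h1 h2 h3 h4 h5 h6
    rw [h1, h2, Pi.add_apply, h3, h4, Pi.smul_apply, h5, h6, smul_eq_mul,
      inv_mul_eq_div, le_div_iff₀ (by positivity)]
    have h7 := mul_le_mul (pow_two_le_symbol hα ξ) (norm_FT_le_sqrt v i ξ) (norm_nonneg _)
      (by have := one_le_wt hα ξ; positivity)
    nlinarith
  have hint : Integrable (FT (v i)) := by
    refine (integrable_mul J g).mono' (memLp_FT (v i)).1 hle
  refine ⟨hint, ?_⟩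
  calc ∫ ξ, ‖FT (v i) ξ‖ ≤ ∫ ξ, ‖J ξ * g ξ‖ := by
        refine integral_mono_ae hint.norm (integrable_mul J g).norm ?_
        filter_upwards [hle] with ξ hξ
        exact hξ.trans (le_abs_self _)
    _ ≤ ‖J‖ * ‖g‖ := integral_norm_mul_le J g
    _ ≤ ‖J‖ * ((1 + (1 + α⁻¹) * √3) * v2Norm α v) := by
        gcongr
        have n1 : ‖((memLp_FT (v i)).norm).toLp _‖ ≤ v2Norm α v := by
          have : ‖((memLp_FT (v i)).norm).toLp _‖ = ‖FT (v i)‖ := by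
            rw [Lp.norm_toLp, Lp.norm_def, eLpNorm_norm]
          rw [this, norm_FT]
          exact norm_le_v2Norm hα v i
        have n2 : ‖(memLp_sqrt_sqFT (vort α v)).toLp _‖ ≤ √3 * v2Norm α v := by
          refine le_of_sq_le_sq ?_ (by positivity)
          have e : ‖(memLp_sqrt_sqFT (vort α v)).toLp _‖ ^ 2 = ∫ ξ, sqFT (vort α v) ξ := by
            rw [← real_inner_self_eq_norm_sq, L2.inner_def]
            refine integral_congr_ae ?_
            filter_upwards [(memLp_sqrt_sqFT (vort α v)).coeFn_toLp] with ξ hξ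
            rw [hξ, real_inner_self_eq_norm_sq, Real.norm_eq_abs, sq_abs,
              Real.sq_sqrt (sqFT_nonneg _ _)]
          rw [e, integral_sqFT, mul_pow, Real.sq_sqrt (by norm_num)]
          nlinarith [sum_norm_vort_sq_le hα v, sq_nonneg (v2Norm α v)]
        have hi : 0 < α⁻¹ := inv_pos.2 hα
        calc ‖g‖ ≤ _ := norm_add_le _ _
          _ ≤ v2Norm α v + (1 + α⁻¹) * (√3 * v2Norm α v) := by
            rw [norm_smul, Real.norm_of_nonneg (by positivity)]
            gcongr
          _ = _ := by ring
    _ = _ := by ring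

/-! ### The equation in Fourier variables -/

/-- The weak formulation at a fixed time, for the field `v` with time derivative `w`. -/
def WeakEquation (α μ : ℝ) (v w : VF) : Prop :=
  ∀ φ : Fin 3 → E3 → ℝ, IsTestField φ →
    pair w φ + α * gradPair w φ + μ * gradPair v φ + trilinear (fun i => v i) v φ
      - α * trilinear (fun i => v i) (weakLaplacian v) φ
      + α * trilinear φ (weakLaplacian v) (fun i => v i) = 0

/-- The nonlinear term `v·∇vᵢ - α v·∇Δvᵢ + α ∑ⱼ vⱼ ∂ᵢΔvⱼ` as a distribution. -/
def nlDist (α : ℝ) (v : VF) (i : Fin 3) : 𝓢'(E3, ℂ) :=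
  ∑ j, (prodDist (v j) (weakPartial j (v i))
    - (α : ℂ) • prodDist (v j) (weakPartial j (weakLaplacian v i))
    + (α : ℂ) • prodDist (v j) (weakPartial i (weakLaplacian v j)))

/-- The Fourier transform of the nonlinear term. -/
def nlFT (α : ℝ) (v : VF) (i : Fin 3) (ξ : E3) : ℂ :=
  ∑ j, (prodFT (v j) (weakPartial j (v i)) ξ
    - (α : ℂ) * prodFT (v j) (weakPartial j (weakLaplacian v i)) ξ
    + (α : ℂ) * prodFT (v j) (weakPartial i (weakLaplacian v j)) ξ)

theorem isFourier_nlDist (α : ℝ) (v : VF) (i : Fin 3) :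
    IsFourier (nlDist α v i) (nlFT α v i) :=
  IsFourier.sum Finset.univ fun _ => ((isFourier_prodDist _ _).sub
    ((isFourier_prodDist _ _).smul α)).add ((isFourier_prodDist _ _).smul α)

/-- The residual of the momentum equation without pressure. -/
def residual (α μ : ℝ) (v w : VF) (i : Fin 3) : 𝓢'(E3, ℂ) :=
  (toDist (w i) - (α : ℂ) • Δ (toDist (w i))) - (μ : ℂ) • Δ (toDist (v i)) + nlDist α v i

theorem isFourier_residual (α μ : ℝ) (v w : VF) (i : Fin 3) :
    IsFourier (residual α μ v w i) (fun ξ => (wt α ξ : ℂ) * FT (w i) ξ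
      + ((μ * (2 * Real.pi * ‖ξ‖) ^ 2 : ℝ) : ℂ) * FT (v i) ξ + nlFT α v i ξ) := by
  refine (((isFourier_filtered α (w i)).sub ((isFourier_toDist (v i)).laplacian.smul μ)).add
    (isFourier_nlDist α v i)).congr (ae_of_all _ fun ξ => ?_)
  push_cast
  ring

theorem laplacian_toDist_cplx {f : L2} (h : ∀ j, HasWP j f (weakPartial j f)) (ψ : 𝓢(E3, ℝ)) :
    Δ (toDist f) (cplx ψ) =
      ((-∑ j, ∫ x, weakPartial j f x * fderiv ℝ ψ x (stdVec j) : ℝ) : ℂ) := by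
  have e : Δ (toDist f) (cplx ψ) = ∑ j, ∂_{stdVec j} (toDist (weakPartial j f)) (cplx ψ) := by
    rw [laplacian_eq_sum_stdVec, Finset.sum_congr rfl fun j _ => by rw [h j]]
    simp
  rw [e]
  simp only [toDist_lineDeriv_cplx, SchwartzMap.lineDerivOp_apply_eq_fderiv]
  push_cast
  rw [Finset.sum_neg_distrib]

theorem nlDist_cplx (α : ℝ) (v : VF) (i : Fin 3) (ψ : 𝓢(E3, ℝ)) :
    nlDist α v i (cplx ψ) = ((∑ j, ((∫ x, v j x * weakPartial j (v i) x * ψ x)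
      - α * (∫ x, v j x * weakPartial j (weakLaplacian v i) x * ψ x)
      + α * ∫ x, v j x * weakPartial i (weakLaplacian v j) x * ψ x) : ℝ) : ℂ) := by
  have e : nlDist α v i (cplx ψ) = ∑ j, (prodDist (v j) (weakPartial j (v i)) (cplx ψ)
      - (α : ℂ) * prodDist (v j) (weakPartial j (weakLaplacian v i)) (cplx ψ)
      + (α : ℂ) * prodDist (v j) (weakPartial i (weakLaplacian v j)) (cplx ψ)) := by
    simp only [nlDist, Fin.sum_univ_three]
    rfl
  rw [e]
  simp only [prodDist_cplx]
  push_cast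
  rfl

theorem residual_cplx {α μ : ℝ} {v w : VF} (hv : ∀ i j, HasWP j (v i) (weakPartial j (v i)))
    (hw : ∀ i j, HasWP j (w i) (weakPartial j (w i))) (φ : Fin 3 → 𝓢(E3, ℝ)) :
    ∑ i, residual α μ v w i (cplx (φ i)) = ((pair w (fun i => φ i) + α * gradPair w (fun i => φ i)
      + μ * gradPair v (fun i => φ i) + trilinear (fun i => v i) v (fun i => φ i)
      - α * trilinear (fun i => v i) (weakLaplacian v) (fun i => φ i)
      + α * trilinear (fun i => φ i) (weakLaplacian v) (fun i => v i) : ℝ) : ℂ) := by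
  have e : ∀ i, residual α μ v w i (cplx (φ i)) = toDist (w i) (cplx (φ i))
      - (α : ℂ) * Δ (toDist (w i)) (cplx (φ i)) - (μ : ℂ) * Δ (toDist (v i)) (cplx (φ i))
      + nlDist α v i (cplx (φ i)) := fun i => rfl
  have hsw : trilinear (fun i => φ i) (weakLaplacian v) (fun i => v i)
      = ∑ i, ∑ j, ∫ x, v j x * weakPartial i (weakLaplacian v j) x * φ i x := by
    rw [trilinear, Finset.sum_comm]
    refine Finset.sum_congr rfl fun i _ => Finset.sum_congr rfl fun j _ => ?_
    congr 1
    ext x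
    ring
  simp only [e, toDist_cplx, laplacian_toDist_cplx (hw _), laplacian_toDist_cplx (hv _),
    nlDist_cplx]
  rw [hsw]
  norm_cast
  simp only [pair, gradPair, trilinear, Finset.sum_add_distrib, Finset.sum_sub_distrib,
    Finset.mul_sum, mul_neg, Finset.sum_neg_distrib]
  ring

theorem lineDerivOp_comm_apply (ψ : 𝓢(E3, ℝ)) (m n : E3) (x : E3) :
    (∂_{m} (∂_{n} ψ)) x = (∂_{n} (∂_{m} ψ)) x := by
  have h : ∀ a b : E3, (∂_{a} (∂_{b} ψ)) x = fderiv ℝ (fderiv ℝ ψ) x a b := by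
    intro a b
    rw [SchwartzMap.lineDerivOp_apply_eq_fderiv]
    have e : ((∂_{b} ψ : 𝓢(E3, ℝ)) : E3 → ℝ) = fun y => fderiv ℝ ψ y b := by
      ext y
      rw [SchwartzMap.lineDerivOp_apply_eq_fderiv]
    rw [e]
    have hd : DifferentiableAt ℝ (fderiv ℝ ψ) x :=
      (((ψ.smooth ⊤).fderiv_right (m := 1) (WithTop.coe_le_coe.2 le_top :
        ((2 : ℕ∞) : ℕ∞ω) ≤ ((⊤ : ℕ∞) : ℕ∞ω))).differentiable
        one_ne_zero) x
    rw [fderiv_clm_apply hd (differentiableAt_const b)]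
    simp
  rw [h, h]
  have hs : IsSymmSndFDerivAt ℝ ψ x :=
    (ψ.smooth ⊤).contDiffAt.isSymmSndFDerivAt (by
      rw [minSmoothness_of_isRCLikeNormedField]
      exact (WithTop.coe_le_coe.2 le_top : ((2 : ℕ∞) : ℕ∞ω) ≤ ((⊤ : ℕ∞) : ℕ∞ω)))
  exact hs m n

theorem hasCompactSupport_lineDerivOp {ψ : 𝓢(E3, ℝ)} (h : HasCompactSupport ψ) (m : E3) :
    HasCompactSupport (∂_{m} ψ : 𝓢(E3, ℝ)) :=
  h.of_isClosed_subset (isClosed_tsupport _) (SchwartzMap.tsupport_lineDerivOp_subset m ψ)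

/-- This eliminates the pressure. For `a ≠ b`, the field with `-∂ₐψ` in position `b` and `∂_bψ` in
position `a` is divergence-free, hence admissible, and pairing the residual with it gives one
component of its curl tested against `ψ`. -/
theorem curl_residual_eq_zero {α μ : ℝ} {v w : VF}
    (hv : ∀ i j, HasWP j (v i) (weakPartial j (v i)))
    (hw : ∀ i j, HasWP j (w i) (weakPartial j (w i))) (h : WeakEquation α μ v w) {a b : Fin 3}
    (hab : a ≠ b) :
    ∂_{stdVec a} (residual α μ v w b) - ∂_{stdVec b} (residual α μ v w a) = 0 := by
  refine eq_zero_of_forall_hasCompactSupport fun ψ hψ => ?_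
  set φ : Fin 3 → 𝓢(E3, ℝ) := fun k =>
    if k = b then -∂_{stdVec a} ψ else if k = a then ∂_{stdVec b} ψ else 0 with hφ
  have hφb : φ b = -∂_{stdVec a} ψ := by simp [hφ]
  have hφa : φ a = ∂_{stdVec b} ψ := by simp [hφ, hab]
  have hφ0 : ∀ k, k ≠ b → k ≠ a → φ k = 0 := fun k h1 h2 => by simp [hφ, h1, h2]
  have hsum : ∀ {M : Type} [AddCommMonoid M] (F : Fin 3 → M),
      (∀ k, k ≠ b → k ≠ a → F k = 0) → ∑ k, F k = F a + F b := by
    intro M _ F hF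
    rw [← Finset.sum_pair hab]
    symm
    refine Finset.sum_subset (Finset.subset_univ _) fun k _ hk => ?_
    simp only [Finset.mem_insert, Finset.mem_singleton, not_or] at hk
    exact hF k hk.2 hk.1
  have ht : IsTestField (fun k => φ k) := by
    refine ⟨fun k => (φ k).smooth ⊤, fun k => ?_, fun x => ?_⟩
    · by_cases h1 : k = b
      · rw [h1, hφb]
        exact (hasCompactSupport_lineDerivOp hψ _).neg
      · by_cases h2 : k = a
        · rw [h2, hφa]
          exact hasCompactSupport_lineDerivOp hψ _
        · rw [hφ0 k h1 h2]
          exact HasCompactSupport.zero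
    · have e : ∀ k, fderiv ℝ (φ k) x (stdVec k) = (∂_{stdVec k} (φ k)) x := fun k =>
        (SchwartzMap.lineDerivOp_apply_eq_fderiv _ _ _).symm
      simp only [e]
      rw [hsum _ fun k h1 h2 => by rw [hφ0 k h1 h2, LineDeriv.lineDerivOp_zero]; rfl, hφa, hφb,
        LineDeriv.lineDerivOp_neg, neg_apply, lineDerivOp_comm_apply, add_neg_cancel]
  have hres := residual_cplx (α := α) (μ := μ) hv hw φ
  rw [h _ ht, hsum _ fun k h1 h2 => by rw [hφ0 k h1 h2, map_zero, map_zero], hφa, hφb] at hres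
  have e : (∂_{stdVec a} (residual α μ v w b) - ∂_{stdVec b} (residual α μ v w a)) (cplx ψ)
      = residual α μ v w b (-∂_{stdVec a} (cplx ψ))
        - residual α μ v w a (-∂_{stdVec b} (cplx ψ)) := rfl
  rw [e, lineDerivOp_cplx, lineDerivOp_cplx]
  rw [map_neg, map_neg] at hres
  rw [map_neg, map_neg]
  simp only [Complex.ofReal_zero] at hres
  linear_combination hres

/-- The curl condition makes `G` parallel to `ξ`, and `V` is orthogonal to `ξ`. Multiplying by one
nonzero `ξₖ` makes this explicit. -/
theorem sum_conj_mul_eq_zero {ξ : E3} (hξ : ξ ≠ 0) {G V : Fin 3 → ℂ}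
    (hG : ∀ a b : Fin 3, dsym a ξ * G b = dsym b ξ * G a) (hV : ∑ i, dsym i ξ * V i = 0) :
    ∑ i, G i * starRingEnd ℂ (V i) = 0 := by
  obtain ⟨k, hk⟩ : ∃ k, ξ k ≠ 0 := by
    by_contra! h
    exact hξ (by ext k; exact h k)
  have hdk : dsym k ξ ≠ 0 := by
    simp [dsym, hk, Real.pi_ne_zero]
  have hV' : ∑ i, dsym i ξ * starRingEnd ℂ (V i) = 0 := by
    have := congrArg (starRingEnd ℂ) hV
    simp only [map_sum, map_mul, conj_dsym, map_zero, neg_mul, Finset.sum_neg_distrib,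
      neg_eq_zero] at this
    exact this
  refine (mul_eq_zero.1 (?_ : dsym k ξ * _ = 0)).resolve_left hdk
  rw [Finset.mul_sum]
  have e : ∀ i, dsym k ξ * (G i * starRingEnd ℂ (V i))
      = G k * (dsym i ξ * starRingEnd ℂ (V i)) := fun i => by
    rw [← mul_assoc, hG k i]
    ring
  rw [Finset.sum_congr rfl fun i _ => e i, ← Finset.mul_sum, hV', mul_zero]

/-- The weak formulation tested, frequency by frequency, with the solution itself. -/
theorem WeakEquation.fourier {α μ : ℝ} {v w : VF} (hv2 : MemV2 α v) (hw1 : MemV w)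
    (h : WeakEquation α μ v w) :
    ∀ᵐ ξ, ∑ i, ((wt α ξ : ℂ) * FT (w i) ξ + ((μ * (2 * Real.pi * ‖ξ‖) ^ 2 : ℝ) : ℂ) * FT (v i) ξ
      + nlFT α v i ξ) * starRingEnd ℂ (FT (v i) ξ) = 0 := by
  have hw : ∀ i j, HasWP j (w i) (weakPartial j (w i)) := fun i j =>
    (exists_hasWP_of_memHs hw1.1 i j).choose_spec.hasWP_weakPartial
  have hcurl : ∀ a b : Fin 3, ∀ᵐ ξ, dsym a ξ * ((wt α ξ : ℂ) * FT (w b) ξ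
      + ((μ * (2 * Real.pi * ‖ξ‖) ^ 2 : ℝ) : ℂ) * FT (v b) ξ + nlFT α v b ξ)
      = dsym b ξ * ((wt α ξ : ℂ) * FT (w a) ξ
      + ((μ * (2 * Real.pi * ‖ξ‖) ^ 2 : ℝ) : ℂ) * FT (v a) ξ + nlFT α v a ξ) := by
    intro a b
    by_cases hab : a = b
    · subst hab
      exact ae_of_all _ fun ξ => rfl
    have h1 := ((isFourier_residual α μ v w b).lineDeriv a).sub
      ((isFourier_residual α μ v w a).lineDeriv b)
    rw [curl_residual_eq_zero hv2.hasWP hw h hab] at h1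
    filter_upwards [h1.unique IsFourier.zero] with ξ hξ
    exact sub_eq_zero.1 hξ
  have h0 : ∀ᵐ ξ : E3, ξ ≠ 0 := by
    simp [ae_iff]
  filter_upwards [ae_all_iff.2 fun a => ae_all_iff.2 (hcurl a), isDivFree_FT hv2.1.2, h0]
    with ξ h1 h2 h3
  exact sum_conj_mul_eq_zero h3 h1 h2

/-! ### Estimates for the nonlinear term -/

/-- The letters stand for transforms of products: `A j i k` for `vⱼ∂ₖvᵢ`, `B j i k` for `vⱼ∂ₖΔvᵢ`,
`T j i k` for `∂ₖ∂ᵢvⱼ ∂ₖvⱼ`, `P` for `vⱼvᵢ`, `Q` for `vⱼΔvᵢ`, `S` for `∂ᵢvⱼΔvⱼ`, `R j k i l` for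
`∂ₖvⱼ∂ₗvᵢ`, and `d` for the symbols. The hypotheses are product rules together with `div v = 0`. The
computation is `vⱼΔvᵢ = ∂ₖ(vⱼ∂ₖvᵢ) - ∂ₖvⱼ∂ₖvᵢ`, `vⱼ∂ᵢΔvⱼ = ∂ᵢ(vⱼΔvⱼ) - ∂ᵢvⱼΔvⱼ` and `∂ᵢvⱼΔvⱼ =
∂ₖ(∂ᵢvⱼ∂ₖvⱼ) - ½∂ᵢ|∇v|²` (summed over repeated `j`, `k`): second derivatives survive only inside the
gradient. -/
theorem divergence_form_algebra (α : ℂ) (d : Fin 3 → ℂ) (A B T : Fin 3 → Fin 3 → Fin 3 → ℂ)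
    (P Q S : Fin 3 → Fin 3 → ℂ) (R : Fin 3 → Fin 3 → Fin 3 → Fin 3 → ℂ)
    (h1 : ∀ i, ∑ j, A j i j = ∑ j, d j * P j i) (h2 : ∀ i, ∑ j, B j i j = ∑ j, d j * Q j i)
    (h3 : ∀ j i, Q j i = ∑ k, (d k * A j i k - R j k i k))
    (h4 : ∀ j i, S j i + B j j i = d i * Q j j)
    (h5 : ∀ j i, S j i = ∑ k, (d k * R j i j k - T j i k))
    (h6 : ∀ j i k, 2 * T j i k = d i * R j k j k) (i : Fin 3) :
    ∑ j, (A j i j - α * B j i j + α * B j j i)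
      = ∑ j, d j * (P j i - α * ∑ k, (d k * A j i k - R j k i k) - α * ∑ k, R k i k j)
        + d i * (α * ∑ j, Q j j + α / 2 * ∑ j, ∑ k, R j k j k) := by
  have hB : ∀ j, B j j i = d i * Q j j - S j i := fun j => by rw [← h4]; ring
  have hT : ∀ j k, T j i k = d i * R j k j k / 2 := fun j k => by rw [← h6]; ring
  have hS : ∑ j, S j i = ∑ j, d j * ∑ k, R k i k j - ∑ j, ∑ k, d i * R j k j k / 2 := by
    simp only [h5, hT, Finset.sum_sub_distrib, Finset.mul_sum]
    rw [Finset.sum_comm]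
  simp only [← h3, Finset.sum_add_distrib, Finset.sum_sub_distrib, ← Finset.mul_sum, mul_sub, h1,
    h2, hB, hS]
  simp only [Finset.mul_sum, mul_add]
  simp only [mul_div_assoc, mul_left_comm α, Fin.sum_univ_three]
  ring

/-- The tensor whose divergence is the nonlinear term, up to a gradient. -/
def stressFT (α : ℝ) (v : VF) (j i : Fin 3) (ξ : E3) : ℂ :=
  prodFT (v j) (v i) ξ
    - α * ∑ k, (dsym k ξ * prodFT (v j) (weakPartial k (v i)) ξ
      - prodFT (weakPartial k (v j)) (weakPartial k (v i)) ξ)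
    - α * ∑ k, prodFT (weakPartial i (v k)) (weakPartial j (v k)) ξ

/-- The nonlinear term is the divergence of `stressFT` up to a gradient. -/
theorem MemV2.exists_nlFT_eq {α : ℝ} (hα : 0 < α) {v : VF} (h : MemV2 α v) :
    ∃ p : E3 → ℂ, ∀ᵐ ξ, ∀ i, nlFT α v i ξ = ∑ j, dsym j ξ * stressFT α v j i ξ
      + dsym i ξ * p ξ := by
  refine ⟨fun ξ => α * ∑ j, prodFT (v j) (weakLaplacian v j) ξ + α / 2 * ∑ j, ∑ k,
    prodFT (weakPartial k (v j)) (weakPartial k (v j)) ξ, ?_⟩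
  have hdiv : ∀ g ξ, ∑ j, prodFT (weakPartial j (v j)) g ξ = 0 := fun g ξ => by
    simp only [prodFT_comm _ g, ← prodFT_sum_right, h.sum_weakPartial_eq_zero, prodFT_zero_right]
  have e1 : ∀ᵐ ξ, ∀ j i, prodFT (weakPartial j (v j)) (v i) ξ + prodFT (v j) (weakPartial j (v i)) ξ
      = dsym j ξ * prodFT (v j) (v i) ξ := by
    simp only [ae_all_iff]
    exact fun j i => prodFT_deriv (h.hasWP j j) (h.hasWP i j)
  have e2 : ∀ᵐ ξ, ∀ j i, prodFT (weakPartial j (v j)) (weakLaplacian v i) ξ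
      + prodFT (v j) (weakPartial j (weakLaplacian v i)) ξ
      = dsym j ξ * prodFT (v j) (weakLaplacian v i) ξ := by
    simp only [ae_all_iff]
    exact fun j i => prodFT_deriv (h.hasWP j j) (h.hasWP_weakLaplacian hα i j)
  have e3 : ∀ᵐ ξ, ∀ j i k, prodFT (weakPartial k (v j)) (weakPartial k (v i)) ξ
      + prodFT (v j) (weakPartial k (weakPartial k (v i))) ξ
      = dsym k ξ * prodFT (v j) (weakPartial k (v i)) ξ := by
    simp only [ae_all_iff]
    exact fun j i k => prodFT_deriv (h.hasWP j k) (h.hasWP₂ hα i k k)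
  have e4 : ∀ᵐ ξ, ∀ j i, prodFT (weakPartial i (v j)) (weakLaplacian v j) ξ
      + prodFT (v j) (weakPartial i (weakLaplacian v j)) ξ
      = dsym i ξ * prodFT (v j) (weakLaplacian v j) ξ := by
    simp only [ae_all_iff]
    exact fun j i => prodFT_deriv (h.hasWP j i) (h.hasWP_weakLaplacian hα j i)
  have e5 : ∀ᵐ ξ, ∀ j i k, prodFT (weakPartial k (weakPartial i (v j))) (weakPartial k (v j)) ξ
      + prodFT (weakPartial i (v j)) (weakPartial k (weakPartial k (v j))) ξ
      = dsym k ξ * prodFT (weakPartial i (v j)) (weakPartial k (v j)) ξ := by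
    simp only [ae_all_iff]
    exact fun j i k => prodFT_deriv (h.hasWP₂ hα j i k) (h.hasWP₂ hα j k k)
  have e6 : ∀ᵐ ξ, ∀ j i k, prodFT (weakPartial i (weakPartial k (v j))) (weakPartial k (v j)) ξ
      + prodFT (weakPartial k (v j)) (weakPartial i (weakPartial k (v j))) ξ
      = dsym i ξ * prodFT (weakPartial k (v j)) (weakPartial k (v j)) ξ := by
    simp only [ae_all_iff]
    exact fun j i k => prodFT_deriv (h.hasWP₂ hα j k i) (h.hasWP₂ hα j k i)
  filter_upwards [e1, e2, e3, e4, e5, e6] with ξ e1 e2 e3 e4 e5 e6 i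
  have hL : ∀ g i, prodFT g (weakLaplacian v i) ξ
      = ∑ k, prodFT g (weakPartial k (weakPartial k (v i))) ξ := fun g i => by
    rw [h.weakLaplacian_eq hα, prodFT_sum_right]
  exact divergence_form_algebra α (fun j => dsym j ξ)
    (fun j i k => prodFT (v j) (weakPartial k (v i)) ξ)
    (fun j i k => prodFT (v j) (weakPartial k (weakLaplacian v i)) ξ)
    (fun j i k => prodFT (weakPartial k (weakPartial i (v j))) (weakPartial k (v j)) ξ)
    (fun j i => prodFT (v j) (v i) ξ) (fun j i => prodFT (v j) (weakLaplacian v i) ξ)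
    (fun j i => prodFT (weakPartial i (v j)) (weakLaplacian v j) ξ)
    (fun j k i l => prodFT (weakPartial k (v j)) (weakPartial l (v i)) ξ)
    (fun i => by simp only [← e1, Finset.sum_add_distrib, hdiv, zero_add])
    (fun i => by simp only [← e2, Finset.sum_add_distrib, hdiv, zero_add])
    (fun j i => by
      rw [hL]
      exact Finset.sum_congr rfl fun k _ => by rw [← e3]; ring)
    (fun j i => e4 j i)
    (fun j i => by
      rw [hL]
      exact Finset.sum_congr rfl fun k _ => by rw [← e5]; ring)
    (fun j i k => by
      rw [← e6, prodFT_comm (weakPartial k (v j)), h.weakPartial_comm hα j i k]; ring) i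

/-- Only `v` and `∇v` enter the tensor, so the energy alone bounds it, without the `V₂` norm; this
is what makes decay of the energy usable. The factor `1 + ‖ξ‖` comes from the one derivative left
outside a product. -/
theorem norm_stressFT_le {α : ℝ} (hα : 0 < α) (v : VF) (j i : Fin 3) (ξ : E3) :
    ‖stressFT α v j i ξ‖ ≤ (7 + 6 * Real.pi * (1 + α)) * (1 + ‖ξ‖) * h1AlphaNormSq α v := by
  set E := h1AlphaNormSq α v
  have hE : 0 ≤ E := h1AlphaNormSq_nonneg hα v
  have hv := norm_sq_le_h1AlphaNormSq hα v
  have hD := norm_weakPartial_sq_le hα v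
  have hp := Real.pi_pos
  have hξ := norm_nonneg ξ
  have b1 : ‖prodFT (v j) (v i) ξ‖ ≤ E := by
    refine (norm_prodFT_le _ _ _).trans ?_
    nlinarith [hv i, hv j, sq_nonneg (‖v j‖ - ‖v i‖)]
  have b2 : ∀ a b c d, α * ‖prodFT (weakPartial a (v b)) (weakPartial c (v d)) ξ‖ ≤ E := by
    intro a b c d
    refine (mul_le_mul_of_nonneg_left (norm_prodFT_le _ _ _) hα.le).trans ?_
    nlinarith [hD b a, hD d c,
      mul_nonneg hα.le (sq_nonneg (‖weakPartial a (v b)‖ - ‖weakPartial c (v d)‖))]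
  have b3 : ∀ k, α * ‖prodFT (v j) (weakPartial k (v i)) ξ‖ ≤ (1 + α) * E := by
    intro k
    refine (mul_le_mul_of_nonneg_left (norm_prodFT_le _ _ _) hα.le).trans ?_
    nlinarith [hv j, hD i k, mul_nonneg hα.le (sq_nonneg (‖v j‖ - ‖weakPartial k (v i)‖)),
      mul_le_mul_of_nonneg_left (hv j) hα.le, mul_nonneg hα.le hE]
  have b4 : ∀ k, α * ‖dsym k ξ * prodFT (v j) (weakPartial k (v i)) ξ
      - prodFT (weakPartial k (v j)) (weakPartial k (v i)) ξ‖
      ≤ 2 * Real.pi * ‖ξ‖ * ((1 + α) * E) + E := by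
    intro k
    calc _ ≤ α * (‖dsym k ξ‖ * ‖prodFT (v j) (weakPartial k (v i)) ξ‖
          + ‖prodFT (weakPartial k (v j)) (weakPartial k (v i)) ξ‖) := by
          rw [← norm_mul]
          gcongr
          exact norm_sub_le _ _
      _ = ‖dsym k ξ‖ * (α * ‖prodFT (v j) (weakPartial k (v i)) ξ‖)
          + α * ‖prodFT (weakPartial k (v j)) (weakPartial k (v i)) ξ‖ := by ring
      _ ≤ _ := by
          exact add_le_add (mul_le_mul (norm_dsym_le k ξ) (b3 k) (by positivity) (by positivity))
            (b2 _ _ _ _)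
  have nα : ‖(α : ℂ)‖ = α := by rw [Complex.norm_real, Real.norm_of_nonneg hα.le]
  have c1 : ‖(α : ℂ) * ∑ k, (dsym k ξ * prodFT (v j) (weakPartial k (v i)) ξ
      - prodFT (weakPartial k (v j)) (weakPartial k (v i)) ξ)‖
      ≤ 3 * (2 * Real.pi * ‖ξ‖ * ((1 + α) * E) + E) := by
    rw [norm_mul, nα]
    refine (mul_le_mul_of_nonneg_left (norm_sum_le _ _) hα.le).trans ?_
    rw [Finset.mul_sum, Fin.sum_univ_three]
    linarith [b4 0, b4 1, b4 2]
  have c2 : ‖(α : ℂ) * ∑ k, prodFT (weakPartial i (v k)) (weakPartial j (v k)) ξ‖ ≤ 3 * E := by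
    rw [norm_mul, nα]
    refine (mul_le_mul_of_nonneg_left (norm_sum_le _ _) hα.le).trans ?_
    rw [Finset.mul_sum, Fin.sum_univ_three]
    linarith [b2 i 0 j 0, b2 i 1 j 1, b2 i 2 j 2]
  have c3 := norm_sub_le (prodFT (v j) (v i) ξ
    - α * ∑ k, (dsym k ξ * prodFT (v j) (weakPartial k (v i)) ξ
      - prodFT (weakPartial k (v j)) (weakPartial k (v i)) ξ))
    (α * ∑ k, prodFT (weakPartial i (v k)) (weakPartial j (v k)) ξ)
  have c4 := norm_sub_le (prodFT (v j) (v i) ξ)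
    (α * ∑ k, (dsym k ξ * prodFT (v j) (weakPartial k (v i)) ξ
      - prodFT (weakPartial k (v j)) (weakPartial k (v i)) ξ))
  unfold stressFT
  have p1 : 0 ≤ ‖ξ‖ * E := by positivity
  have p2 : 0 ≤ Real.pi * (1 + α) * E := by positivity
  nlinarith

/-- The gradient part drops out against the divergence-free `v`. There remain nine entries, each
with a symbol of size at most `2π‖ξ‖`, whence `18π`. -/
theorem MemV2.norm_sum_nlFT_mul_conj_le {α : ℝ} (hα : 0 < α) {v : VF} (h : MemV2 α v) :
    ∀ᵐ ξ, ‖∑ i, nlFT α v i ξ * starRingEnd ℂ (FT (v i) ξ)‖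
      ≤ 18 * Real.pi * (7 + 6 * Real.pi * (1 + α)) * (‖ξ‖ * (1 + ‖ξ‖)) * h1AlphaNormSq α v
        * √(sqFT v ξ) := by
  obtain ⟨p, hp⟩ := h.exists_nlFT_eq hα
  filter_upwards [hp, isDivFree_FT h.1.2] with ξ h1 h2
  have h3 : ∑ i, dsym i ξ * starRingEnd ℂ (FT (v i) ξ) = 0 := by
    have := congrArg (starRingEnd ℂ) h2
    simp only [map_sum, map_mul, conj_dsym, map_zero, neg_mul, Finset.sum_neg_distrib,
      neg_eq_zero] at this
    exact this
  have h4 : ∑ i, nlFT α v i ξ * starRingEnd ℂ (FT (v i) ξ)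
      = ∑ i, ∑ j, dsym j ξ * stressFT α v j i ξ * starRingEnd ℂ (FT (v i) ξ) := by
    have e : ∀ i, nlFT α v i ξ * starRingEnd ℂ (FT (v i) ξ)
        = ∑ j, dsym j ξ * stressFT α v j i ξ * starRingEnd ℂ (FT (v i) ξ)
          + p ξ * (dsym i ξ * starRingEnd ℂ (FT (v i) ξ)) := fun i => by
      rw [h1, add_mul, Finset.sum_mul]
      ring
    rw [Finset.sum_congr rfl fun i _ => e i, Finset.sum_add_distrib, ← Finset.mul_sum, h3,
      mul_zero, add_zero]
  have hE := h1AlphaNormSq_nonneg hα v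
  have hb : ∀ i j, ‖dsym j ξ * stressFT α v j i ξ * starRingEnd ℂ (FT (v i) ξ)‖
      ≤ 2 * Real.pi * ‖ξ‖ * ((7 + 6 * Real.pi * (1 + α)) * (1 + ‖ξ‖) * h1AlphaNormSq α v)
        * √(sqFT v ξ) := by
    intro i j
    rw [norm_mul, norm_mul, RCLike.norm_conj]
    have := Real.pi_pos
    gcongr
    · exact norm_dsym_le j ξ
    · exact norm_stressFT_le hα v j i ξ
    · exact norm_FT_le_sqrt v i ξ
  rw [h4]
  refine (norm_sum_le _ _).trans ((Finset.sum_le_sum fun i _ => norm_sum_le _ _).trans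
    ((Finset.sum_le_sum fun i _ => Finset.sum_le_sum fun j _ => hb i j).trans (le_of_eq ?_)))
  simp only [Finset.sum_const, Finset.card_univ, Fintype.card_fin, nsmul_eq_mul]
  push_cast
  ring

/-- Unlike the divergence-form estimate, this one is uniform in `ξ`. With `v̂` integrable, it makes
the flux integrable over all frequencies. -/
theorem MemV2.norm_nlFT_le {α : ℝ} (hα : 0 < α) {v : VF} (h : MemV2 α v) (i : Fin 3) (ξ : E3) :
    ‖nlFT α v i ξ‖ ≤ 3 * (3 + α⁻¹) * v2Norm α v ^ 2 := by
  set N := v2Norm α v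
  have hN : 0 ≤ N := v2Norm_nonneg α v
  have hi : 0 < α⁻¹ := inv_pos.2 hα
  have nα : ‖(α : ℂ)‖ = α := by rw [Complex.norm_real, Real.norm_of_nonneg hα.le]
  have b1 : ∀ j, ‖prodFT (v j) (weakPartial j (v i)) ξ‖ ≤ (1 + α⁻¹) * N ^ 2 := fun j => by
    refine (norm_prodFT_le _ _ _).trans ((mul_le_mul (norm_le_v2Norm hα v j)
      (norm_weakPartial_le hα v i j) (norm_nonneg _) hN).trans (le_of_eq ?_))
    ring
  have b2 : ∀ j k l, ‖(α : ℂ) * prodFT (v j) (weakPartial k (weakLaplacian v l)) ξ‖ ≤ N ^ 2 := by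
    intro j k l
    rw [norm_mul, nα]
    refine (mul_le_mul_of_nonneg_left ((norm_prodFT_le _ _ _).trans
      (mul_le_mul (norm_le_v2Norm hα v j) (h.norm_weakPartial_weakLaplacian_le hα l k)
        (norm_nonneg _) hN)) hα.le).trans (le_of_eq ?_)
    field_simp
    rfl
  have b3 : ∀ j, ‖prodFT (v j) (weakPartial j (v i)) ξ
    - (α : ℂ) * prodFT (v j) (weakPartial j (weakLaplacian v i)) ξ
    + (α : ℂ) * prodFT (v j) (weakPartial i (weakLaplacian v j)) ξ‖ ≤ (3 + α⁻¹) * N ^ 2 := by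
    intro j
    refine (norm_add_le _ _).trans ?_
    have := norm_sub_le (prodFT (v j) (weakPartial j (v i)) ξ)
      ((α : ℂ) * prodFT (v j) (weakPartial j (weakLaplacian v i)) ξ)
    linarith [b1 j, b2 j j i, b2 j i j]
  unfold nlFT
  refine (norm_sum_le _ _).trans ((Finset.sum_le_sum fun j _ => b3 j).trans (le_of_eq ?_))
  simp only [Finset.sum_const, Finset.card_univ, Fintype.card_fin, nsmul_eq_mul]
  push_cast
  ring

theorem continuous_nlFT (α : ℝ) (v : VF) (i : Fin 3) : Continuous (nlFT α v i) := by
  unfold nlFT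
  exact continuous_finsetSum _ fun j _ => ((continuous_prodFT _ _).sub
    (continuous_const.mul (continuous_prodFT _ _))).add
    (continuous_const.mul (continuous_prodFT _ _))

theorem integral_sub_add_const_mul (c : ℂ) {f g h : E3 → ℂ} (hf : Integrable f)
    (hg : Integrable g) (hh : Integrable h) :
    ∫ ξ, (f ξ - c * g ξ + c * h ξ) = (∫ ξ, f ξ) - c * (∫ ξ, g ξ) + c * ∫ ξ, h ξ := by
  have h1 := integral_add (hf.sub (hg.const_mul c)) (hh.const_mul c)
  have h2 := integral_sub hf (hg.const_mul c)
  simp only [Pi.sub_apply] at h1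
  rw [h1, h2, integral_const_mul, integral_const_mul]

theorem integral_nlFT_mul_conj (α : ℝ) {v : VF} (i : Fin 3) (hI : Integrable (FT (v i))) :
    ∫ ξ, nlFT α v i ξ * starRingEnd ℂ (FT (v i) ξ)
      = ∑ j, (((∫ x, v j x * weakPartial j (v i) x * v i x : ℝ) : ℂ)
        - α * ((∫ x, v j x * weakPartial j (weakLaplacian v i) x * v i x : ℝ) : ℂ)
        + α * ((∫ x, v j x * weakPartial i (weakLaplacian v j) x * v i x : ℝ) : ℂ)) := by
  simp only [nlFT, Finset.sum_mul, add_mul, sub_mul, mul_assoc (α : ℂ)]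
  have hi := fun g h : L2 => integrable_prodFT_mul_conj g h hI
  have hF : ∀ j ∈ Finset.univ, Integrable (fun ξ =>
      prodFT (v j) (weakPartial j (v i)) ξ * starRingEnd ℂ (FT (v i) ξ)
      - (α : ℂ) * (prodFT (v j) (weakPartial j (weakLaplacian v i)) ξ
        * starRingEnd ℂ (FT (v i) ξ))
      + (α : ℂ) * (prodFT (v j) (weakPartial i (weakLaplacian v j)) ξ
        * starRingEnd ℂ (FT (v i) ξ))) := fun j _ =>
    ((hi _ _).sub ((hi _ _).const_mul _)).add ((hi _ _).const_mul _)
  rw [integral_finsetSum _ hF]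
  refine Finset.sum_congr rfl fun j _ => ?_
  rw [integral_sub_add_const_mul _ (hi _ _) (hi _ _) (hi _ _), integral_prodFT_mul_conj _ _ hI,
    integral_prodFT_mul_conj _ _ hI, integral_prodFT_mul_conj _ _ hI]

/-- The nonlinear term does no work: `∫ N · v = 0`. -/
theorem MemV2.integral_sum_nlFT_mul_conj {α : ℝ} {v : VF} (h : MemV2 α v)
    (hI : ∀ i, Integrable (FT (v i))) :
    ∫ ξ, ∑ i, nlFT α v i ξ * starRingEnd ℂ (FT (v i) ξ) = 0 := by
  have hint : ∀ i, Integrable (fun ξ => nlFT α v i ξ * starRingEnd ℂ (FT (v i) ξ)) := by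
    intro i
    simp only [nlFT, Finset.sum_mul, add_mul, sub_mul, mul_assoc (α : ℂ)]
    have hi := fun g h : L2 => integrable_prodFT_mul_conj g h (hI i)
    exact integrable_finsetSum _ fun j _ => ((hi _ _).sub ((hi _ _).const_mul _)).add
      ((hi _ _).const_mul _)
  rw [integral_finsetSum _ fun i _ => hint i,
    Finset.sum_congr rfl fun i _ => integral_nlFT_mul_conj α i (hI i)]
  -- The convective term is `½ ∫ v · ∇(vᵢ²)`, which vanishes by `div v = 0`; this is carried out in
  -- Fourier variables, where `vᵢ∂ⱼvᵢ` has transform `½ dⱼ (vᵢ²)^`.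
  have hconv : ∀ i, ∑ j, ((∫ x, v i x * weakPartial j (v i) x * v j x : ℝ) : ℂ) = 0 := by
    intro i
    rw [Finset.sum_congr rfl fun j _ => (integral_prodFT_mul_conj (v i) _ (hI j)).symm,
      ← integral_finsetSum _ fun j _ => integrable_prodFT_mul_conj _ _ (hI j)]
    have e1 : ∀ᵐ ξ, ∀ j, prodFT (weakPartial j (v i)) (v i) ξ + prodFT (v i) (weakPartial j (v i)) ξ
        = dsym j ξ * prodFT (v i) (v i) ξ := by
      simp only [ae_all_iff]
      exact fun j => prodFT_deriv (h.hasWP i j) (h.hasWP i j)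
    rw [integral_congr_ae (g := fun _ => (0 : ℂ)), integral_zero]
    filter_upwards [e1, isDivFree_FT h.1.2] with ξ e1 h2
    have h3 : ∑ i, dsym i ξ * starRingEnd ℂ (FT (v i) ξ) = 0 := by
      have := congrArg (starRingEnd ℂ) h2
      simp only [map_sum, map_mul, conj_dsym, map_zero, neg_mul, Finset.sum_neg_distrib,
        neg_eq_zero] at this
      exact this
    have e2 : ∀ j, prodFT (v i) (weakPartial j (v i)) ξ * starRingEnd ℂ (FT (v j) ξ)
        = prodFT (v i) (v i) ξ / 2 * (dsym j ξ * starRingEnd ℂ (FT (v j) ξ)) := by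
      intro j
      have := e1 j
      rw [prodFT_comm (weakPartial j (v i))] at this
      linear_combination starRingEnd ℂ (FT (v j) ξ) / 2 * this
    rw [Finset.sum_congr rfl fun j _ => e2 j, ← Finset.mul_sum, h3, mul_zero]
  simp only [Finset.sum_add_distrib, Finset.sum_sub_distrib, ← Finset.mul_sum]
  have s1 : ∑ i, ∑ j, ((∫ x, v j x * weakPartial j (v i) x * v i x : ℝ) : ℂ) = 0 := by
    rw [← Finset.sum_const_zero (s := (Finset.univ : Finset (Fin 3)))]
    refine Finset.sum_congr rfl fun i _ => ?_
    rw [← hconv i]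
    refine Finset.sum_congr rfl fun j _ => ?_
    congr 2
    ext x
    ring
  -- The two third-order terms cancel after exchanging `i` and `j`.
  have s2 : ∑ i, ∑ j, ((∫ x, v j x * weakPartial i (weakLaplacian v j) x * v i x : ℝ) : ℂ)
      = ∑ i, ∑ j, ((∫ x, v j x * weakPartial j (weakLaplacian v i) x * v i x : ℝ) : ℂ) := by
    rw [Finset.sum_comm]
    refine Finset.sum_congr rfl fun i _ => Finset.sum_congr rfl fun j _ => ?_
    congr 2
    ext x
    ring
  rw [s1, s2]
  ring

/-- The density, in frequency, of the work done by the linear terms of the equation. -/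
def flux (α μ : ℝ) (v w : VF) (ξ : E3) : ℝ :=
  ∑ i, (((wt α ξ : ℂ) * FT (w i) ξ + ((μ * (2 * Real.pi * ‖ξ‖) ^ 2 : ℝ) : ℂ) * FT (v i) ξ)
    * starRingEnd ℂ (FT (v i) ξ)).re

/-- By the equation, `flux` is minus the real part of the nonlinear term times `conj v̂`. The
pointwise bound serves low frequencies; the zero integral and the `V₂` bound serve the energy
inequality. -/
theorem exists_flux_bound {α : ℝ} (hα : 0 < α) : ∃ C : ℝ, 0 < C ∧ ∀ μ v w, MemV2 α v → MemV w →
    WeakEquation α μ v w →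
    (∀ᵐ ξ, |flux α μ v w ξ| ≤ C * (‖ξ‖ * (1 + ‖ξ‖)) * h1AlphaNormSq α v * √(sqFT v ξ)) ∧
    Integrable (flux α μ v w) ∧ ∫ ξ, flux α μ v w ξ = 0 ∧
    ∫ ξ, |flux α μ v w ξ| ≤ C * v2Norm α v ^ 3 := by
  obtain ⟨C₀, hC₀, hFT⟩ := exists_integral_norm_FT_le hα
  have hi : 0 < α⁻¹ := inv_pos.2 hα
  have hpi := Real.pi_pos
  set C₁ := 18 * Real.pi * (7 + 6 * Real.pi * (1 + α))
  set C₂ := 9 * (3 + α⁻¹) * C₀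
  have hC₁ : 0 < C₁ := by positivity
  have hC₂ : 0 ≤ C₂ := by positivity
  refine ⟨C₁ + C₂, by positivity, fun μ v w hv hw heq => ?_⟩
  have hN := v2Norm_nonneg α v
  have hflux : ∀ᵐ ξ, flux α μ v w ξ
      = -(∑ i, nlFT α v i ξ * starRingEnd ℂ (FT (v i) ξ)).re := by
    filter_upwards [heq.fourier hv hw] with ξ hξ
    have h1 := congrArg Complex.re hξ
    simp only [add_mul _ (nlFT α v _ ξ), Finset.sum_add_distrib, Complex.add_re,
      Complex.zero_re] at h1
    rw [flux, ← Complex.re_sum]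
    linarith
  have hint : ∀ i, Integrable (fun ξ => nlFT α v i ξ * starRingEnd ℂ (FT (v i) ξ)) := fun i =>
    (Complex.conjCLE.toContinuousLinearMap.integrable_comp (hFT v hv i).1).bdd_mul
      (continuous_nlFT α v i).aestronglyMeasurable (ae_of_all _ (hv.norm_nlFT_le hα i))
  have hsum : Integrable (fun ξ => ∑ i, nlFT α v i ξ * starRingEnd ℂ (FT (v i) ξ)) :=
    integrable_finsetSum _ fun i _ => hint i
  have hre : Integrable (fun ξ => -(∑ i, nlFT α v i ξ * starRingEnd ℂ (FT (v i) ξ)).re) :=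
    (Complex.reCLM.integrable_comp hsum).neg
  refine ⟨?_, hre.congr (hflux.mono fun _ h => h.symm), ?_, ?_⟩
  · filter_upwards [hflux, hv.norm_sum_nlFT_mul_conj_le hα] with ξ h1 h2
    rw [h1, abs_neg]
    refine (Complex.abs_re_le_norm _).trans (h2.trans ?_)
    have := h1AlphaNormSq_nonneg hα v
    gcongr
    exact le_add_of_nonneg_right hC₂
  · rw [integral_congr_ae hflux, integral_neg]
    have := Complex.reCLM.integral_comp_comm hsum
    simp only [Complex.reCLM_apply] at this
    rw [this, hv.integral_sum_nlFT_mul_conj fun i => (hFT v hv i).1]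
    simp
  · calc ∫ ξ, |flux α μ v w ξ|
        ≤ ∫ ξ, ∑ i, 3 * (3 + α⁻¹) * v2Norm α v ^ 2 * ‖FT (v i) ξ‖ := by
          refine integral_mono_ae ((hre.congr (hflux.mono fun _ h => h.symm)).abs)
            (integrable_finsetSum _ fun i _ => ((hFT v hv i).1.norm.const_mul _)) ?_
          filter_upwards [hflux] with ξ h1
          rw [h1, abs_neg]
          refine (Complex.abs_re_le_norm _).trans ((norm_sum_le _ _).trans
            (Finset.sum_le_sum fun i _ => ?_))
          rw [norm_mul, RCLike.norm_conj]
          gcongr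
          exact hv.norm_nlFT_le hα i ξ
      _ = ∑ i, 3 * (3 + α⁻¹) * v2Norm α v ^ 2 * ∫ ξ, ‖FT (v i) ξ‖ := by
          rw [integral_finsetSum _ fun i _ => ((hFT v hv i).1.norm.const_mul _)]
          simp only [integral_const_mul]
      _ ≤ ∑ i : Fin 3, 3 * (3 + α⁻¹) * v2Norm α v ^ 2 * (C₀ * v2Norm α v) := by
          gcongr with i
          exact (hFT v hv i).2
      _ = C₂ * v2Norm α v ^ 3 := by
          simp only [Finset.sum_const, Finset.card_univ, Fintype.card_fin, nsmul_eq_mul, C₂]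
          push_cast
          ring
      _ ≤ _ := by
          gcongr
          exact le_add_of_nonneg_left hC₁.le

/-! ### Lipschitz functions of time -/

theorem integral_eq_sub_of_lipschitz {y y' : ℝ → ℝ} {K : NNReal} {a b : ℝ} (hab : a ≤ b)
    (hy : LipschitzOnWith K y (Set.Icc a b))
    (hd : ∀ᵐ t ∂(volume.restrict (Set.Ioo a b)), HasDerivAt y (y' t) t) :
    IntervalIntegrable y' volume a b ∧ ∫ t in a..b, y' t = y b - y a := by
  rw [← Set.uIcc_of_le hab] at hy
  have hac := hy.absolutelyContinuousOnInterval
  have he : deriv y =ᵐ[volume.restrict (Set.uIoc a b)] y' := by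
    rw [Set.uIoc_of_le hab, ← restrict_Ioo_eq_restrict_Ioc]
    exact hd.mono fun t ht => ht.deriv
  refine ⟨hac.intervalIntegrable_deriv.congr_ae he, ?_⟩
  rw [← hac.integral_deriv_eq_sub]
  refine intervalIntegral.integral_congr_ae_restrict he.symm

theorem abs_sqrt_sub_sqrt_le {δ a b : ℝ} (hδ : 0 < δ) (ha : δ ≤ a) (hb : δ ≤ b) :
    |√a - √b| ≤ (√δ)⁻¹ * |a - b| := by
  have h0 := Real.sqrt_pos.2 hδ
  have h1 := Real.sqrt_le_sqrt ha
  have h2 := Real.sqrt_le_sqrt hb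
  have e : a - b = (√a - √b) * (√a + √b) := by
    have := Real.mul_self_sqrt (hδ.le.trans ha)
    have := Real.mul_self_sqrt (hδ.le.trans hb)
    linarith
  rw [e, abs_mul, inv_mul_eq_div, le_div_iff₀ h0]
  gcongr
  exact (by linarith : √δ ≤ √a + √b).trans (le_abs_self _)

section Sqrt

variable {y f : ℝ → ℝ} {K : NNReal} {a b : ℝ}

/-- The shift by `δ` keeps the square root Lipschitz where `y` vanishes; it is sent to zero in the
two comparison lemmas. -/
theorem sqrt_add_ftc (hab : a ≤ b) (hy : LipschitzOnWith K y (Set.Icc a b))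
    (h0 : ∀ t ∈ Set.Icc a b, 0 ≤ y t) {y' : ℝ → ℝ}
    (hd : ∀ᵐ t ∂(volume.restrict (Set.Ioo a b)), HasDerivAt y (y' t) t) {δ : ℝ} (hδ : 0 < δ) :
    IntervalIntegrable (fun t => y' t / (2 * √(y t + δ))) volume a b ∧
      ∫ t in a..b, y' t / (2 * √(y t + δ)) = √(y b + δ) - √(y a + δ) := by
  refine integral_eq_sub_of_lipschitz (y := fun t => √(y t + δ))
    (K := Real.toNNReal (√δ)⁻¹ * K) hab ?_ ?_
  · refine LipschitzOnWith.of_dist_le_mul fun s hs t ht => ?_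
    have h1 := hy.dist_le_mul s hs t ht
    rw [Real.dist_eq] at h1 ⊢
    refine (abs_sqrt_sub_sqrt_le hδ (by linarith [h0 s hs]) (by linarith [h0 t ht])).trans ?_
    rw [add_sub_add_right_eq_sub, NNReal.coe_mul, Real.coe_toNNReal _ (by positivity), mul_assoc]
    gcongr
  · filter_upwards [hd, ae_restrict_mem measurableSet_Ioo] with t ht hm
    have := h0 t (Set.Ioo_subset_Icc_self hm)
    exact (ht.add_const δ).sqrt (by positivity)

theorem sqrt_add_le {x δ : ℝ} (hx : 0 ≤ x) (hδ : 0 ≤ δ) : √(x + δ ^ 2) ≤ √x + δ := by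
  rw [Real.sqrt_le_left (by positivity)]
  nlinarith [Real.sq_sqrt hx, mul_nonneg (Real.sqrt_nonneg x) hδ]

theorem sqrt_le_sqrt_add_integral (hab : a ≤ b) (hy : LipschitzOnWith K y (Set.Icc a b))
    (h0 : ∀ t ∈ Set.Icc a b, 0 ≤ y t) {y' : ℝ → ℝ}
    (hd : ∀ᵐ t ∂(volume.restrict (Set.Ioo a b)), HasDerivAt y (y' t) t)
    (hf : IntervalIntegrable f volume a b) (hf0 : ∀ t ∈ Set.Icc a b, 0 ≤ f t)
    (hle : ∀ᵐ t ∂(volume.restrict (Set.Ioo a b)), y' t ≤ 2 * f t * √(y t)) :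
    √(y b) ≤ √(y a) + ∫ t in a..b, f t := by
  refine le_of_forall_pos_le_add fun δ hδ => ?_
  obtain ⟨hi, he⟩ := sqrt_add_ftc hab hy h0 hd (sq_pos_of_pos hδ)
  have hm : ∫ t in a..b, y' t / (2 * √(y t + δ ^ 2)) ≤ ∫ t in a..b, f t := by
    refine intervalIntegral.integral_mono_ae_restrict hab hi hf ?_
    rw [← restrict_Ioo_eq_restrict_Icc]
    filter_upwards [hle, ae_restrict_mem measurableSet_Ioo] with t ht hm
    have hm' := Set.Ioo_subset_Icc_self hm
    have h1 := h0 t hm'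
    have h2 := hf0 t hm'
    rw [div_le_iff₀ (by positivity)]
    have h3 : √(y t) ≤ √(y t + δ ^ 2) := Real.sqrt_le_sqrt (by nlinarith)
    nlinarith [mul_le_mul_of_nonneg_left h3 h2]
  have h1 := sqrt_add_le (h0 a (Set.left_mem_Icc.2 hab)) hδ.le
  have h2 : √(y b) ≤ √(y b + δ ^ 2) := Real.sqrt_le_sqrt (by nlinarith)
  linarith

theorem sqrt_sub_integral_le_sqrt (hab : a ≤ b) (hy : LipschitzOnWith K y (Set.Icc a b))
    (h0 : ∀ t ∈ Set.Icc a b, 0 ≤ y t) {y' : ℝ → ℝ}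
    (hd : ∀ᵐ t ∂(volume.restrict (Set.Ioo a b)), HasDerivAt y (y' t) t)
    (hf : IntervalIntegrable f volume a b) (hf0 : ∀ t ∈ Set.Icc a b, 0 ≤ f t)
    (hle : ∀ᵐ t ∂(volume.restrict (Set.Ioo a b)), -(2 * f t * √(y t)) ≤ y' t) :
    √(y a) - ∫ t in a..b, f t ≤ √(y b) := by
  refine le_of_forall_pos_le_add fun δ hδ => ?_
  obtain ⟨hi, he⟩ := sqrt_add_ftc hab hy h0 hd (sq_pos_of_pos hδ)
  have hm : ∫ t in a..b, -f t ≤ ∫ t in a..b, y' t / (2 * √(y t + δ ^ 2)) := by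
    refine intervalIntegral.integral_mono_ae_restrict hab hf.neg hi ?_
    rw [← restrict_Ioo_eq_restrict_Icc]
    filter_upwards [hle, ae_restrict_mem measurableSet_Ioo] with t ht hm
    have hm' := Set.Ioo_subset_Icc_self hm
    have h1 := h0 t hm'
    have h2 := hf0 t hm'
    rw [le_div_iff₀ (by positivity)]
    have h3 : √(y t) ≤ √(y t + δ ^ 2) := Real.sqrt_le_sqrt (by nlinarith)
    nlinarith [mul_le_mul_of_nonneg_left h3 h2]
  rw [intervalIntegral.integral_neg] at hm
  have h1 := sqrt_add_le (h0 b (Set.right_mem_Icc.2 hab)) hδ.le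
  have h2 : √(y a) ≤ √(y a + δ ^ 2) := Real.sqrt_le_sqrt (by nlinarith)
  linarith

end Sqrt

/-! ### Vector-valued primitives in time -/

theorem intervalIntegrable_of_ae_bound {X : Type*} [NormedAddCommGroup X] {u' : ℝ → X} {T M : ℝ}
    (hm : AEStronglyMeasurable u' (volume.restrict (Set.Ioo 0 T)))
    (hT : 0 ≤ T) (hb : ∀ᵐ t ∂(volume.restrict (Set.Ioo 0 T)), ‖u' t‖ ≤ M) :
    IntervalIntegrable u' volume 0 T := by
  rw [intervalIntegrable_iff_integrableOn_Ioo_of_le hT]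
  exact Integrable.of_bound hm M hb

section Primitive

variable {X : Type*} [NormedAddCommGroup X] [NormedSpace ℝ X]
  {u u' : ℝ → X} {x₀ : X} {T M : ℝ}

theorem lipschitzOnWith_primitive (hu : ∀ t ≥ 0, u t = x₀ + ∫ s in (0 : ℝ)..t, u' s) (hT : 0 ≤ T)
    (hi : IntervalIntegrable u' volume 0 T)
    (hb : ∀ᵐ t ∂(volume.restrict (Set.Ioo 0 T)), ‖u' t‖ ≤ M) :
    LipschitzOnWith (Real.toNNReal M) u (Set.Icc 0 T) := by
  refine LipschitzOnWith.of_dist_le_mul fun s hs t ht => ?_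
  have hsub : ∀ r ∈ Set.Icc 0 T, IntervalIntegrable u' volume 0 r := fun r hr =>
    hi.mono_set (by rw [Set.uIcc_of_le hr.1, Set.uIcc_of_le hT]; exact Set.Icc_subset_Icc_right hr.2)
  rw [dist_eq_norm, hu s hs.1, hu t ht.1, add_sub_add_left_eq_sub,
    intervalIntegral.integral_interval_sub_left (hsub s hs) (hsub t ht), Real.dist_eq]
  refine intervalIntegral.norm_integral_le_of_norm_le_const_ae ?_
  rw [restrict_Ioo_eq_restrict_Ioc, ae_restrict_iff' measurableSet_Ioc] at hb
  filter_upwards [hb] with τ hτ hm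
  refine (hτ ?_).trans (Real.le_coe_toNNReal M)
  rw [Set.uIoc, Set.mem_Ioc] at hm
  exact ⟨(le_min ht.1 hs.1).trans_lt hm.1, hm.2.trans (max_le ht.2 hs.2)⟩

theorem ae_hasDerivAt_primitive [CompleteSpace X]
    (hu : ∀ t ≥ 0, u t = x₀ + ∫ s in (0 : ℝ)..t, u' s) (hT : 0 ≤ T)
    (hi : IntervalIntegrable u' volume 0 T) :
    ∀ᵐ t ∂(volume.restrict (Set.Ioo 0 T)), HasDerivAt u (u' t) t := by
  rw [ae_restrict_iff' measurableSet_Ioo]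
  filter_upwards [hi.ae_hasDerivAt_integral] with t ht hm
  rw [Set.uIcc_of_le hT] at ht
  refine ((ht (Set.Ioo_subset_Icc_self hm) 0 (Set.left_mem_Icc.2 hT)).const_add x₀).congr_of_eventuallyEq ?_
  filter_upwards [lt_mem_nhds hm.1] with s hs
  exact hu s hs.le

theorem lipschitzOnWith_bilin (B : X →L[ℝ] X →L[ℝ] ℝ) {K : NNReal} {a b : ℝ}
    (h : LipschitzOnWith K u (Set.Icc a b)) :
    ∃ K' : NNReal, LipschitzOnWith K' (fun t => B (u t) (u t)) (Set.Icc a b) := by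
  obtain ⟨N, hN⟩ := isCompact_Icc.exists_bound_of_continuousOn h.continuousOn
  refine ⟨Real.toNNReal (‖B‖ * N * K + ‖B‖ * N * K),
    LipschitzOnWith.of_dist_le_mul fun s hs t ht => ?_⟩
  have hN0 : 0 ≤ N := (norm_nonneg _).trans (hN s hs)
  have h1 := h.dist_le_mul s hs t ht
  rw [dist_eq_norm] at h1
  have e : B (u s) (u s) - B (u t) (u t) = B (u s - u t) (u s) + B (u t) (u s - u t) := by
    simp only [map_sub, _root_.sub_apply]
    ring
  rw [Real.coe_toNNReal _ (by positivity), Real.dist_eq, e, ← Real.norm_eq_abs, add_mul]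
  refine (norm_add_le _ _).trans (add_le_add ?_ ?_)
  · refine (B.le_opNorm₂ _ _).trans ?_
    calc _ ≤ ‖B‖ * (K * dist s t) * N := by gcongr; exact hN s hs
      _ = _ := by ring
  · refine (B.le_opNorm₂ _ _).trans ?_
    calc _ ≤ ‖B‖ * N * (K * dist s t) := by gcongr; exact hN t ht
      _ = _ := by ring

end Primitive

/-! ### Weighted quadratic forms in frequency -/

/-- The form `(v, w) ↦ ∫ G Re (ŵ · conj v̂)`. -/
def weightForm (G : Lp ℝ ⊤ (volume : Measure E3)) : VF →L[ℝ] VF →L[ℝ] ℝ :=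
  ∑ i, ((innerSL ℝ).bilinearComp (FTL ∘L ContinuousLinearMap.proj i)
    ((ContinuousLinearMap.lsmul ℝ ℝ).holderL volume ⊤ 2 2 G ∘L FTL ∘L ContinuousLinearMap.proj i) :
      VF →L[ℝ] VF →L[ℝ] ℝ)

theorem weightForm_apply (G : Lp ℝ ⊤ (volume : Measure E3)) (v w : VF) :
    weightForm G v w = ∫ ξ, G ξ * ∑ i, (FT (w i) ξ * starRingEnd ℂ (FT (v i) ξ)).re := by
  have h : ∀ i, Integrable (fun ξ => G ξ * (FT (w i) ξ * starRingEnd ℂ (FT (v i) ξ)).re) ∧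
      inner ℝ (FT (v i)) ((ContinuousLinearMap.lsmul ℝ ℝ).holder 2 G (FT (w i)))
        = ∫ ξ, G ξ * (FT (w i) ξ * starRingEnd ℂ (FT (v i) ξ)).re := by
    intro i
    have e : (fun ξ => inner ℝ (FT (v i) ξ)
        ((ContinuousLinearMap.lsmul ℝ ℝ).holder 2 G (FT (w i)) ξ))
        =ᵐ[volume] fun ξ => G ξ * (FT (w i) ξ * starRingEnd ℂ (FT (v i) ξ)).re := by
      filter_upwards [(ContinuousLinearMap.lsmul ℝ ℝ).coeFn_holder (r := 2) G (FT (w i))] with ξ hξ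
      rw [hξ, ContinuousLinearMap.lsmul_apply, inner_smul_right, Complex.inner, mul_comm (FT (w i) ξ)]
    refine ⟨(L2.integrable_inner _ _).congr e, ?_⟩
    rw [L2.inner_def]
    exact integral_congr_ae e
  simp only [Finset.mul_sum]
  rw [integral_finsetSum _ fun i _ => (h i).1, weightForm, _root_.sum_apply,
    _root_.sum_apply]
  exact Finset.sum_congr rfl fun i _ => (h i).2

/-- `∑ᵢ Re (ŵᵢ(ξ) conj v̂ᵢ(ξ))`. -/
def crossFT (v w : VF) (ξ : E3) : ℝ := ∑ i, (FT (w i) ξ * starRingEnd ℂ (FT (v i) ξ)).re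

theorem crossFT_self (v : VF) (ξ : E3) : crossFT v v ξ = sqFT v ξ := by
  unfold crossFT sqFT
  refine Finset.sum_congr rfl fun i _ => ?_
  rw [Complex.mul_conj, Complex.ofReal_re, Complex.sq_norm]

theorem crossFT_comm (v w : VF) (ξ : E3) : crossFT v w ξ = crossFT w v ξ := by
  unfold crossFT
  refine Finset.sum_congr rfl fun i _ => ?_
  simp only [Complex.mul_re, Complex.conj_re, Complex.conj_im]
  ring

theorem integrable_crossFT (v w : VF) : Integrable (crossFT v w) := by
  refine integrable_finsetSum _ fun i _ => (L2.integrable_inner (𝕜 := ℝ) (FT (v i)) (FT (w i))).congr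
    (ae_of_all _ fun ξ => ?_)
  beta_reduce
  rw [Complex.inner, mul_comm]

theorem integrableOn_closedBall_mul {p f : E3 → ℝ} (hp : Continuous p) (hf : Integrable f) (R : ℝ) :
    IntegrableOn (fun ξ => p ξ * f ξ) (Metric.closedBall 0 R) :=
  hf.integrableOn.continuousOn_mul hp.continuousOn (isCompact_closedBall 0 R)

/-- Truncation turns the unbounded weights into bounded multipliers, so the associated forms are
continuous on `L²` and can be differentiated along the solution. -/
theorem memLp_top_indicator {p : E3 → ℝ} (hp : Continuous p) (R : ℝ) :
    MemLp ((Metric.closedBall (0 : E3) R).indicator p) ⊤ volume := by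
  obtain ⟨C, hC⟩ := (isCompact_closedBall (0 : E3) R).exists_bound_of_continuousOn hp.continuousOn
  refine memLp_top_of_bound (hp.aestronglyMeasurable.indicator measurableSet_closedBall) (max C 0)
    (ae_of_all _ fun ξ => ?_)
  by_cases h : ξ ∈ Metric.closedBall (0 : E3) R
  · rw [Set.indicator_of_mem h]
    exact (hC ξ h).trans (le_max_left _ _)
  · rw [Set.indicator_of_notMem h, norm_zero]
    exact le_max_right _ _

/-- The form `(v, w) ↦ ∫_{|ξ| ≤ R} p Re (ŵ · conj v̂)`. -/
def lowForm {p : E3 → ℝ} (hp : Continuous p) (R : ℝ) : VF →L[ℝ] VF →L[ℝ] ℝ :=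
  weightForm ((memLp_top_indicator hp R).toLp _)

theorem lowForm_apply {p : E3 → ℝ} (hp : Continuous p) (R : ℝ) (v w : VF) :
    lowForm hp R v w = ∫ ξ in Metric.closedBall 0 R, p ξ * crossFT v w ξ := by
  rw [lowForm, weightForm_apply, ← integral_indicator measurableSet_closedBall]
  refine integral_congr_ae ?_
  filter_upwards [(memLp_top_indicator hp R).coeFn_toLp] with ξ hξ
  rw [hξ]
  by_cases h : ξ ∈ Metric.closedBall (0 : E3) R
  · rw [Set.indicator_of_mem h, Set.indicator_of_mem h]
    rfl
  · rw [Set.indicator_of_notMem h, Set.indicator_of_notMem h, zero_mul]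

/-- The energy `∫_{|ξ| ≤ R} (1 + 4π²α|ξ|²) |v̂|²` of the low frequencies. -/
def lowEnergy (α R : ℝ) (v : VF) : ℝ := ∫ ξ in Metric.closedBall 0 R, wt α ξ * sqFT v ξ

/-- The dissipation `∫_{|ξ| ≤ R} 4π²|ξ|² |v̂|²` in the low frequencies. -/
def lowDiss (R : ℝ) (v : VF) : ℝ :=
  ∫ ξ in Metric.closedBall 0 R, (2 * Real.pi * ‖ξ‖) ^ 2 * sqFT v ξ

theorem continuous_symbol_sq : Continuous (fun ξ : E3 => (2 * Real.pi * ‖ξ‖) ^ 2) := by fun_prop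

theorem lowForm_wt (α R : ℝ) (v : VF) : lowForm (continuous_wt α) R v v = lowEnergy α R v := by
  rw [lowForm_apply, lowEnergy]
  simp only [crossFT_self]

theorem lowForm_symbol_sq (R : ℝ) (v : VF) : lowForm continuous_symbol_sq R v v = lowDiss R v := by
  rw [lowForm_apply, lowDiss]
  simp only [crossFT_self]

theorem flux_eq (α μ : ℝ) (v w : VF) (ξ : E3) :
    flux α μ v w ξ = wt α ξ * crossFT v w ξ + μ * ((2 * Real.pi * ‖ξ‖) ^ 2 * sqFT v ξ) := by
  rw [flux, ← crossFT_self, crossFT, crossFT, Finset.mul_sum, Finset.mul_sum, Finset.mul_sum,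
    ← Finset.sum_add_distrib]
  refine Finset.sum_congr rfl fun i _ => ?_
  rw [add_mul, Complex.add_re, mul_assoc, mul_assoc, Complex.re_ofReal_mul, Complex.re_ofReal_mul]
  ring

theorem two_mul_lowForm (α μ R : ℝ) (v w : VF) :
    lowForm (continuous_wt α) R v w + lowForm (continuous_wt α) R w v
      = 2 * (∫ ξ in Metric.closedBall 0 R, flux α μ v w ξ) - 2 * μ * lowDiss R v := by
  have h1 := integral_add (integrableOn_closedBall_mul (continuous_wt α) (integrable_crossFT v w) R)
    ((integrableOn_closedBall_mul continuous_symbol_sq (integrable_sqFT v) R).const_mul μ)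
  rw [integral_const_mul] at h1
  simp only [flux_eq]
  rw [h1, lowForm_apply, lowForm_apply, lowDiss]
  simp only [crossFT_comm w v]
  ring

/-! ### Time regularity and truncated energy balance of weak solutions -/

namespace IsWeakSolutionWith

variable {α μ : ℝ} {u₀ : VF} {u u' : ℝ → VF}

theorem apply_zero (h : IsWeakSolutionWith α μ u₀ u u') : u 0 = u₀ := by
  rw [h.time_deriv 0 le_rfl, intervalIntegral.integral_same, add_zero]

theorem exists_norm_deriv_le (hα : 0 < α) (h : IsWeakSolutionWith α μ u₀ u u') {T : ℝ}
    (hT : 0 < T) : ∃ M, ∀ᵐ t ∂(volume.restrict (Set.Ioo 0 T)), ‖u' t‖ ≤ M := by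
  obtain ⟨M, hM⟩ := h.bound_deriv T hT
  refine ⟨M, hM.mono fun t ht => ?_⟩
  refine ((pi_norm_le_iff_of_nonneg (Real.sqrt_nonneg _)).2 fun i => ?_).trans ht.2
  exact Real.le_sqrt_of_sq_le (norm_sq_le_h1AlphaNormSq hα (u' t) i)

theorem exists_lipschitzOnWith (hα : 0 < α) (h : IsWeakSolutionWith α μ u₀ u u') {T : ℝ}
    (hT : 0 < T) : ∃ K : NNReal, LipschitzOnWith K u (Set.Icc 0 T) := by
  obtain ⟨M, hM⟩ := h.exists_norm_deriv_le hα hT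
  exact ⟨_, lipschitzOnWith_primitive h.time_deriv hT.le
    (intervalIntegrable_of_ae_bound (h.meas_deriv T hT) hT.le hM) hM⟩

theorem ae_weakEquation (hα : 0 < α) (h : IsWeakSolutionWith α μ u₀ u u') {T : ℝ} (hT : 0 < T) :
    ∀ᵐ t ∂(volume.restrict (Set.Ioo 0 T)), MemV2 α (u t) ∧ MemV (u' t) ∧
      WeakEquation α μ (u t) (u' t) ∧ HasDerivAt u (u' t) t := by
  obtain ⟨M, hM⟩ := h.exists_norm_deriv_le hα hT
  obtain ⟨M₁, hM₁⟩ := h.bound T hT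
  obtain ⟨M₂, hM₂⟩ := h.bound_deriv T hT
  have h1 := ae_restrict_of_ae_restrict_of_subset
    (Set.Ioo_subset_Ioi_self : Set.Ioo 0 T ⊆ Set.Ioi 0) h.equation
  filter_upwards [hM₁, hM₂, h1, ae_hasDerivAt_primitive h.time_deriv hT.le
    (intervalIntegrable_of_ae_bound (h.meas_deriv T hT) hT.le hM)] with t a b c d
  exact ⟨a.1, b.1, c, d⟩

theorem ae_hasDerivAt_lowEnergy (hα : 0 < α) (h : IsWeakSolutionWith α μ u₀ u u') {T : ℝ}
    (hT : 0 < T) : ∀ᵐ t ∂(volume.restrict (Set.Ioo 0 T)), ∀ R,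
      HasDerivAt (fun t => lowEnergy α R (u t))
        (2 * (∫ ξ in Metric.closedBall 0 R, flux α μ (u t) (u' t) ξ) - 2 * μ * lowDiss R (u t)) t := by
  filter_upwards [h.ae_weakEquation hα hT] with t ht R
  have hd := ht.2.2.2
  have h2 := ((lowForm (continuous_wt α) R).hasFDerivAt.comp_hasDerivAt t hd).clm_apply hd
  simp only [Function.comp_apply, lowForm_wt] at h2
  rw [add_comm, two_mul_lowForm α μ] at h2
  exact h2

theorem exists_lipschitzOnWith_lowEnergy (hα : 0 < α) (h : IsWeakSolutionWith α μ u₀ u u') {T : ℝ}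
    (hT : 0 < T) (R : ℝ) :
    ∃ K : NNReal, LipschitzOnWith K (fun t => lowEnergy α R (u t)) (Set.Icc 0 T) := by
  obtain ⟨K, hK⟩ := h.exists_lipschitzOnWith hα hT
  simpa only [lowForm_wt] using lipschitzOnWith_bilin (lowForm (continuous_wt α) R) hK

theorem continuousOn_lowDiss (hα : 0 < α) (h : IsWeakSolutionWith α μ u₀ u u') {T : ℝ}
    (hT : 0 < T) (R : ℝ) : ContinuousOn (fun t => lowDiss R (u t)) (Set.Icc 0 T) := by
  obtain ⟨K, hK⟩ := h.exists_lipschitzOnWith hα hT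
  obtain ⟨K', hK'⟩ := lipschitzOnWith_bilin (lowForm continuous_symbol_sq R) hK
  simp only [lowForm_symbol_sq] at hK'
  exact hK'.continuousOn

/-- The energy inequality for the frequencies `|ξ| ≤ n`, up to a vanishing error. -/
theorem exists_energy_error (hα : 0 < α) (h : IsWeakSolutionWith α μ u₀ u u') {T : ℝ}
    (hT : 0 < T) : ∃ δ : ℕ → ℝ, Tendsto δ atTop (𝓝 0) ∧ ∀ n : ℕ, ∀ s t, 0 ≤ s → s ≤ t → t ≤ T →
      lowEnergy α n (u t) + 2 * μ * (∫ τ in s..t, lowDiss n (u τ))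
        ≤ lowEnergy α n (u s) + δ n := by
  obtain ⟨C, hC, hflux⟩ := exists_flux_bound hα
  obtain ⟨M, hM⟩ := h.bound T hT
  set err : ℕ → ℝ → ℝ := fun n t => 2 * ∫ ξ in Metric.closedBall 0 (n : ℝ), flux α μ (u t) (u' t) ξ
  have hftc : ∀ n : ℕ, ∀ s t, 0 ≤ s → s ≤ t → t ≤ T →
      IntervalIntegrable (fun τ => err n τ - 2 * μ * lowDiss n (u τ)) volume s t ∧
      ∫ τ in s..t, (err n τ - 2 * μ * lowDiss n (u τ))
        = lowEnergy α n (u t) - lowEnergy α n (u s) := by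
    intro n s t hs hst ht
    obtain ⟨K, hK⟩ := h.exists_lipschitzOnWith_lowEnergy hα hT n
    refine integral_eq_sub_of_lipschitz (y := fun t => lowEnergy α n (u t)) hst
      (hK.mono (Set.Icc_subset_Icc hs ht)) ?_
    exact ae_restrict_of_ae_restrict_of_subset (Set.Ioo_subset_Ioo hs ht)
      ((h.ae_hasDerivAt_lowEnergy hα hT).mono fun τ hτ => hτ n)
  have hD : ∀ n : ℕ, ∀ s t, 0 ≤ s → s ≤ t → t ≤ T →
      IntervalIntegrable (fun τ => 2 * μ * lowDiss n (u τ)) volume s t := by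
    intro n s t hs hst ht
    refine (ContinuousOn.intervalIntegrable ?_).const_mul _
    rw [Set.uIcc_of_le hst]
    exact (h.continuousOn_lowDiss hα hT n).mono (Set.Icc_subset_Icc hs ht)
  have herr : ∀ n : ℕ, ∀ s t, 0 ≤ s → s ≤ t → t ≤ T → IntervalIntegrable (err n) volume s t := by
    intro n s t hs hst ht
    simpa using (hftc n s t hs hst ht).1.add (hD n s t hs hst ht)
  -- Integrating the absolute value over all of `[0, T]` gives one error valid for every pair `s ≤
  -- t`.
  refine ⟨fun n => ∫ τ in (0 : ℝ)..T, |err n τ|, ?_, fun n s t hs hst ht => ?_⟩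
  · have hae : ∀ᵐ τ ∂(volume.restrict (Set.uIoc 0 T)), (∀ n, |err n τ| ≤ 2 * (C * M ^ 3)) ∧
        Tendsto (fun n => |err n τ|) atTop (𝓝 0) := by
      rw [Set.uIoc_of_le hT.le, ← restrict_Ioo_eq_restrict_Ioc]
      filter_upwards [hM, h.ae_weakEquation hα hT] with τ hb ht
      obtain ⟨-, hi, h0, hle⟩ := hflux μ (u τ) (u' τ) ht.1 ht.2.1 ht.2.2.1
      constructor
      · intro n
        have hv := v2Norm_nonneg α (u τ)
        rw [abs_mul, abs_two]
        gcongr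
        refine (norm_integral_le_integral_norm _).trans ((setIntegral_le_integral hi.norm
          (ae_of_all _ fun _ => norm_nonneg _)).trans (hle.trans ?_))
        gcongr
        exact hb.2
      -- The flux through the growing balls tends to its integral over the whole space, which is
      -- zero; the `V₂` bound dominates it in time.
      · have hcov : AECover (volume : Measure E3) atTop
            (fun n : ℕ => Metric.closedBall (0 : E3) (n : ℝ)) :=
          aecover_closedBall tendsto_natCast_atTop_atTop
        have hlim := (hcov.integral_tendsto_of_countably_generated hi).const_mul 2
        rw [h0, mul_zero] at hlim
        have hlim' := hlim.abs
        rwa [abs_zero] at hlim'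
    have hz : (∫ _ in (0 : ℝ)..T, (0 : ℝ)) = 0 := intervalIntegral.integral_zero
    suffices key : Tendsto (fun n => ∫ τ in (0 : ℝ)..T, |err n τ|) atTop
        (𝓝 (∫ _ in (0 : ℝ)..T, (0 : ℝ))) by rwa [hz] at key
    refine intervalIntegral.tendsto_integral_filter_of_dominated_convergence (μ := volume)
      (l := atTop) (a := 0) (b := T) (F := fun n τ => |err n τ|) (f := fun _ => 0)
      (fun _ => 2 * (C * M ^ 3)) ?_ ?_ ?_ ?_
    · refine Eventually.of_forall fun n => ?_
      have := (herr n 0 T le_rfl hT.le le_rfl).abs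
      rw [intervalIntegrable_iff] at this
      exact this.1
    · refine Eventually.of_forall fun n => ?_
      rw [← ae_restrict_iff' measurableSet_uIoc]
      filter_upwards [hae] with τ hτ
      rw [Real.norm_eq_abs, abs_abs]
      exact hτ.1 n
    · exact intervalIntegrable_const
    · rw [← ae_restrict_iff' measurableSet_uIoc]
      exact hae.mono fun τ hτ => hτ.2
  · have h1 := (hftc n s t hs hst ht).2
    have h3 : ∫ τ in s..t, 2 * μ * lowDiss n (u τ) = 2 * μ * ∫ τ in s..t, lowDiss n (u τ) :=
      intervalIntegral.integral_const_mul _ _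
    rw [intervalIntegral.integral_sub (herr n s t hs hst ht) (hD n s t hs hst ht), h3] at h1
    have h2 : ∫ τ in s..t, err n τ ≤ ∫ τ in (0 : ℝ)..T, |err n τ| := by
      refine (le_abs_self _).trans ((intervalIntegral.abs_integral_le_integral_abs hst).trans ?_)
      exact intervalIntegral.integral_mono_interval hs hst ht
        (ae_of_all _ fun _ => abs_nonneg _) (herr n 0 T le_rfl hT.le le_rfl).abs
    beta_reduce
    linarith

end IsWeakSolutionWith

/-! ### Estimates at low frequencies -/

/-- Cauchy–Schwarz against the constant `1`. The volume of the ball yields `ρ^(3/2)`, which with the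
factor `|ξ| ≤ ρ` of the flux makes up `ρ^(5/2)`. -/
theorem setIntegral_sqrt_le {ρ : ℝ} (hρ : 0 ≤ ρ) {f : E3 → ℝ} (hf : Integrable f)
    (h0 : ∀ ξ, 0 ≤ f ξ) :
    ∫ ξ in Metric.closedBall 0 ρ, √(f ξ)
      ≤ √((volume : Measure E3).real (Metric.closedBall 0 1)) * √(ρ ^ 3)
        * √(∫ ξ in Metric.closedBall 0 ρ, f ξ) := by
  have : IsFiniteMeasure (volume.restrict (Metric.closedBall (0 : E3) ρ)) :=
    ⟨by rw [Measure.restrict_apply_univ]; exact measure_closedBall_lt_top⟩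
  have hm : MemLp (fun ξ => √(f ξ)) (ENNReal.ofReal 2)
      (volume.restrict (Metric.closedBall (0 : E3) ρ)) := by
    have hs : AEStronglyMeasurable (fun ξ => √(f ξ)) volume :=
      Real.continuous_sqrt.comp_aestronglyMeasurable hf.1
    rw [ENNReal.ofReal_ofNat]
    refine MemLp.restrict _ ?_
    rw [memLp_two_iff_integrable_sq hs]
    exact hf.congr (ae_of_all _ fun ξ => (Real.sq_sqrt (h0 ξ)).symm)
  have key := integral_mul_le_Lp_mul_Lq_of_nonneg Real.HolderConjugate.two_two
    (ae_of_all _ fun ξ => zero_le_one) (ae_of_all _ fun ξ => Real.sqrt_nonneg (f ξ))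
    (memLp_const (1 : ℝ)) hm
  simp only [one_mul, Real.rpow_two, one_pow, Real.sq_sqrt (h0 _), ← Real.sqrt_eq_rpow,
    integral_const, smul_eq_mul, mul_one] at key
  refine key.trans (le_of_eq ?_)
  rw [measureReal_restrict_apply_univ, Measure.addHaar_real_closedBall' _ _ hρ,
    finrank_euclideanSpace_fin, Real.sqrt_mul (by positivity), mul_comm (√(ρ ^ 3))]

theorem wt_mul_sqFT_nonneg {α : ℝ} (hα : 0 < α) (v : VF) (ξ : E3) : 0 ≤ wt α ξ * sqFT v ξ :=
  mul_nonneg (zero_le_one.trans (one_le_wt hα ξ)) (sqFT_nonneg v ξ)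

theorem integrableOn_wt_mul_sqFT (α R : ℝ) (v : VF) :
    IntegrableOn (fun ξ => wt α ξ * sqFT v ξ) (Metric.closedBall 0 R) :=
  integrableOn_closedBall_mul (continuous_wt α) (integrable_sqFT v) R

theorem lowEnergy_nonneg {α : ℝ} (hα : 0 < α) (R : ℝ) (v : VF) : 0 ≤ lowEnergy α R v :=
  integral_nonneg fun ξ => wt_mul_sqFT_nonneg hα v ξ

theorem lowEnergy_mono {α : ℝ} (hα : 0 < α) {R R' : ℝ} (h : R ≤ R') (v : VF) :
    lowEnergy α R v ≤ lowEnergy α R' v :=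
  setIntegral_mono_set (integrableOn_wt_mul_sqFT α R' v)
    (ae_of_all _ fun ξ => wt_mul_sqFT_nonneg hα v ξ)
    (Metric.closedBall_subset_closedBall h).eventuallyLE

theorem aecover_closedBall_nat :
    AECover (volume : Measure E3) atTop (fun n : ℕ => Metric.closedBall (0 : E3) (n : ℝ)) :=
  aecover_closedBall tendsto_natCast_atTop_atTop

section HasWP

variable {α : ℝ} {v : VF}

theorem lowEnergy_le (hα : 0 < α) (h : ∀ i j, HasWP j (v i) (weakPartial j (v i))) (R : ℝ) :
    lowEnergy α R v ≤ h1AlphaNormSq α v := by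
  rw [h1AlphaNormSq_eq h]
  exact setIntegral_le_integral (integrable_wt_mul_sqFT h)
    (ae_of_all _ fun ξ => wt_mul_sqFT_nonneg hα v ξ)

theorem tendsto_lowEnergy (h : ∀ i j, HasWP j (v i) (weakPartial j (v i))) :
    Tendsto (fun n : ℕ => lowEnergy α n v) atTop (𝓝 (h1AlphaNormSq α v)) := by
  rw [h1AlphaNormSq_eq h]
  exact aecover_closedBall_nat.integral_tendsto_of_countably_generated (integrable_wt_mul_sqFT h)

end HasWP

/-- A uniform bound on the truncated energies makes `|ξ|²|v̂|²` integrable by monotone convergence.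
-/
theorem hasWP_of_lowEnergy_le {α : ℝ} (hα : 0 < α) {v : VF} {M : ℝ}
    (h : ∀ n : ℕ, lowEnergy α n v ≤ M) (i j : Fin 3) : HasWP j (v i) (weakPartial j (v i)) := by
  have hI : Integrable (fun ξ => wt α ξ * sqFT v ξ) :=
    aecover_closedBall_nat.integrable_of_integral_bounded_of_nonneg_ae M
      (fun n => integrableOn_wt_mul_sqFT α n v) (ae_of_all _ fun ξ => wt_mul_sqFT_nonneg hα v ξ)
      (Eventually.of_forall h)
  have hs : AEStronglyMeasurable (fun ξ => dsym j ξ * FT (v i) ξ) volume :=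
    (continuous_dsym j).aestronglyMeasurable.mul (memLp_FT _).1
  have hm : MemLp (fun ξ => dsym j ξ * FT (v i) ξ) 2 volume := by
    rw [← memLp_norm_iff hs, memLp_two_iff_integrable_sq hs.norm]
    refine (hI.const_mul α⁻¹).mono' (hs.norm.pow 2) (ae_of_all _ fun ξ => ?_)
    rw [Real.norm_of_nonneg (by positivity), norm_mul, mul_pow]
    have h1 : ‖FT (v i) ξ‖ ^ 2 ≤ sqFT v ξ :=
      Finset.single_le_sum (f := fun i => ‖FT (v i) ξ‖ ^ 2) (fun _ _ => sq_nonneg _)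
        (Finset.mem_univ i)
    have h2 : ‖dsym j ξ‖ ^ 2 ≤ α⁻¹ * wt α ξ := by
      have := norm_dsym_le j ξ
      calc ‖dsym j ξ‖ ^ 2 ≤ (2 * Real.pi * ‖ξ‖) ^ 2 := by gcongr
        _ ≤ α⁻¹ * wt α ξ := by
          rw [wt, mul_add, inv_mul_cancel_left₀ hα.ne', mul_one]
          exact le_add_of_nonneg_left (inv_pos.2 hα).le
    calc _ ≤ α⁻¹ * wt α ξ * sqFT v ξ :=
          mul_le_mul h2 h1 (sq_nonneg _) ((sq_nonneg _).trans h2)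
      _ = _ := by ring
  obtain ⟨g, hg⟩ := exists_hasWP hm
  exact hg.hasWP_weakPartial

theorem lowDiss_nonneg (R : ℝ) (v : VF) : 0 ≤ lowDiss R v :=
  integral_nonneg fun ξ => mul_nonneg (sq_nonneg _) (sqFT_nonneg v ξ)

theorem lowDiss_le {α : ℝ} (hα : 0 < α) (ρ : ℝ) (v : VF) :
    lowDiss ρ v ≤ (2 * Real.pi * ρ) ^ 2 * lowEnergy α ρ v := by
  rw [lowEnergy, ← integral_const_mul]
  refine setIntegral_mono_on
    (integrableOn_closedBall_mul continuous_symbol_sq (integrable_sqFT v) ρ)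
    ((integrableOn_wt_mul_sqFT α ρ v).const_mul _) measurableSet_closedBall fun ξ hξ => ?_
  rw [mem_closedBall_zero_iff] at hξ
  have h1 : sqFT v ξ ≤ wt α ξ * sqFT v ξ :=
    le_mul_of_one_le_left (sqFT_nonneg v ξ) (one_le_wt hα ξ)
  have := Real.pi_pos
  exact mul_le_mul (by gcongr) h1 (sqFT_nonneg v ξ) (sq_nonneg _)

/-- With `s = 2π|ξ| ≥ ρ` and `ρ ≤ 1`, one has `ρ²(1 + αs²) ≤ (1 + α)s²`: the high-frequency energy,
with its `α`-part, is controlled by the dissipation. -/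
theorem sub_lowEnergy_le_lowDiss {α : ℝ} (hα : 0 < α) {ρ R : ℝ} (hρ : 0 < ρ) (hρ1 : ρ ≤ 1)
    (hR : ρ ≤ R) (v : VF) :
    (1 + α)⁻¹ * ρ ^ 2 * (lowEnergy α R v - lowEnergy α ρ v) ≤ lowDiss R v := by
  have hsub : Metric.closedBall (0 : E3) ρ ⊆ Metric.closedBall 0 R :=
    Metric.closedBall_subset_closedBall hR
  have hD := integrableOn_closedBall_mul continuous_symbol_sq (integrable_sqFT v) R
  rw [lowEnergy, lowEnergy, ← setIntegral_sdiff measurableSet_closedBall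
    (integrableOn_wt_mul_sqFT α R v) hsub, ← integral_const_mul]
  refine (setIntegral_mono_on
    (((integrableOn_wt_mul_sqFT α R v).mono_set Set.sdiff_subset).const_mul _)
    (hD.mono_set Set.sdiff_subset) (measurableSet_closedBall.diff measurableSet_closedBall)
    fun ξ hξ => ?_).trans (setIntegral_mono_set hD
      (ae_of_all _ fun ξ => mul_nonneg (sq_nonneg _) (sqFT_nonneg v ξ))
      Set.sdiff_subset.eventuallyLE)
  have h1 : ρ ≤ ‖ξ‖ := by
    have := hξ.2
    rw [mem_closedBall_zero_iff, not_le] at this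
    exact this.le
  have h2 : ρ ≤ 2 * Real.pi * ‖ξ‖ :=
    h1.trans (le_mul_of_one_le_left (norm_nonneg _) (by linarith [Real.pi_gt_three]))
  rw [← mul_assoc]
  refine mul_le_mul_of_nonneg_right ?_ (sqFT_nonneg v ξ)
  rw [mul_assoc, inv_mul_le_iff₀ (by positivity), wt]
  have h3 : ρ ^ 2 ≤ (2 * Real.pi * ‖ξ‖) ^ 2 := by gcongr
  have h4 : ρ ^ 2 ≤ 1 := pow_le_one₀ hρ.le hρ1
  nlinarith [mul_nonneg hα.le (mul_nonneg (sub_nonneg.2 h4) (sq_nonneg (2 * Real.pi * ‖ξ‖)))]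

theorem mul_sqrt_pow_three {ρ : ℝ} (hρ : 0 < ρ) : ρ * √(ρ ^ 3) = ρ ^ (5 / 2 : ℝ) := by
  rw [Real.sqrt_eq_rpow, ← Real.rpow_natCast, ← Real.rpow_mul hρ.le]
  nth_rewrite 1 [← Real.rpow_one ρ]
  rw [← Real.rpow_add hρ]
  norm_num

/-- The flux through low frequencies is controlled by the energy alone. -/
theorem exists_low_flux_bound {α : ℝ} (hα : 0 < α) : ∃ C : ℝ, 0 < C ∧ ∀ μ v w, MemV2 α v →
    MemV w → WeakEquation α μ v w → ∀ ρ, 0 < ρ → ρ ≤ 1 →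
    |∫ ξ in Metric.closedBall 0 ρ, flux α μ v w ξ|
      ≤ C * ρ ^ (5 / 2 : ℝ) * h1AlphaNormSq α v * √(lowEnergy α ρ v) := by
  obtain ⟨C, hC, hflux⟩ := exists_flux_bound hα
  set V := √((volume : Measure E3).real (Metric.closedBall 0 1))
  refine ⟨2 * C * (V + 1), by positivity, fun μ v w hv hw heq ρ hρ hρ1 => ?_⟩
  obtain ⟨hle, hi, -, -⟩ := hflux μ v w hv hw heq
  have hE := h1AlphaNormSq_nonneg hα v
  have hsq : IntegrableOn (fun ξ => √(sqFT v ξ)) (Metric.closedBall (0 : E3) ρ) := by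
    have : IsFiniteMeasure (volume.restrict (Metric.closedBall (0 : E3) ρ)) :=
      ⟨by rw [Measure.restrict_apply_univ]; exact measure_closedBall_lt_top⟩
    exact ((memLp_sqrt_sqFT v).restrict _).integrable one_le_two
  calc |∫ ξ in Metric.closedBall 0 ρ, flux α μ v w ξ|
      ≤ ∫ ξ in Metric.closedBall 0 ρ, |flux α μ v w ξ| := abs_integral_le_integral_abs
    _ ≤ ∫ ξ in Metric.closedBall 0 ρ, C * (ρ * 2) * h1AlphaNormSq α v * √(sqFT v ξ) := by
        refine setIntegral_mono_on_ae hi.abs.integrableOn (hsq.const_mul _)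
          measurableSet_closedBall ?_
        filter_upwards [hle] with ξ h1 hξ
        rw [mem_closedBall_zero_iff] at hξ
        refine h1.trans ?_
        gcongr
        linarith
    _ = C * (ρ * 2) * h1AlphaNormSq α v * ∫ ξ in Metric.closedBall 0 ρ, √(sqFT v ξ) :=
        integral_const_mul _ _
    _ ≤ C * (ρ * 2) * h1AlphaNormSq α v * ((V + 1) * √(ρ ^ 3) * √(lowEnergy α ρ v)) := by
        gcongr
        refine (setIntegral_sqrt_le hρ.le (integrable_sqFT v) (sqFT_nonneg v)).trans ?_
        gcongr ?_ * _ * √?_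
        · exact le_add_of_nonneg_right zero_le_one
        · refine setIntegral_mono_on (integrable_sqFT v).integrableOn
            (integrableOn_wt_mul_sqFT α ρ v) measurableSet_closedBall fun ξ _ => ?_
          exact le_mul_of_one_le_left (sqFT_nonneg v ξ) (one_le_wt hα ξ)
    _ = _ := by
        rw [← mul_sqrt_pow_three hρ]
        ring

/-! ### A priori estimates for weak solutions -/

/-- The estimates for the energy `E(t)` of a solution and the energy `Y(ρ, t)` of its frequencies
below `ρ` from which the decay rates are derived. -/
structure EnergyEstimates (c C : ℝ) (E : ℝ → ℝ) (Y : ℝ → ℝ → ℝ) : Prop where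
  anti : AntitoneOn E (Set.Ici 0)
  low_nonneg : ∀ ρ t, 0 ≤ Y ρ t
  low_le : ∀ ρ t, 0 ≤ t → Y ρ t ≤ E t
  split : ∀ ρ, 0 < ρ → ρ ≤ 1 → ∀ T, 0 ≤ T → ∀ S, (∀ t ∈ Set.Icc T (2 * T), Y ρ t ≤ S) →
    E (2 * T) * (1 + c * ρ ^ 2 * T) ≤ E T + c * ρ ^ 2 * T * S
  upper : ∀ ρ, 0 < ρ → ρ ≤ 1 → ∀ t, 0 ≤ t →
    √(Y ρ t) ≤ √(Y ρ 0) + C * ρ ^ (5 / 2 : ℝ) * ∫ s in (0 : ℝ)..t, E s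
  lower : ∀ ρ, 0 < ρ → ρ ≤ 1 → ∀ t, 0 ≤ t →
    √(Y ρ 0) - C * ρ ^ 2 * t * (√(Y ρ 0) + C * ρ ^ (5 / 2 : ℝ) * ∫ s in (0 : ℝ)..t, E s)
      - C * ρ ^ (5 / 2 : ℝ) * (∫ s in (0 : ℝ)..t, E s) ≤ √(Y ρ t)

namespace IsWeakSolutionWith

variable {α μ : ℝ} {u₀ : VF} {u u' : ℝ → VF}

/-- The definition gives `H¹` regularity only for almost every time. The truncated inequality holds
at every `t`; fixing the smaller truncation `m` and letting `n → ∞` bounds it by the initial energy.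
-/
theorem hasWP (hα : 0 < α) (hμ : 0 < μ) (h : IsWeakSolutionWith α μ u₀ u u')
    (h0 : ∀ i j, HasWP j (u₀ i) (weakPartial j (u₀ i))) {t : ℝ} (ht : 0 ≤ t) (i j : Fin 3) :
    HasWP j (u t i) (weakPartial j (u t i)) := by
  rcases ht.eq_or_lt with rfl | htp
  · rw [h.apply_zero]
    exact h0 i j
  obtain ⟨δ, hδ, hle⟩ := h.exists_energy_error hα htp
  refine hasWP_of_lowEnergy_le (M := h1AlphaNormSq α u₀) hα (fun m => ?_) i j
  have hlim : Tendsto (fun n => h1AlphaNormSq α u₀ + δ n) atTop (𝓝 (h1AlphaNormSq α u₀)) := by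
    simpa using hδ.const_add (h1AlphaNormSq α u₀)
  refine ge_of_tendsto hlim ?_
  filter_upwards [eventually_ge_atTop m] with n hn
  have h1 := hle n 0 t le_rfl ht le_rfl
  rw [h.apply_zero] at h1
  have h2 := lowEnergy_le hα h0 n
  have h3 : 0 ≤ 2 * μ * ∫ τ in (0 : ℝ)..t, lowDiss n (u τ) :=
    mul_nonneg (by positivity) (intervalIntegral.integral_nonneg ht fun τ _ => lowDiss_nonneg _ _)
  have h4 := lowEnergy_mono hα (Nat.cast_le (α := ℝ).2 hn) (u t)
  linarith

theorem antitoneOn_energy (hα : 0 < α) (hμ : 0 < μ) (h : IsWeakSolutionWith α μ u₀ u u')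
    (h0 : ∀ i j, HasWP j (u₀ i) (weakPartial j (u₀ i))) :
    AntitoneOn (fun t => h1AlphaNormSq α (u t)) (Set.Ici 0) := by
  intro s hs t ht hst
  rw [Set.mem_Ici] at hs ht
  rcases ht.eq_or_lt with rfl | htp
  · rw [le_antisymm hst hs]
  obtain ⟨δ, hδ, hle⟩ := h.exists_energy_error hα htp
  have hlim := (tendsto_lowEnergy (α := α) (fun i j => h.hasWP hα hμ h0 hs i j)).add hδ
  rw [add_zero] at hlim
  refine le_of_tendsto_of_tendsto (tendsto_lowEnergy fun i j => h.hasWP hα hμ h0 ht i j) hlim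
    (Eventually.of_forall fun n => ?_)
  have h1 := hle n s t hs hst le_rfl
  have h3 : 0 ≤ 2 * μ * ∫ τ in s..t, lowDiss n (u τ) :=
    mul_nonneg (by positivity) (intervalIntegral.integral_nonneg hst fun τ _ => lowDiss_nonneg _ _)
  beta_reduce
  linarith

/-- Fourier splitting in integrated form, so that `E` need not be differentiated. On `[T, 2T]` the
dissipation dominates `ρ²` times the energy above `ρ`; there the total energy is at least its final
value, up to the vanishing error, and the low part is at most `S`. -/
theorem energy_split (hα : 0 < α) (hμ : 0 < μ) (h : IsWeakSolutionWith α μ u₀ u u')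
    (h0 : ∀ i j, HasWP j (u₀ i) (weakPartial j (u₀ i))) {ρ : ℝ} (hρ : 0 < ρ) (hρ1 : ρ ≤ 1)
    {T S : ℝ} (hT : 0 ≤ T) (hS : ∀ t ∈ Set.Icc T (2 * T), lowEnergy α ρ (u t) ≤ S) :
    h1AlphaNormSq α (u (2 * T)) * (1 + 2 * μ * (1 + α)⁻¹ * ρ ^ 2 * T)
      ≤ h1AlphaNormSq α (u T) + 2 * μ * (1 + α)⁻¹ * ρ ^ 2 * T * S := by
  rcases hT.eq_or_lt with rfl | hTp
  · simp
  have h2T : (0 : ℝ) < 2 * T := by positivity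
  have hTT : T ≤ 2 * T := by linarith
  obtain ⟨δ, hδ, hle⟩ := h.exists_energy_error hα h2T
  have l1 := tendsto_lowEnergy (α := α) (fun i j => h.hasWP hα hμ h0 hT i j)
  have l2 := tendsto_lowEnergy (α := α) (fun i j => h.hasWP hα hμ h0 h2T.le i j)
  set c := 2 * μ * (1 + α)⁻¹ * ρ ^ 2 * T with hc
  have hlim1 := l2.add (((l2.sub hδ).sub_const S).const_mul c)
  have hlim2 := l1.add hδ
  have key := le_of_tendsto_of_tendsto hlim1 hlim2 ?_
  · nlinarith
  filter_upwards [eventually_ge_atTop 1] with n hn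
  have hn1 : ρ ≤ (n : ℝ) := hρ1.trans (by exact_mod_cast hn)
  have h1 := hle n T (2 * T) hT hTT le_rfl
  have hint : IntervalIntegrable (fun τ => lowDiss n (u τ)) volume T (2 * T) := by
    refine ContinuousOn.intervalIntegrable ?_
    rw [Set.uIcc_of_le hTT]
    exact (h.continuousOn_lowDiss hα h2T n).mono (Set.Icc_subset_Icc_left hT)
  have h2 : ∫ _ in T..(2 * T), (1 + α)⁻¹ * ρ ^ 2 * (lowEnergy α n (u (2 * T)) - δ n - S)
      ≤ ∫ τ in T..(2 * T), lowDiss n (u τ) := by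
    refine intervalIntegral.integral_mono_on hTT intervalIntegrable_const hint fun τ hτ => ?_
    refine le_trans ?_ (sub_lowEnergy_le_lowDiss hα hρ hρ1 hn1 (u τ))
    have h3 := hle n τ (2 * T) (hT.trans hτ.1) hτ.2 le_rfl
    have h4 : 0 ≤ 2 * μ * ∫ σ in τ..(2 * T), lowDiss n (u σ) :=
      mul_nonneg (by positivity)
        (intervalIntegral.integral_nonneg hτ.2 fun σ _ => lowDiss_nonneg _ _)
    have h5 := hS τ hτ
    gcongr
    linarith
  rw [intervalIntegral.integral_const, smul_eq_mul] at h2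
  have h6 := mul_le_mul_of_nonneg_left h2 (by positivity : 0 ≤ 2 * μ)
  have h7 : 2 * μ * ((2 * T - T) * ((1 + α)⁻¹ * ρ ^ 2 * (lowEnergy α n (u (2 * T)) - δ n - S)))
      = c * (lowEnergy α n (u (2 * T)) - δ n - S) := by
    rw [hc]
    ring
  rw [h7] at h6
  linarith

theorem intervalIntegrable_energy (hα : 0 < α) (hμ : 0 < μ) (h : IsWeakSolutionWith α μ u₀ u u')
    (h0 : ∀ i j, HasWP j (u₀ i) (weakPartial j (u₀ i))) {t : ℝ} (ht : 0 ≤ t) :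
    IntervalIntegrable (fun t => h1AlphaNormSq α (u t)) volume 0 t := by
  refine AntitoneOn.intervalIntegrable ?_
  rw [Set.uIcc_of_le ht]
  exact (h.antitoneOn_energy hα hμ h0).mono Set.Icc_subset_Ici_self

end IsWeakSolutionWith

theorem exists_energyEstimates {α μ : ℝ} (hα : 0 < α) (hμ : 0 < μ) :
    ∃ c C : ℝ, 0 < c ∧ 0 < C ∧ ∀ u₀ u u', (∀ i j, HasWP j (u₀ i) (weakPartial j (u₀ i))) →
      IsWeakSolutionWith α μ u₀ u u' →
      EnergyEstimates c C (fun t => h1AlphaNormSq α (u t)) (fun ρ t => lowEnergy α ρ (u t)) := by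
  obtain ⟨C₁, hC₁, hflux⟩ := exists_low_flux_bound hα
  have hpi := Real.pi_pos
  set k := μ * (2 * Real.pi) ^ 2 with hk
  have hk0 : 0 < k := by positivity
  refine ⟨2 * μ * (1 + α)⁻¹, C₁ + k, by positivity, by positivity, fun u₀ u u' h0 h => ?_⟩
  have hE : ∀ t, 0 ≤ h1AlphaNormSq α (u t) := fun t => h1AlphaNormSq_nonneg hα _
  have hY : ∀ ρ t, 0 ≤ lowEnergy α ρ (u t) := fun ρ t => lowEnergy_nonneg hα _ _
  have hI : ∀ t, 0 ≤ t → 0 ≤ ∫ s in (0 : ℝ)..t, h1AlphaNormSq α (u s) := fun t ht =>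
    intervalIntegral.integral_nonneg ht fun s _ => hE s
  have hup : ∀ ρ, 0 < ρ → ρ ≤ 1 → ∀ t, 0 ≤ t → √(lowEnergy α ρ (u t))
      ≤ √(lowEnergy α ρ (u 0)) + C₁ * ρ ^ (5 / 2 : ℝ) * ∫ s in (0 : ℝ)..t, h1AlphaNormSq α (u s) := by
    intro ρ hρ hρ1 t ht
    rcases ht.eq_or_lt with rfl | htp
    · simp
    have hρ5 : 0 < ρ ^ (5 / 2 : ℝ) := Real.rpow_pos_of_pos hρ _
    obtain ⟨K, hK⟩ := h.exists_lipschitzOnWith_lowEnergy hα htp ρ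
    rw [← intervalIntegral.integral_const_mul]
    refine sqrt_le_sqrt_add_integral (y := fun t => lowEnergy α ρ (u t)) ht hK
      (fun s _ => hY ρ s) ((h.ae_hasDerivAt_lowEnergy hα htp).mono fun s hs => hs ρ)
      ((h.intervalIntegrable_energy hα hμ h0 ht).const_mul _)
      (fun s _ => mul_nonneg (by positivity) (hE s)) ?_
    filter_upwards [h.ae_weakEquation hα htp] with s hs
    have h1 := (le_abs_self _).trans (hflux μ _ _ hs.1 hs.2.1 hs.2.2.1 ρ hρ hρ1)
    have h2 := mul_nonneg (by positivity : 0 ≤ 2 * μ) (lowDiss_nonneg ρ (u s))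
    linarith
  refine ⟨h.antitoneOn_energy hα hμ h0, hY, fun ρ t ht => lowEnergy_le hα
    (fun i j => h.hasWP hα hμ h0 ht i j) ρ, fun ρ hρ hρ1 T hT S hS =>
      h.energy_split hα hμ h0 hρ hρ1 hT hS, fun ρ hρ hρ1 t ht => (hup ρ hρ hρ1 t ht).trans ?_,
      fun ρ hρ hρ1 t ht => ?_⟩
  · have := hI t ht
    have : 0 ≤ ρ ^ (5 / 2 : ℝ) := Real.rpow_nonneg hρ.le _
    gcongr
    linarith
  · rcases ht.eq_or_lt with rfl | htp
    · simp
    set b := C₁ * ρ ^ (5 / 2 : ℝ) with hb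
    set y0 := √(lowEnergy α ρ (u 0))
    set I := ∫ s in (0 : ℝ)..t, h1AlphaNormSq α (u s) with hIdef
    have hρ5 : 0 < ρ ^ (5 / 2 : ℝ) := Real.rpow_pos_of_pos hρ _
    have hI0 : 0 ≤ I := hI t ht
    have hy0 : 0 ≤ y0 := Real.sqrt_nonneg _
    have hb0 : 0 < b := by positivity
    obtain ⟨K, hK⟩ := h.exists_lipschitzOnWith_lowEnergy hα htp ρ
    have hint := (h.intervalIntegrable_energy hα hμ h0 ht).const_mul b
    -- The dissipation is at most a multiple of `ρ² Y = ρ² √Y √Y`. Bounding one factor by the upper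
    -- estimate `y0 + b * I` leaves the form `f √Y` that the comparison lemma accepts.
    have key := sqrt_sub_integral_le_sqrt (y := fun t => lowEnergy α ρ (u t))
      (f := fun s => b * h1AlphaNormSq α (u s) + k * ρ ^ 2 * (y0 + b * I)) ht hK
      (fun s _ => hY ρ s) ((h.ae_hasDerivAt_lowEnergy hα htp).mono fun s hs => hs ρ)
      (hint.add intervalIntegrable_const)
      (fun s _ => add_nonneg (mul_nonneg hb0.le (hE s)) (by positivity)) ?_
    · rw [intervalIntegral.integral_add hint intervalIntegrable_const,
        intervalIntegral.integral_const_mul, intervalIntegral.integral_const, smul_eq_mul,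
        sub_zero, ← hIdef] at key
      refine le_trans ?_ key
      have e1 : b * I ≤ (C₁ + k) * ρ ^ (5 / 2 : ℝ) * I := by
        rw [hb]
        gcongr
        linarith
      have e2 : t * (k * ρ ^ 2 * (y0 + b * I))
          ≤ (C₁ + k) * ρ ^ 2 * t * (y0 + (C₁ + k) * ρ ^ (5 / 2 : ℝ) * I) := by
        calc _ = k * ρ ^ 2 * t * (y0 + b * I) := by ring
          _ ≤ _ := by
            gcongr
            linarith
      linarith
    · filter_upwards [h.ae_weakEquation hα htp, ae_restrict_mem measurableSet_Ioo] with s hs hst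
      have h1 := (neg_abs_le _).trans' (neg_le_neg (hflux μ _ _ hs.1 hs.2.1 hs.2.2.1 ρ hρ hρ1))
      have h2 := lowDiss_le hα ρ (u s)
      have h3 := hup ρ hρ hρ1 s hst.1.le
      have h4 : ∫ σ in (0 : ℝ)..s, h1AlphaNormSq α (u σ) ≤ I :=
        intervalIntegral.integral_mono_interval le_rfl hst.1.le hst.2.le
          (ae_of_all _ fun σ => hE σ) (h.intervalIntegrable_energy hα hμ h0 ht)
      have h5 : √(lowEnergy α ρ (u s)) ≤ y0 + b * I :=
        h3.trans (add_le_add_right (mul_le_mul_of_nonneg_left h4 hb0.le) _)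
      have h6 : lowEnergy α ρ (u s) ≤ (y0 + b * I) * √(lowEnergy α ρ (u s)) := by
        nth_rewrite 1 [← Real.mul_self_sqrt (hY ρ s)]
        gcongr
      have h7 : 2 * μ * lowDiss ρ (u s)
          ≤ 2 * (k * ρ ^ 2) * ((y0 + b * I) * √(lowEnergy α ρ (u s))) := by
        calc _ ≤ 2 * μ * ((2 * Real.pi * ρ) ^ 2 * lowEnergy α ρ (u s)) := by gcongr
          _ = 2 * (k * ρ ^ 2) * lowEnergy α ρ (u s) := by rw [hk]; ring
          _ ≤ _ := by gcongr
      linarith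

/-! ### Decay of the energy -/

theorem EnergyEstimates.energy_nonneg {c C : ℝ} {E : ℝ → ℝ} {Y : ℝ → ℝ → ℝ}
    (h : EnergyEstimates c C E Y) {t : ℝ} (ht : 0 ≤ t) : 0 ≤ E t :=
  (h.low_nonneg 0 t).trans (h.low_le 0 t ht)

/-- One step of the Fourier splitting method: a bound on `∫₀ᵗ E` and on the low frequencies of the
initial value yields decay of `E`. -/
theorem exists_energy_le {c C J M K e a b : ℝ} (hc : 0 < c) (hC : 0 < C) (hJ : 0 ≤ J)
    (hM : 0 ≤ M) (hK : 0 ≤ K) (ha : 0 ≤ a) (ha2 : a ≤ 2) (hb : 0 ≤ b) (hae : a ≤ e)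
    (hab : a ≤ 5 / 2 - 2 * b) :
    ∃ A : ℝ, 0 ≤ A ∧ ∀ E Y, EnergyEstimates c C E Y → E 0 ≤ K →
      (∀ ρ, 0 < ρ → ρ ≤ 1 → √(Y ρ 0) ≤ M * ρ ^ e) →
      (∀ t, 0 ≤ t → ∫ s in (0 : ℝ)..t, E s ≤ J * (1 + t) ^ b) →
      ∀ t, 0 ≤ t → E t ≤ A * (1 + t) ^ (-a) := by
  -- With `ρ² = B / T` the splitting factor `1 + c ρ² T` equals `8`, which beats the loss of at most
  -- `4` in passing from `1 + T` to `1 + 2T` when `a ≤ 2`.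
  set B := 7 / c with hB
  have hB0 : 0 < B := by positivity
  set T₀ := max B 1
  have hT₀ : 0 < T₀ := zero_lt_one.trans_le (le_max_right _ _)
  set N := M + C * J * (3 * B) ^ b
  have hN : 0 ≤ N := by positivity
  -- The first term covers `t ≤ 2 T₀`. The second makes the doubling step close: it produces `A / 2
  -- + 16 N² B^a`, which must not exceed `A`.
  set A := K * (1 + 2 * T₀) ^ a + 32 * (N ^ 2 * B ^ a)
  have hA : 0 ≤ A := by positivity
  have two_pow : (2 : ℝ) ^ a ≤ 4 := by
    calc (2 : ℝ) ^ a ≤ 2 ^ (2 : ℝ) := Real.rpow_le_rpow_of_exponent_le one_le_two ha2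
      _ = 4 := by norm_num
  have half : ∀ x y : ℝ, 0 < x → 0 < y → y ≤ 2 * x → x ^ (-a) ≤ 4 * y ^ (-a) := by
    intro x y hx hy hxy
    rw [Real.rpow_neg hx.le, Real.rpow_neg hy.le, ← div_eq_mul_inv, inv_eq_one_div,
      div_le_div_iff₀ (by positivity) (by positivity), one_mul]
    calc y ^ a ≤ (2 * x) ^ a := by gcongr
      _ = 2 ^ a * x ^ a := Real.mul_rpow zero_le_two hx.le
      _ ≤ 4 * x ^ a := by gcongr
  refine ⟨A, hA, fun E Y h hE0 hlow hint => ?_⟩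
  have hstep : ∀ T, T₀ ≤ T → E (2 * T) ≤ E T / 8 + N ^ 2 * B ^ a * T ^ (-a) := by
    intro T hT
    have hTp : 0 < T := hT₀.trans_le hT
    have hT1 : 1 ≤ T := (le_max_right _ _).trans hT
    set ρ := √(B / T)
    have hρ : 0 < ρ := Real.sqrt_pos.2 (by positivity)
    have hρ1 : ρ ≤ 1 := by
      rw [Real.sqrt_le_left zero_le_one, one_pow, div_le_one hTp]
      exact (le_max_left _ _).trans hT
    have hρ2 : ρ ^ 2 = B / T := Real.sq_sqrt (by positivity)
    have hq : c * ρ ^ 2 * T = 7 := by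
      rw [hρ2, hB]
      field_simp
    have hS : ∀ t ∈ Set.Icc T (2 * T), Y ρ t ≤ (N * ρ ^ a) ^ 2 := by
      intro t ht
      have ht0 : 0 ≤ t := hTp.le.trans ht.1
      have h1 := h.upper ρ hρ hρ1 t ht0
      have h2 : √(Y ρ 0) ≤ M * ρ ^ a := (hlow ρ hρ hρ1).trans
        (mul_le_mul_of_nonneg_left (Real.rpow_le_rpow_of_exponent_ge hρ hρ1 hae) hM)
      have h3 : ρ ^ (5 / 2 : ℝ) * (1 + t) ^ b ≤ (3 * B) ^ b * ρ ^ a := by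
        calc ρ ^ (5 / 2 : ℝ) * (1 + t) ^ b ≤ ρ ^ (5 / 2 : ℝ) * (3 * B * ρ ^ (-2 : ℝ)) ^ b := by
              gcongr
              rw [Real.rpow_neg hρ.le, Real.rpow_two, hρ2, inv_div]
              calc 1 + t ≤ 3 * T := by linarith [ht.2]
                _ = 3 * B * (T / B) := by field_simp
          _ = (3 * B) ^ b * ρ ^ (5 / 2 - 2 * b) := by
              rw [Real.mul_rpow (by positivity) (by positivity), ← Real.rpow_mul hρ.le,
                mul_left_comm, ← Real.rpow_add hρ]
              ring_nf
          _ ≤ (3 * B) ^ b * ρ ^ a := by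
              gcongr ?_ * ?_
              exact Real.rpow_le_rpow_of_exponent_ge hρ hρ1 hab
      have h4 : C * ρ ^ (5 / 2 : ℝ) * (∫ s in (0 : ℝ)..t, E s)
          ≤ C * J * (3 * B) ^ b * ρ ^ a := by
        calc _ ≤ C * ρ ^ (5 / 2 : ℝ) * (J * (1 + t) ^ b) := by
              gcongr
              exact hint t ht0
          _ = C * J * (ρ ^ (5 / 2 : ℝ) * (1 + t) ^ b) := by ring
          _ ≤ C * J * ((3 * B) ^ b * ρ ^ a) := by gcongr
          _ = _ := by ring
      have h5 : √(Y ρ t) ≤ N * ρ ^ a := by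
        calc _ ≤ _ := h1
          _ ≤ M * ρ ^ a + C * J * (3 * B) ^ b * ρ ^ a := add_le_add h2 h4
          _ = _ := by ring
      exact (Real.sqrt_le_left (by positivity)).1 h5
    have h6 := h.split ρ hρ hρ1 T hTp.le _ hS
    have h7 : (N * ρ ^ a) ^ 2 = N ^ 2 * B ^ a * T ^ (-a) := by
      rw [mul_pow, ← Real.rpow_natCast (ρ ^ a), ← Real.rpow_mul hρ.le, mul_comm a,
        Real.rpow_mul hρ.le, Real.rpow_natCast, hρ2, Real.div_rpow hB0.le hTp.le,
        Real.rpow_neg hTp.le]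
      ring
    rw [hq, h7] at h6
    have h8 : 0 ≤ N ^ 2 * B ^ a * T ^ (-a) := by positivity
    linarith
  have hind : ∀ n : ℕ, ∀ t, 0 ≤ t → t ≤ 2 ^ n * (2 * T₀) → E t ≤ A * (1 + t) ^ (-a) := by
    have hbase : ∀ t, 0 ≤ t → t ≤ 2 * T₀ → E t ≤ A * (1 + t) ^ (-a) := by
      intro t ht0 ht
      have h1 : E t ≤ K := (h.anti (Set.mem_Ici.2 le_rfl) (Set.mem_Ici.2 ht0) ht0).trans hE0
      rw [Real.rpow_neg (by positivity), ← div_eq_mul_inv, le_div_iff₀ (by positivity)]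
      calc E t * (1 + t) ^ a ≤ K * (1 + 2 * T₀) ^ a := by gcongr
        _ ≤ A := le_add_of_nonneg_right (by positivity)
    intro n
    induction n with
    | zero => simpa using hbase
    | succ n ih =>
      intro t ht0 ht
      rcases le_or_gt t (2 * T₀) with h1 | h1
      · exact hbase t ht0 h1
      obtain ⟨T, rfl⟩ : ∃ T, t = 2 * T := ⟨t / 2, by ring⟩
      have hTT : T₀ ≤ T := by linarith
      have hT1 : 1 ≤ T := (le_max_right _ _).trans hTT
      have hTp : 0 < T := hT₀.trans_le hTT
      have h2 := ih T hTp.le (by rw [pow_succ] at ht; linarith)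
      have h3 := half T (1 + T) hTp (by positivity) (by linarith)
      have h4 := half (1 + T) (1 + 2 * T) (by positivity) (by positivity) (by linarith)
      have hx : 0 ≤ N ^ 2 * B ^ a := by positivity
      calc E (2 * T) ≤ E T / 8 + N ^ 2 * B ^ a * T ^ (-a) := hstep T hTT
        _ ≤ A * (1 + T) ^ (-a) / 8 + N ^ 2 * B ^ a * (4 * (1 + T) ^ (-a)) := by gcongr
        _ = (A / 8 + 4 * (N ^ 2 * B ^ a)) * (1 + T) ^ (-a) := by ring
        _ ≤ (A / 8 + 4 * (N ^ 2 * B ^ a)) * (4 * (1 + 2 * T) ^ (-a)) := by gcongr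
        _ = (A / 2 + 16 * (N ^ 2 * B ^ a)) * (1 + 2 * T) ^ (-a) := by ring
        _ ≤ A * (1 + 2 * T) ^ (-a) := by
            gcongr
            have : 0 ≤ K * (1 + 2 * T₀) ^ a := by positivity
            linarith
  intro t ht
  obtain ⟨n, hn⟩ := pow_unbounded_of_one_lt t (one_lt_two (α := ℝ))
  refine hind n t ht (hn.le.trans ?_)
  have : (1 : ℝ) ≤ 2 * T₀ := by linarith [le_max_right B 1]
  exact le_mul_of_one_le_right (by positivity) this

theorem integral_le_of_decay {E : ℝ → ℝ} {A a : ℝ} (hE : AntitoneOn E (Set.Ici 0)) (hA : 0 ≤ A)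
    (ha : a < 1) (h : ∀ t, 0 ≤ t → E t ≤ A * (1 + t) ^ (-a)) {t : ℝ} (ht : 0 ≤ t) :
    ∫ s in (0 : ℝ)..t, E s ≤ A / (1 - a) * (1 + t) ^ (1 - a) := by
  have hEi : IntervalIntegrable E volume 0 t := by
    refine AntitoneOn.intervalIntegrable ?_
    rw [Set.uIcc_of_le ht]
    exact hE.mono Set.Icc_subset_Ici_self
  have ha1 : 0 < 1 - a := by linarith
  have hc : ContinuousOn (fun s : ℝ => A * (1 + s) ^ (-a)) (Set.uIcc 0 t) := by
    rw [Set.uIcc_of_le ht]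
    refine continuousOn_const.mul (ContinuousOn.rpow_const (by fun_prop) fun s hs => Or.inl ?_)
    have := hs.1
    positivity
  have hd : ∀ s ∈ Set.uIcc 0 t,
      HasDerivAt (fun s : ℝ => A / (1 - a) * (1 + s) ^ (1 - a)) (A * (1 + s) ^ (-a)) s := by
    intro s hs
    rw [Set.uIcc_of_le ht] at hs
    have hs0 : 1 + s ≠ 0 := by have := hs.1; positivity
    have h1 := (((hasDerivAt_id s).const_add 1).rpow_const (p := 1 - a) (Or.inl hs0)).const_mul
      (A / (1 - a))
    rw [show 1 - a - 1 = -a by ring] at h1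
    refine h1.congr_deriv ?_
    simp only [id]
    field_simp
  calc ∫ s in (0 : ℝ)..t, E s ≤ ∫ s in (0 : ℝ)..t, A * (1 + s) ^ (-a) :=
        intervalIntegral.integral_mono_on ht hEi hc.intervalIntegrable fun s hs => h s hs.1
    _ = A / (1 - a) * (1 + t) ^ (1 - a) - A / (1 - a) * (1 + 0) ^ (1 - a) :=
        intervalIntegral.integral_eq_sub_of_hasDerivAt hd hc.intervalIntegrable
    _ ≤ _ := sub_le_self _ (by positivity)

theorem exists_le_energy {c C J κ ρ₁ r b : ℝ} (hC : 0 < C) (hJ : 0 ≤ J) (hκ : 0 < κ)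
    (hρ₁ : 0 < ρ₁) (hr : r < 1) (hb : b ≤ (1 - r) / 2) :
    ∃ A : ℝ, 0 < A ∧ ∀ E Y, EnergyEstimates c C E Y →
      (∀ ρ, 0 < ρ → ρ ≤ ρ₁ → κ * ρ ^ (3 / 2 + r) ≤ √(Y ρ 0)) →
      (∀ t, 0 ≤ t → ∫ s in (0 : ℝ)..t, E s ≤ J * (1 + t) ^ b) →
      ∀ t, 0 ≤ t → A * (1 + t) ^ (-(3 / 2 + r)) ≤ E t := by
  have h1r : 0 < 1 - r := by linarith
  -- `h` is chosen so that viscosity removes at most half of `√(Y ρ 0)` and, through `h^(1-r) ≤ θ`,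
  -- the nonlinear contribution is at most `κ/6` times `ρ^(3/2+r)`. Positivity of `1 - r` is
  -- essential here.
  set θ := κ / (6 * C * (J + 1)) with hθ
  have hθ0 : 0 < θ := by positivity
  set h := min (min 1 ρ₁) (min (√(1 / (2 * C))) (θ ^ (1 - r)⁻¹))
  have hh : 0 < h := lt_min (lt_min one_pos hρ₁)
    (lt_min (Real.sqrt_pos.2 (by positivity)) (by positivity))
  have hh1 : h ≤ 1 := (min_le_left _ _).trans (min_le_left _ _)
  have hhρ : h ≤ ρ₁ := (min_le_left _ _).trans (min_le_right _ _)
  have hhC : C * h ^ 2 ≤ 1 / 2 := by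
    have h1 : h ≤ √(1 / (2 * C)) := (min_le_right _ _).trans (min_le_left _ _)
    calc C * h ^ 2 ≤ C * √(1 / (2 * C)) ^ 2 := by gcongr
      _ = 1 / 2 := by
        rw [Real.sq_sqrt (by positivity)]
        field_simp
  have hhθ : h ^ (1 - r) ≤ θ := by
    have h1 : h ≤ θ ^ (1 - r)⁻¹ := (min_le_right _ _).trans (min_le_right _ _)
    calc h ^ (1 - r) ≤ (θ ^ (1 - r)⁻¹) ^ (1 - r) := by gcongr
      _ = θ := Real.rpow_inv_rpow hθ0.le h1r.ne'
  refine ⟨(κ / 4) ^ 2 * h ^ (3 + 2 * r), by positivity, fun E Y hEY hlow hint t ht => ?_⟩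
  have ht1 : 0 < 1 + t := by positivity
  set ρ := h * (1 + t) ^ (-(1 / 2) : ℝ) with hρdef
  have hρ : 0 < ρ := by positivity
  have hρh : ρ ≤ h := mul_le_of_le_one_right hh.le
    (Real.rpow_le_one_of_one_le_of_nonpos (by linarith) (by norm_num))
  have hpow : ∀ x : ℝ, ρ ^ x = h ^ x * (1 + t) ^ (-(x / 2)) := fun x => by
    rw [hρdef, Real.mul_rpow hh.le (by positivity), ← Real.rpow_mul ht1.le]
    ring_nf
  have hsmall : C * ρ ^ 2 * t ≤ 1 / 2 := by
    have h1 : ρ ^ 2 = h ^ 2 * (1 + t)⁻¹ := by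
      rw [← Real.rpow_two, hpow, Real.rpow_two, ← Real.rpow_neg_one]
      norm_num
    have h2 : (1 + t)⁻¹ * t ≤ 1 := by
      rw [inv_mul_le_iff₀ ht1]
      linarith
    calc C * ρ ^ 2 * t = C * h ^ 2 * ((1 + t)⁻¹ * t) := by rw [h1]; ring
      _ ≤ 1 / 2 * 1 := by gcongr
      _ = 1 / 2 := mul_one _
  set I := ∫ s in (0 : ℝ)..t, E s
  have hI : 0 ≤ I := intervalIntegral.integral_nonneg ht fun s hs => hEY.energy_nonneg hs.1
  set z := ρ ^ (3 / 2 + r) with hz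
  have hz0 : 0 < z := by positivity
  have hnl : C * ρ ^ (5 / 2 : ℝ) * I ≤ κ / 6 * z := by
    have h1 : ρ ^ (5 / 2 : ℝ) * (1 + t) ^ b ≤ θ * z := by
      rw [hpow, mul_assoc, ← Real.rpow_add ht1]
      calc h ^ (5 / 2 : ℝ) * (1 + t) ^ (-(5 / 2 / 2) + b)
          ≤ h ^ (5 / 2 : ℝ) * (1 + t) ^ (-((3 / 2 + r) / 2)) := by
            gcongr ?_ * ?_
            exact Real.rpow_le_rpow_of_exponent_le (by linarith) (by linarith)
        _ = h ^ (1 - r) * z := by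
            rw [hz, hpow, ← mul_assoc, ← Real.rpow_add hh]
            ring_nf
        _ ≤ θ * z := by gcongr
    calc C * ρ ^ (5 / 2 : ℝ) * I ≤ C * ρ ^ (5 / 2 : ℝ) * (J * (1 + t) ^ b) := by
          gcongr
          exact hint t ht
      _ = C * J * (ρ ^ (5 / 2 : ℝ) * (1 + t) ^ b) := by ring
      _ ≤ C * (J + 1) * (θ * z) := by
          gcongr
          linarith
      _ = κ / 6 * z := by
          rw [hθ]
          field_simp
  have h1 := hEY.lower ρ hρ (hρh.trans hh1) t ht
  have h2 := hlow ρ hρ (hρh.trans hhρ)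
  rw [← hz] at h2
  have hn0 : 0 ≤ C * ρ ^ (5 / 2 : ℝ) * I := by positivity
  have h3 : C * ρ ^ 2 * t * (√(Y ρ 0) + C * ρ ^ (5 / 2 : ℝ) * I)
      ≤ 1 / 2 * (√(Y ρ 0) + C * ρ ^ (5 / 2 : ℝ) * I) := by gcongr
  -- The nonlinear contribution enters with coefficient `1 + 1/2`, so the remainder is `κ/2 -
  -- (3/2)(κ/6) = κ/4`.
  have h4 : κ / 4 * z ≤ √(Y ρ t) := by linarith
  have h5 : (κ / 4 * z) ^ 2 ≤ Y ρ t := by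
    rw [← Real.sq_sqrt (hEY.low_nonneg ρ t)]
    gcongr
  refine le_trans (le_of_eq ?_) (h5.trans (hEY.low_le ρ t ht))
  rw [mul_pow, hz, ← Real.rpow_natCast (ρ ^ _), ← Real.rpow_mul hρ.le, hpow, mul_assoc]
  push_cast
  ring_nf

/-- The lower bound for the energy in terms of the low frequencies of the initial value. -/
theorem exists_le_energy_of_low_frequencies {c C M K κ ρ₁ r : ℝ} (hc : 0 < c) (hC : 0 < C)
    (hM : 0 ≤ M) (hK : 0 ≤ K) (hκ : 0 < κ) (hρ₁ : 0 < ρ₁) (hr : r < 1) :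
    ∃ A : ℝ, 0 < A ∧ ∀ E Y, EnergyEstimates c C E Y → E 0 ≤ K →
      (∀ ρ, 0 < ρ → ρ ≤ ρ₁ → κ * ρ ^ (3 / 2 + r) ≤ √(Y ρ 0)) →
      (-1 < r → ∀ ρ, 0 < ρ → ρ ≤ 1 → √(Y ρ 0) ≤ M * ρ ^ ((1 + r) / 2)) →
      ∀ t, 0 ≤ t → A * (1 + t) ^ (-(3 / 2 + r)) ≤ E t := by
  have hone : ∀ E Y, EnergyEstimates c C E Y → E 0 ≤ K →
      ∀ t, 0 ≤ t → ∫ s in (0 : ℝ)..t, E s ≤ K * (1 + t) ^ (1 : ℝ) := by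
    intro E Y h hE0 t ht
    have h1 := integral_le_of_decay (a := 0) h.anti hK one_pos (fun t ht => by
      rw [neg_zero, Real.rpow_zero, mul_one]
      exact (h.anti (Set.mem_Ici.2 le_rfl) (Set.mem_Ici.2 ht) ht).trans hE0) ht
    simpa using h1
  rcases le_or_gt r (-1) with hr1 | hr1
  · obtain ⟨A, hA, h⟩ := exists_le_energy (c := c) (b := 1) hC hK hκ hρ₁ hr (by linarith)
    exact ⟨A, hA, fun E Y hEY hE0 hlow _ => h E Y hEY hlow (hone E Y hEY hE0)⟩
  -- From the trivial `b = 1`, one round of splitting allows rates up to `1/2` only, which need not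
  -- reach `(1 + r)/2`. The intermediate rate `(1 + r)/4` lowers `b` enough for the second round,
  -- and `1 - (1 + r)/2 = (1 - r)/2` is the required exponent.
  · obtain ⟨A₁, hA₁, h₁⟩ := exists_energy_le (a := (1 + r) / 4) (b := 1) (e := (1 + r) / 2) hc hC hK
      hM hK (by linarith) (by linarith) zero_le_one (by linarith) (by linarith)
    have hA₁' : 0 ≤ A₁ / (1 - (1 + r) / 4) := div_nonneg hA₁ (by linarith)
    obtain ⟨A₂, hA₂, h₂⟩ := exists_energy_le (a := (1 + r) / 2) (b := 1 - (1 + r) / 4)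
      (e := (1 + r) / 2) hc hC hA₁' hM hK (by linarith) (by linarith) (by linarith) le_rfl
      (by linarith)
    have hA₂' : 0 ≤ A₂ / (1 - (1 + r) / 2) := div_nonneg hA₂ (by linarith)
    obtain ⟨A, hA, h⟩ := exists_le_energy (c := c) (b := 1 - (1 + r) / 2) hC hA₂' hκ hρ₁ hr
      (by linarith)
    refine ⟨A, hA, fun E Y hEY hE0 hlow hup => h E Y hEY hlow fun t ht => ?_⟩
    have i1 := fun t ht => integral_le_of_decay hEY.anti hA₁ (by linarith)
      (h₁ E Y hEY hE0 (hup hr1) (hone E Y hEY hE0)) (t := t) ht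
    exact integral_le_of_decay hEY.anti hA₂ (by linarith) (h₂ E Y hEY hE0 (hup hr1) i1) ht

/-! ### The decay character and the low frequencies -/

theorem ofReal_rpow_mul_cancel {ρ : ℝ} (hρ : 0 < ρ) (s : ℝ) (x : ℝ≥0∞) :
    ENNReal.ofReal (ρ ^ s) * (ENNReal.ofReal (ρ ^ (-s)) * x) = x := by
  rw [← mul_assoc, ← ENNReal.ofReal_mul (by positivity), ← Real.rpow_add hρ, add_neg_cancel,
    Real.rpow_zero, ENNReal.ofReal_one, one_mul]

theorem exists_le_lowFreqEnergy {r : ℝ} {v : VF} (h : 0 < lowerDecayIndicator r v) :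
    ∃ κ ρ₁ : ℝ, 0 < κ ∧ 0 < ρ₁ ∧ ∀ ρ, 0 < ρ → ρ < ρ₁ →
      ENNReal.ofReal (κ * ρ ^ (2 * r + 3)) ≤ lowFreqEnergy v ρ := by
  obtain ⟨κ, hκ0, hκ⟩ := ENNReal.lt_iff_exists_nnreal_btwn.1 h
  have hev := eventually_lt_of_lt_liminf hκ
  obtain ⟨ρ₁, hρ₁, hsub⟩ := mem_nhdsGT_iff_exists_Ioo_subset.1 hev
  refine ⟨κ, ρ₁, by exact_mod_cast hκ0, hρ₁, fun ρ hρ hlt => ?_⟩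
  have h1 : (κ : ℝ≥0∞) < ENNReal.ofReal (ρ ^ (-2 * r - 3)) * lowFreqEnergy v ρ := hsub ⟨hρ, hlt⟩
  rw [← ofReal_rpow_mul_cancel hρ (2 * r + 3) (lowFreqEnergy v ρ), mul_comm (κ : ℝ),
    ENNReal.ofReal_mul (by positivity), ENNReal.ofReal_coe_nnreal]
  gcongr
  rw [show -(2 * r + 3) = -2 * r - 3 by ring]
  exact h1.le

/-- The supremum defining the character need not be attained, so `P_r(v)₊` may be infinite at `r`
itself. An exponent strictly below `r` is always available, and a strict loss is affordable in the
upper bounds. -/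
theorem exists_lowFreqEnergy_le {r r' : ℝ} {v : VF} (h : upperDecayCharacter v = (r : EReal))
    (hr : r' < r) : ∃ M ρ₁ : ℝ, 0 ≤ M ∧ 0 < ρ₁ ∧ ∀ ρ, 0 < ρ → ρ < ρ₁ →
      lowFreqEnergy v ρ ≤ ENNReal.ofReal (M * ρ ^ (2 * r' + 3)) := by
  have hlt : (r' : EReal) < upperDecayCharacter v := by
    rw [h]
    exact_mod_cast hr
  obtain ⟨-, ⟨s, hs, rfl⟩, hrs⟩ := lt_sSup_iff.1 hlt
  rw [EReal.coe_lt_coe_iff] at hrs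
  obtain ⟨M, hM, -⟩ := ENNReal.lt_iff_exists_nnreal_btwn.1 (hs : upperDecayIndicator s v < ⊤)
  have hev := eventually_lt_of_limsup_lt hM
  obtain ⟨ρ₁, hρ₁, hsub⟩ := mem_nhdsGT_iff_exists_Ioo_subset.1 hev
  refine ⟨M, min ρ₁ 1, M.2, lt_min hρ₁ one_pos, fun ρ hρ hlt => ?_⟩
  have h1 : ENNReal.ofReal (ρ ^ (-2 * s - 3)) * lowFreqEnergy v ρ < M :=
    hsub ⟨hρ, hlt.trans_le (min_le_left _ _)⟩
  have h2 : ρ ^ (2 * s + 3) ≤ ρ ^ (2 * r' + 3) :=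
    Real.rpow_le_rpow_of_exponent_ge hρ (hlt.trans_le (min_le_right _ _)).le (by linarith)
  rw [← ofReal_rpow_mul_cancel hρ (2 * s + 3) (lowFreqEnergy v ρ), mul_comm (M : ℝ),
    ENNReal.ofReal_mul (by positivity), ENNReal.ofReal_coe_nnreal]
  gcongr
  rw [show -(2 * s + 3) = -2 * s - 3 by ring]
  exact h1.le

theorem lowFreqEnergy_eq (v : VF) (ρ : ℝ) : lowFreqEnergy v (2 * Real.pi * ρ)
    = ENNReal.ofReal ((2 * Real.pi) ^ 3 * ∫ ξ in Metric.closedBall 0 ρ, sqFT v ξ) := by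
  have hpi := Real.two_pi_pos
  have h1 := Measure.setIntegral_comp_smul_of_pos (volume : Measure E3) (sqFT v)
    (Metric.closedBall 0 (2 * Real.pi * ρ)) (inv_pos.2 hpi)
  rw [smul_closedBall' (inv_pos.2 hpi).ne', smul_zero, Real.norm_of_nonneg (inv_pos.2 hpi).le,
    inv_mul_cancel_left₀ hpi.ne', finrank_euclideanSpace_fin, inv_pow, inv_inv, smul_eq_mul] at h1
  rw [← h1, ofReal_integral_eq_lintegral_ofReal
    ((integrable_sqFT v).comp_smul (inv_pos.2 hpi).ne').integrableOn
    (ae_of_all _ fun ξ => sqFT_nonneg v _)]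
  refine lintegral_congr fun ξ => ?_
  rw [sqFT, ENNReal.ofReal_sum_of_nonneg fun _ _ => sq_nonneg _]
  refine Finset.sum_congr rfl fun i _ => ?_
  rw [ENNReal.ofReal_pow (norm_nonneg _), ofReal_norm]
  rfl

theorem setIntegral_sqFT_le_lowEnergy {α : ℝ} (hα : 0 < α) (ρ : ℝ) (v : VF) :
    ∫ ξ in Metric.closedBall 0 ρ, sqFT v ξ ≤ lowEnergy α ρ v :=
  setIntegral_mono_on (integrable_sqFT v).integrableOn (integrableOn_wt_mul_sqFT α ρ v)
    measurableSet_closedBall fun ξ _ => le_mul_of_one_le_left (sqFT_nonneg v ξ) (one_le_wt hα ξ)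

theorem lowEnergy_le_setIntegral_sqFT {α : ℝ} (hα : 0 < α) {ρ : ℝ} (hρ1 : ρ ≤ 1) (v : VF) :
    lowEnergy α ρ v ≤ (1 + α * (2 * Real.pi) ^ 2) * ∫ ξ in Metric.closedBall 0 ρ, sqFT v ξ := by
  rw [← integral_const_mul]
  refine setIntegral_mono_on (integrableOn_wt_mul_sqFT α ρ v)
    ((integrable_sqFT v).integrableOn.const_mul _) measurableSet_closedBall fun ξ hξ => ?_
  rw [mem_closedBall_zero_iff] at hξ
  refine mul_le_mul_of_nonneg_right ?_ (sqFT_nonneg v ξ)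
  have := Real.pi_pos
  have h1 : 2 * Real.pi * ‖ξ‖ ≤ 2 * Real.pi :=
    mul_le_of_le_one_right (by positivity) (hξ.trans hρ1)
  unfold wt
  gcongr

theorem le_sqrt_lowEnergy {α κ ρ₁ r : ℝ} (hα : 0 < α) (hκ : 0 < κ) (hr : -3 / 2 < r) {v : VF}
    (h : ∀ ρ, 0 < ρ → ρ < ρ₁ → ENNReal.ofReal (κ * ρ ^ (2 * r + 3)) ≤ lowFreqEnergy v ρ)
    {ρ : ℝ} (hρ : 0 < ρ) (hρρ : 2 * Real.pi * ρ < ρ₁) :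
    √(κ / (2 * Real.pi) ^ 3) * ρ ^ (3 / 2 + r) ≤ √(lowEnergy α ρ v) := by
  have hpi := Real.pi_pos
  have hL : 0 ≤ ∫ ξ in Metric.closedBall 0 ρ, sqFT v ξ := integral_nonneg fun ξ => sqFT_nonneg v ξ
  have h1 := h (2 * Real.pi * ρ) (by positivity) hρρ
  rw [lowFreqEnergy_eq, ENNReal.ofReal_le_ofReal_iff (by positivity)] at h1
  have h2 : ρ ≤ 2 * Real.pi * ρ :=
    le_mul_of_one_le_left hρ.le (by linarith [Real.pi_gt_three])
  have h3 : κ * ρ ^ (2 * r + 3) ≤ κ * (2 * Real.pi * ρ) ^ (2 * r + 3) := by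
    gcongr
    linarith
  apply Real.le_sqrt_of_sq_le
  refine le_trans ?_ (setIntegral_sqFT_le_lowEnergy hα ρ v)
  rw [mul_pow, Real.sq_sqrt (by positivity), ← Real.rpow_natCast (ρ ^ (3 / 2 + r)),
    ← Real.rpow_mul hρ.le, div_mul_eq_mul_div, div_le_iff₀ (by positivity)]
  calc _ = κ * ρ ^ (2 * r + 3) := by push_cast; ring_nf
    _ ≤ _ := h3
    _ ≤ _ := h1
    _ = _ := mul_comm _ _

theorem sqrt_lowEnergy_le {α M K ρ₁ s : ℝ} (hα : 0 < α) (hM : 0 ≤ M) (hρ₁ : 0 < ρ₁) (hs : 0 ≤ s)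
    (hs3 : s ≤ 3) {v : VF}
    (h : ∀ ρ, 0 < ρ → ρ < ρ₁ → lowFreqEnergy v ρ ≤ ENNReal.ofReal (M * ρ ^ s))
    (hK : 0 ≤ K) (hle : ∀ ρ, lowEnergy α ρ v ≤ K) {ρ : ℝ} (hρ : 0 < ρ) (hρ1 : ρ ≤ 1) :
    √(lowEnergy α ρ v)
      ≤ √((1 + α * (2 * Real.pi) ^ 2) * M + K * (2 * Real.pi / ρ₁) ^ s) * ρ ^ (s / 2) := by
  have hpi := Real.pi_pos
  rw [Real.sqrt_le_left (by positivity), mul_pow, Real.sq_sqrt (by positivity),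
    ← Real.rpow_natCast (ρ ^ (s / 2)), ← Real.rpow_mul hρ.le]
  push_cast
  rw [div_mul_cancel₀ s two_ne_zero, add_mul]
  rcases lt_or_ge (2 * Real.pi * ρ) ρ₁ with h1 | h1
  · have h2 := h (2 * Real.pi * ρ) (by positivity) h1
    rw [lowFreqEnergy_eq, ENNReal.ofReal_le_ofReal_iff (by positivity),
      Real.mul_rpow (by positivity) hρ.le] at h2
    have h3 : (2 * Real.pi) ^ s ≤ (2 * Real.pi) ^ 3 := by
      rw [← Real.rpow_natCast (2 * Real.pi) 3]
      exact Real.rpow_le_rpow_of_exponent_le (by linarith [Real.pi_gt_three]) (by exact_mod_cast hs3)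
    have h4 : ∫ ξ in Metric.closedBall 0 ρ, sqFT v ξ ≤ M * ρ ^ s := by
      refine le_of_mul_le_mul_left (h2.trans ?_) (by positivity : 0 < (2 * Real.pi) ^ 3)
      calc M * ((2 * Real.pi) ^ s * ρ ^ s) ≤ M * ((2 * Real.pi) ^ 3 * ρ ^ s) := by gcongr
        _ = _ := by ring
    calc lowEnergy α ρ v ≤ _ := lowEnergy_le_setIntegral_sqFT hα hρ1 v
      _ ≤ (1 + α * (2 * Real.pi) ^ 2) * (M * ρ ^ s) := by gcongr
      _ = (1 + α * (2 * Real.pi) ^ 2) * M * ρ ^ s := by ring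
      _ ≤ _ := le_add_of_nonneg_right (by positivity)
  -- Beyond the range of the low-frequency hypothesis, `ρ` is bounded below, and the total energy
  -- `K` suffices.
  · have h2 : 1 ≤ (2 * Real.pi / ρ₁) ^ s * ρ ^ s := by
      rw [← Real.mul_rpow (by positivity) hρ.le]
      refine Real.one_le_rpow ?_ hs
      rw [div_mul_eq_mul_div, one_le_div hρ₁]
      exact h1
    calc lowEnergy α ρ v ≤ K := hle ρ
      _ ≤ K * ((2 * Real.pi / ρ₁) ^ s * ρ ^ s) := le_mul_of_one_le_right hK h2
      _ = K * (2 * Real.pi / ρ₁) ^ s * ρ ^ s := by ring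
      _ ≤ _ := le_add_of_nonneg_left (by positivity)

end SecondGrade
end

/-! ### The lower bound for weak solutions -/

theorem mainTheorem3 (α μ : ℝ) (hα : 0 < α) (hμ : 0 < μ) :
    ∃ ε : ℝ, 0 < ε ∧
      ∀ r : ℝ, -3 / 2 < r → r < 1 →
      ∀ (K ρ₀ : ℝ) (m : ℝ → ENNReal), 0 < ρ₀ →
      ∃ C : ℝ, 0 < C ∧
        ∀ u₀ : SecondGrade.VF,
          SecondGrade.MemHs 4 u₀ → SecondGrade.IsDivFree u₀ →
          SecondGrade.v2Norm α u₀ < ε →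
          SecondGrade.upperDecayCharacter u₀ = (r : EReal) →
          0 < SecondGrade.lowerDecayIndicator r u₀ →
          SecondGrade.h1AlphaNorm α u₀ = K →
          (∀ ρ : ℝ, 0 < ρ → ρ ≤ ρ₀ → SecondGrade.lowFreqEnergy u₀ ρ = m ρ) →
          ∀ u : ℝ → SecondGrade.VF, SecondGrade.IsWeakSolution α μ u₀ u →
            ∀ t : ℝ, 0 ≤ t →
              C * (t + 1) ^ (-(min (3 / 2 + r) (5 / 2))) ≤ SecondGrade.h1AlphaNorm α (u t) ^ 2 := by
  refine ⟨1, one_pos, fun r hr hr1 K ρ₀ m hρ₀ => ?_⟩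
  -- The constant may depend on the profile `m` but not on `u₀`. All constants are taken from one
  -- representative `v` with that profile, and transferred to any other `u₀` through equality of the
  -- profiles below `ρ₀`; without a representative there is nothing to prove.
  by_cases hex : ∃ v, SecondGrade.upperDecayCharacter v = (r : EReal) ∧
      0 < SecondGrade.lowerDecayIndicator r v ∧
      ∀ ρ : ℝ, 0 < ρ → ρ ≤ ρ₀ → SecondGrade.lowFreqEnergy v ρ = m ρ
  swap
  · exact ⟨1, one_pos, fun v _ _ _ h1 h2 _ h3 => (hex ⟨v, h1, h2, h3⟩).elim⟩
  obtain ⟨v, hv1, hv2, hv3⟩ := hex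
  obtain ⟨κ, ρ₁, hκ, hρ₁, hlow⟩ := SecondGrade.exists_le_lowFreqEnergy hv2
  -- With `r' = r/2 - 1` the exponent `2r' + 3` is `1 + r`, and `r' < r` because `r > -2`.
  obtain ⟨M, ρ₂, hM, hρ₂, hup⟩ := SecondGrade.exists_lowFreqEnergy_le (r' := r / 2 - 1) hv1
    (by linarith)
  obtain ⟨c, C, hc, hC, hest⟩ := SecondGrade.exists_energyEstimates hα hμ
  have hpi := Real.two_pi_pos
  -- The powers of `2π` translate between the two normalizations of the frequency; the extra factor
  -- `2` in `ρ₁` turns `≤` into the strict inequality needed below.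
  obtain ⟨A, hA, hfin⟩ := SecondGrade.exists_le_energy_of_low_frequencies
    (M := √((1 + α * (2 * Real.pi) ^ 2) * M + K ^ 2 * (2 * Real.pi / min ρ₂ ρ₀) ^ (1 + r)))
    (K := K ^ 2) (κ := √(κ / (2 * Real.pi) ^ 3)) (ρ₁ := min ρ₁ ρ₀ / (2 * (2 * Real.pi)))
    hc hC (Real.sqrt_nonneg _) (sq_nonneg K) (Real.sqrt_pos.2 (by positivity))
    (div_pos (lt_min hρ₁ hρ₀) (by positivity)) hr1
  refine ⟨A, hA, fun u₀ h4 _ _ _ _ hK hm u hu t ht => ?_⟩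
  obtain ⟨u', hu'⟩ := hu
  have hWP : ∀ i j, SecondGrade.HasWP j (u₀ i) (SecondGrade.weakPartial j (u₀ i)) := fun i j => by
    obtain ⟨g, hg⟩ := SecondGrade.exists_hasWP_of_memHs (fun i => (h4 i).mono (by norm_num)) i j
    exact hg.hasWP_weakPartial
  have hE0 : SecondGrade.h1AlphaNormSq α u₀ = K ^ 2 := by
    rw [← hK, SecondGrade.h1AlphaNorm, Real.sq_sqrt (SecondGrade.h1AlphaNormSq_nonneg hα _)]
  rw [SecondGrade.h1AlphaNorm, Real.sq_sqrt (SecondGrade.h1AlphaNormSq_nonneg hα _),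
    min_eq_left (by linarith), add_comm t]
  refine hfin _ _ (hest u₀ u u' hWP hu') ?_ (fun ρ hρ hρρ => ?_) (fun hr0 ρ hρ hρ1 => ?_) t ht
  · rw [hu'.apply_zero, hE0]
  · rw [hu'.apply_zero]
    refine SecondGrade.le_sqrt_lowEnergy (ρ₁ := min ρ₁ ρ₀) hα hκ hr (fun σ hσ hlt => ?_) hρ ?_
    · have hle := (hlt.trans_le (min_le_right _ _)).le
      rw [hm σ hσ hle, ← hv3 σ hσ hle]
      exact hlow σ hσ (hlt.trans_le (min_le_left _ _))
    · rw [le_div_iff₀ (by positivity)] at hρρ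
      nlinarith
  · rw [hu'.apply_zero]
    refine SecondGrade.sqrt_lowEnergy_le hα hM (lt_min hρ₂ hρ₀) (by linarith) (by linarith)
      (fun σ hσ hlt => ?_) (sq_nonneg K)
      (fun σ => hE0 ▸ SecondGrade.lowEnergy_le hα hWP σ) hρ hρ1
    have hle := (hlt.trans_le (min_le_right _ _)).le
    rw [hm σ hσ hle, ← hv3 σ hσ hle]
    refine (hup σ hσ (hlt.trans_le (min_le_left _ _))).trans (le_of_eq ?_)
    rw [show 2 * (r / 2 - 1) + 3 = 1 + r by ring]
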